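/- Let $q$ be an odd prime power, $n=2t$ with $t\ge 2$, $1<k\le t$, $s\ge 3$, and assume $n\nmid sk$. Let $\sigma$ be a generator of $\mathrm{Gal}(\mathbb F_{q^n}/\mathbb F_q)$, let $R=\mathbb F_{q^n}[x;\sigma]$ be the skew polynomial ring ($xa=\sigma(a)x$), and for a monic irreducible $F(y)\in\mathbb F_q[y]$ of degree $s$ with constant coefficient $F_0$ put $R_F=R/RF(x^n)$. For $\gamma\in\mathbb F_{q^n}$ let $$D_{n,s,k}(\gamma,F)=\Big\{a_0'+\sum_{i=1}^{sk-1}a_ix^i+\gamma a_0''x^{sk}+RF(x^n)\;:\;a_i\in\mathbb F_{q^n},\ a_0',a_0''\in\mathbb F_{q^t}\Big\}\subseteq R_F .$$ Call $(F,\gamma)$ admissible if $(-1)^{sk}F_0^k\,\mathrm N_{\mathbb F_{q^n}/\mathbb F_q}(\gamma)$ is not a square in $\mathbb F_q$. A code in $M_n(\mathbb F)$ is a subset with the distance $\mathrm{rk}(A-B)$. Codes $\mathcal C,\mathcal C'$ are equivalent if $\mathcal C'=\{XA^{\rho}Y+Z: A\in\mathcal C\}$ with $X,Y\in\mathrm{GL}_n(\mathbb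 F)$, $Z\in M_n(\mathbb F)$, $\rho\in\mathrm{Aut}(\mathbb F)$ acting entrywise. An $\mathbb F'$-linear code with minimum distance $d$ is MRD if its $\mathbb F'$-dimension is $n(n-d+1)[\mathbb F:\mathbb F']$. The left and right idealisers are $\mathcal I_\ell(\mathcal C)=\{A: A\mathcal C\subseteq\mathcal C\}$ and $\mathcal I_r(\mathcal C)=\{B:\mathcal CB\subseteq\mathcal C\}$, the centraliser $C(\mathcal C)$ consists of the matrices commuting with all elements of $\mathcal C$, and the centre is $Z(\mathcal C)=\mathcal I_\ell(\mathcal C)\cap C(\mathcal C)$. The nuclear parameters of a code containing the identity are $(|\mathcal C|,|\mathcal I_\ell(\mathcal C)|,|\mathcal I_r(\mathcal C)|,|C(\mathcal C)|,|Z(\mathcal C)|)$. The adjoint of $\mathcal C$ is $\{A^{\top}:A\in\mathcal C\}$ and its dual is $\{B:\mathrm{Tr}(\mathrm{tr}(AB^{\top}))=0\ \forall A\in\mathcal C\}$, with $\mathrm{Tr}$ the absolute trace of $\mathbb F$. Then admissible pairs $(F,\gamma)$ exist, and for every admissible pair one has $R_F\cong M_n(\mathbb F_{q^s})$ as rings and,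 under any such isomorphism, $D_{n,s,k}(\gamma,F)$ is an $\mathbb F_q$-linear MRD code in $M_n(\mathbb F_{q^s})$ with minimum distance $n-k+1$ that contains the identity, has nuclear parameters $(q^{nsk},q^t,q^t,q^s,q)$, and is new in the following sense: it is not equivalent to any of the codes below, nor to the adjoint, the dual, or the adjoint of the dual of any of them. The codes I)--V) lie in $\mathbb L[x;\sigma']/(x^n-1)\cong M_n(\mathbb F_Q)$, where $Q=q^s$, $\mathbb L=\mathbb F_{Q^n}$ and $\sigma'$ generates $\mathrm{Gal}(\mathbb L/\mathbb F_Q)$. * I) Generalized Gabidulin codes $\{\sum_{i<k'}a_ix^i: a_i\in\mathbb L\}$, $1\le k'\le n$. * II) AGTG codes $\{\sum_{i<k'}a_ix^i+\tau(a_0)\eta x^{k'}: a_i\in\mathbb L\}$, $1\le k'<n$, $\tau\in\mathrm{Aut}(\mathbb L)$, $\eta\in\mathbb L$, with $\mathrm N_{\mathbb L/\mathbb F_{q'}}(\eta)\,\mathrm N_{\mathbb F_Q/\mathbb F_{q'}}((-1)^{k'n})\ne1$, where $\mathbb F_{q'}$ is the fixed field of $\tau$ in $\mathbb F_Q$. *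 III) Trombetti--Zhou codes $\{a_0'+\sum_{0<i<k'}a_ix^i+\delta a_0''x^{k'}: a_i\in\mathbb L,\ a_0',a_0''\in\mathbb F_{Q^{t}}\}$, $1\le k'<n$, $\mathrm N_{\mathbb L/\mathbb F_Q}(\delta)$ not a square in $\mathbb F_Q$. * IV) Csajbók--Marino--Polverino--Zhou codes $\{a_0+a_1x+a_2x^3: a_i\in\mathbb L\}$, for $n=7$ and $Q$ odd, or $n=8$ and $Q\equiv1\pmod 3$. * V) Codes $\{a_0+a_1f(x): a_0,a_1\in\mathbb L\}$ with $f=\sum_{i<n}c_ix^i$ scattered, that is, with $f(\beta):=\sum_i c_i\sigma'^i(\beta)$, for nonzero $\beta,\delta\in\mathbb L$ the equality $f(\beta)/\beta=f(\delta)/\delta$ implies $\beta/\delta\in\mathbb F_Q$. * VI) Codes $S_{n,s',k'}(\eta,\rho,F')=\{\sum_{i<s'k'}a_ix^i+\eta\rho(a_0)x^{s'k'}+R'F'(x^n): a_i\in\mathbb L'\}\subseteq R'/R'F'(x^n)\cong M_n(\mathbb F_{q^s})$, where $\mathbb K'$ is a finite field, $\mathbb L'/\mathbb K'$ has degree $n$,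 $R'=\mathbb L'[x;\sigma']$ with $\sigma'$ a generator of $\mathrm{Gal}(\mathbb L'/\mathbb K')$, $F'\ne y$ is monic irreducible of degree $s'$ over $\mathbb K'$ with constant coefficient $F'_0$ (so $|\mathbb K'|^{s'}=q^s$), $1\le k'<n$, $\rho\in\mathrm{Aut}(\mathbb L')$, $\eta\in\mathbb L'$, and $\mathrm N_{\mathbb L'/\mathbb K''}(\eta)\,\mathrm N_{\mathbb K'/\mathbb K''}((-1)^{s'k'(n-1)}F_0'^{k'})\ne1$, where $\mathbb K''$ is the fixed field of $\rho$ in $\mathbb K'$. -/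

import Mathlib

open Polynomial

universe u

noncomputable section

namespace SkewMRD

section SkewRing

variable {K L : Type u} [Field K] [Field L] [Algebra K L]

/-- The field `L`, tagged with the automorphism `σ` that twists multiplication in `L[x;σ]`. -/
def Twisted (_σ : L ≃ₐ[K] L) : Type u := L

instance (σ : L ≃ₐ[K] L) : Field (Twisted σ) := inferInstanceAs (Field L)

/-- The exponent `n` of `x ^ n` acts on coefficients as `σ ^ n`, so that `x * a = σ a * x`. -/
instance (σ : L ≃ₐ[K] L) : MulSemiringAction (Multiplicative ℕ) (Twisted σ) :=
  MulSemiringAction.compHom L (powersHom (L ≃ₐ[K] L) σ)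

/-- The skew polynomial ring `L[x;σ]`. -/
abbrev SkewRing (σ : L ≃ₐ[K] L) : Type u := SkewPolynomial (Twisted σ)

/-- The skew monomial `a x ^ i`. -/
def mono (σ : L ≃ₐ[K] L) (i : ℕ) (a : L) : SkewRing σ :=
  SkewPolynomial.monomial (R := Twisted σ) i a

/-- The defining relation of `L[x;σ]`: `(a x ^ i) (b x ^ j) = a σ ^ i (b) x ^ (i + j)`. -/
theorem mono_mul_mono (σ : L ≃ₐ[K] L) (i j : ℕ) (a b : L) :
    mono σ i a * mono σ j b = mono σ (i + j) (a * (σ ^ i) b) :=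
  SkewMonoidAlgebra.single_mul_single

/-- The central element `F(x ^ n)` of `L[x;σ]`, where `n = [L : K]` and `F` is in `K[y]`. -/
def evalXPow (σ : L ≃ₐ[K] L) (F : K[X]) : SkewRing σ :=
  F.sum fun i c => mono σ (Module.finrank K L * i) (algebraMap K L c)

/-- The two-sided ideal `R F(x ^ n)` of `R = L[x;σ]`. -/
def modulus (σ : L ≃ₐ[K] L) (F : K[X]) : TwoSidedIdeal (SkewRing σ) :=
  TwoSidedIdeal.span {evalXPow σ F}

/-- The quotient ring `R_F = R / R F(x ^ n)`. -/
abbrev SkewQuot (σ : L ≃ₐ[K] L) (F : K[X]) : Type u := (modulus σ F).ringCon.Quotient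

/-- The projection from `R` onto `R_F`. -/
def toQuot (σ : L ≃ₐ[K] L) (F : K[X]) : SkewRing σ →+* SkewQuot σ F :=
  (modulus σ F).ringCon.mk'

/-- `σ` generates the Galois group of `L / K`. -/
def IsGenerator (σ : L ≃ₐ[K] L) : Prop := ∀ τ : L ≃ₐ[K] L, τ ∈ Subgroup.zpowers σ

/-- The elements of `K` that are fixed by the automorphism `ρ` of `L`. -/
def fixedBase (K : Type u) {L : Type u} [Field K] [Field L] [Algebra K L] (ρ : L ≃+* L) :
    Subfield K :=
  RingHom.eqLocusField ((ρ : L →+* L).comp (algebraMap K L)) (algebraMap K L)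

/-- The family `D_{n,s,k}(γ,F)`, with `s = deg F`: the classes of
`a₀' + ∑_{0 < i < sk} aᵢ x ^ i + γ a₀'' x ^ (sk)`, with `aᵢ ∈ L` and `a₀', a₀'' ∈ L'`. -/
def codeD (σ : L ≃ₐ[K] L) (L' : IntermediateField K L) (F : K[X]) (k : ℕ) (γ : L) :
    Set (SkewQuot σ F) :=
  {z | ∃ (a : ℕ → L) (a' a'' : L), a' ∈ L' ∧ a'' ∈ L' ∧
    z = toQuot σ F (mono σ 0 a' + ∑ i ∈ Finset.Ico 1 (F.natDegree * k), mono σ i (a i) +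
      mono σ (F.natDegree * k) (γ * a''))}

/-- The family `S_{n,s,k}(η,ρ,F)`, with `s = deg F`: the classes of
`∑_{i < sk} aᵢ x ^ i + η ρ(a₀) x ^ (sk)`, with `aᵢ ∈ L`. -/
def codeS (σ : L ≃ₐ[K] L) (ρ : L ≃+* L) (F : K[X]) (k : ℕ) (η : L) : Set (SkewQuot σ F) :=
  {z | ∃ a : ℕ → L, z = toQuot σ F (∑ i ∈ Finset.range (F.natDegree * k), mono σ i (a i) +
      mono σ (F.natDegree * k) (η * ρ (a 0)))}

/-- Generalized Gabidulin codes. -/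
def codeGabidulin (σ : L ≃ₐ[K] L) (k : ℕ) : Set (SkewQuot σ (X - 1 : K[X])) :=
  {z | ∃ a : ℕ → L, z = toQuot σ _ (∑ i ∈ Finset.range k, mono σ i (a i))}

/-- Additive generalized twisted Gabidulin codes. -/
def codeAGTG (σ : L ≃ₐ[K] L) (τ : L ≃+* L) (k : ℕ) (η : L) : Set (SkewQuot σ (X - 1 : K[X])) :=
  {z | ∃ a : ℕ → L,
    z = toQuot σ _ (∑ i ∈ Finset.range k, mono σ i (a i) + mono σ k (τ (a 0) * η))}

/-- Trombetti-Zhou codes. -/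
def codeTZ (σ : L ≃ₐ[K] L) (L' : IntermediateField K L) (k : ℕ) (γ : L) :
    Set (SkewQuot σ (X - 1 : K[X])) :=
  {z | ∃ (a : ℕ → L) (a' a'' : L), a' ∈ L' ∧ a'' ∈ L' ∧
    z = toQuot σ _ (mono σ 0 a' + ∑ i ∈ Finset.Ico 1 k, mono σ i (a i) + mono σ k (γ * a''))}

/-- The codes `{a₀ + a₁ x + a₂ x ^ 3}` of Csajbók, Marino, Polverino and Zhou. -/
def codeCMPZ (σ : L ≃ₐ[K] L) : Set (SkewQuot σ (X - 1 : K[X])) :=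
  {z | ∃ a₀ a₁ a₂ : L, z = toQuot σ _ (mono σ 0 a₀ + mono σ 1 a₁ + mono σ 3 a₂)}

/-- The codes `{a₀ + a₁ f(x)}`, where `f(x) = ∑_{i < n} cᵢ x ^ i`. -/
def codeTwoDim (σ : L ≃ₐ[K] L) (c : ℕ → L) : Set (SkewQuot σ (X - 1 : K[X])) :=
  {z | ∃ a₀ a₁ : L, z = toQuot σ _ (mono σ 0 a₀ +
    mono σ 0 a₁ * ∑ i ∈ Finset.range (Module.finrank K L), mono σ i (c i))}

/-- `f(x) = ∑_{i < n} cᵢ x ^ i` is scattered: the quotient `f(β) / β` of the `K`-linear map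
`β ↦ ∑_{i < n} cᵢ σ ^ i (β)` determines the nonzero element `β` of `L` up to a factor in `K`. -/
def IsScattered (σ : L ≃ₐ[K] L) (c : ℕ → L) : Prop :=
  ∀ β δ : L, β ≠ 0 → δ ≠ 0 →
    (∑ i ∈ Finset.range (Module.finrank K L), c i * (σ ^ i) β) / β =
      (∑ i ∈ Finset.range (Module.finrank K L), c i * (σ ^ i) δ) / δ →
    ∃ u : K, β = u • δ

end SkewRing

section RankMetric

variable {n : ℕ} {E : Type u} [Field E]

/-- `d` is the minimum rank distance of the code `C`. -/
def IsMinDist (C : Set (Matrix (Fin n) (Fin n) E)) (d : ℕ) : Prop :=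
  IsLeast {r : ℕ | ∃ A ∈ C, ∃ B ∈ C, A ≠ B ∧ r = (A - B).rank} d

/-- `C` is a `K`-linear MRD code with minimum distance `d`: it attains the Singleton-like bound
`dim_K C ≤ n (n - d + 1) [E : K]`. -/
def IsLinearMRD (K : Type u) [Field K] [Algebra K E] (C : Set (Matrix (Fin n) (Fin n) E))
    (d : ℕ) : Prop :=
  IsMinDist C d ∧ ∃ V : Submodule K (Matrix (Fin n) (Fin n) E),
    (V : Set (Matrix (Fin n) (Fin n) E)) = C ∧
      Module.finrank K V = n * (n - d + 1) * Module.finrank K E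

/-- Code equivalence: `C' = {X A^ρ Y + Z : A ∈ C}`, with `X`, `Y` invertible and `ρ` a field
automorphism acting entrywise. -/
def Equivalent (C C' : Set (Matrix (Fin n) (Fin n) E)) : Prop :=
  ∃ (P Q : (Matrix (Fin n) (Fin n) E)ˣ) (Z : Matrix (Fin n) (Fin n) E) (ρ : E ≃+* E),
    C' = (fun A : Matrix (Fin n) (Fin n) E =>
      (P : Matrix (Fin n) (Fin n) E) * A.map ρ * (Q : Matrix (Fin n) (Fin n) E) + Z) '' C

/-- The adjoint code. -/
def adjointCode (C : Set (Matrix (Fin n) (Fin n) E)) : Set (Matrix (Fin n) (Fin n) E) :=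
  Matrix.transpose '' C

/-- The Delsarte dual, for the form `(A, B) ↦ Tr(tr(A Bᵀ))`, where `Tr` is the absolute trace of
the finite field `E`. For a code that is linear over a subfield of `E` it makes no difference
whether the absolute trace or the trace onto that subfield is used. -/
def dualCode (C : Set (Matrix (Fin n) (Fin n) E)) : Set (Matrix (Fin n) (Fin n) E) :=
  letI : Algebra (ZMod (ringChar E)) E := ZMod.algebra E (ringChar E)
  {B | ∀ A ∈ C, Algebra.trace (ZMod (ringChar E)) E (A * B.transpose).trace = 0}

/-- The left idealiser. -/
def leftIdealiser (C : Set (Matrix (Fin n) (Fin n) E)) : Set (Matrix (Fin n) (Fin n) E) :=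
  {A | ∀ M ∈ C, A * M ∈ C}

/-- The right idealiser. -/
def rightIdealiser (C : Set (Matrix (Fin n) (Fin n) E)) : Set (Matrix (Fin n) (Fin n) E) :=
  {B | ∀ M ∈ C, M * B ∈ C}

/-- The centraliser. -/
def centraliser (C : Set (Matrix (Fin n) (Fin n) E)) : Set (Matrix (Fin n) (Fin n) E) :=
  {A | ∀ M ∈ C, A * M = M * A}

/-- The centre: the intersection of the left idealiser and the centraliser. -/
def centre (C : Set (Matrix (Fin n) (Fin n) E)) : Set (Matrix (Fin n) (Fin n) E) :=
  leftIdealiser C ∩ centraliser C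

/-- `C` contains the identity and has nuclear parameters `(a, b, c, d, e)`: these are the
numbers of elements of the code, its left and right idealiser, its centraliser and its centre. -/
def HasNuclearParameters (C : Set (Matrix (Fin n) (Fin n) E)) (a b c d e : ℕ) : Prop :=
  (1 : Matrix (Fin n) (Fin n) E) ∈ C ∧ C.ncard = a ∧ (leftIdealiser C).ncard = b ∧
    (rightIdealiser C).ncard = c ∧ (centraliser C).ncard = d ∧ (centre C).ncard = e

/-- The previously known MRD codes in `M_n(E)`, for a finite field `E`. A code given in `R_F` is
viewed in `M_n(E)` through a ring isomorphism from `R_F` to `M_n(E)`; any two choices of it give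
equivalent codes. The first five families live in `L[x;σ] / (x ^ n - 1)` with `[L : E] = n`; in
the last one the base field `K` is an arbitrary finite field, and the isomorphism forces
`|K| ^ deg F = |E|`. -/
inductive IsKnownCode : Set (Matrix (Fin n) (Fin n) E) → Prop
  /-- Generalized Gabidulin codes. -/
  | gabidulin (L : Type u) [Field L] [Algebra E L] (hn : Module.finrank E L = n)
      (σ : L ≃ₐ[E] L) (hσ : IsGenerator σ)
      (θ : SkewQuot σ (X - 1 : E[X]) ≃+* Matrix (Fin n) (Fin n) E)
      (k : ℕ) (hk : 1 ≤ k) (hkn : k ≤ n) :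
      IsKnownCode (θ '' codeGabidulin σ k)
  /-- Additive generalized twisted Gabidulin codes. -/
  | agtg (L : Type u) [Field L] [Algebra E L] (hn : Module.finrank E L = n)
      (σ : L ≃ₐ[E] L) (hσ : IsGenerator σ)
      (θ : SkewQuot σ (X - 1 : E[X]) ≃+* Matrix (Fin n) (Fin n) E)
      (k : ℕ) (hk : 1 ≤ k) (hkn : k < n) (τ : L ≃+* L) (η : L)
      (hη : Algebra.norm (fixedBase E τ) η * Algebra.norm (fixedBase E τ) ((-1 : E) ^ (k * n)) ≠ 1) :
      IsKnownCode (θ '' codeAGTG σ τ k η)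
  /-- Trombetti-Zhou codes. -/
  | trombettiZhou (L : Type u) [Field L] [Algebra E L] (hn : Module.finrank E L = n)
      (σ : L ≃ₐ[E] L) (hσ : IsGenerator σ)
      (θ : SkewQuot σ (X - 1 : E[X]) ≃+* Matrix (Fin n) (Fin n) E)
      (k : ℕ) (hk : 1 ≤ k) (hkn : k < n) (hn4 : 4 ≤ n)
      (L' : IntermediateField E L) (hL' : 2 * Module.finrank E L' = n)
      (γ : L) (hγ : ¬ IsSquare (Algebra.norm E γ)) :
      IsKnownCode (θ '' codeTZ σ L' k γ)
  /-- The codes of Csajbók, Marino, Polverino and Zhou. -/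
  | cmpz (L : Type u) [Field L] [Algebra E L] (hn : Module.finrank E L = n)
      (σ : L ≃ₐ[E] L) (hσ : IsGenerator σ)
      (θ : SkewQuot σ (X - 1 : E[X]) ≃+* Matrix (Fin n) (Fin n) E)
      (hcase : (n = 7 ∧ Odd (Nat.card E)) ∨ (n = 8 ∧ Nat.card E % 3 = 1)) :
      IsKnownCode (θ '' codeCMPZ σ)
  /-- Codes from scattered polynomials. -/
  | scattered (L : Type u) [Field L] [Algebra E L] (hn : Module.finrank E L = n)
      (σ : L ≃ₐ[E] L) (hσ : IsGenerator σ)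
      (θ : SkewQuot σ (X - 1 : E[X]) ≃+* Matrix (Fin n) (Fin n) E)
      (c : ℕ → L) (hc : IsScattered σ c) :
      IsKnownCode (θ '' codeTwoDim σ c)
  /-- The family `S_{n,s,k}(η,ρ,F)`. -/
  | skewTwisted (K L : Type u) [Field K] [Finite K] [Field L] [Algebra K L]
      (hn : Module.finrank K L = n) (σ : L ≃ₐ[K] L) (hσ : IsGenerator σ)
      (F : K[X]) (hF : F.Monic) (hirr : Irreducible F) (hFX : F ≠ X)
      (θ : SkewQuot σ F ≃+* Matrix (Fin n) (Fin n) E)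
      (k : ℕ) (hk : 1 ≤ k) (hkn : k < n) (ρ : L ≃+* L) (η : L)
      (hη : Algebra.norm (fixedBase K ρ) η * Algebra.norm (fixedBase K ρ)
        ((-1 : K) ^ (F.natDegree * k * (n - 1)) * F.coeff 0 ^ k) ≠ 1) :
      IsKnownCode (θ '' codeS σ ρ F k η)

/-- `C` is new: it is not equivalent to a known code, nor to the adjoint, the dual or the adjoint
of the dual of a known code. -/
def IsNew (C : Set (Matrix (Fin n) (Fin n) E)) : Prop :=
  ∀ C₀ : Set (Matrix (Fin n) (Fin n) E), IsKnownCode C₀ →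
    ¬ Equivalent C C₀ ∧ ¬ Equivalent C (adjointCode C₀) ∧
      ¬ Equivalent C (dualCode C₀) ∧ ¬ Equivalent C (adjointCode (dualCode C₀))

end RankMetric

end SkewMRD

end

set_option linter.unusedSectionVars false

/-! Write K = F_q, L = F_{q^n}, n = 2t, s = deg F, r = sk, R = L[x;σ] and N = ns. Since σ^n = 1, the
element F(x^n) is central, and each class of R_F has exactly one representative of degree less than
N. All computations with codes are done on coefficients of these representatives.

Matrix ring: a nonzero element of least degree in a two-sided ideal becomes, after scaling and
multiplication by a power of the unit x, some G(x^n) with F not dividing G, hence a unit. So R_F is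
simple (`isSimpleRing_skewQuot`). Wedderburn's theorems and a count of the ring and its centre,
which has q^s elements, give R_F ≅ M_n(F_{q^s}) (`nonempty_ringEquiv_matrix`).

Distance: if a nonzero f of degree at most sk has rank at most n - k, then R_F f is too small for h
↦ hf to be injective on degree at most s(n - k). By degrees, hf = cF(x^n) with c a nonzero constant,
and f has degree exactly sk (`exists_mul_eq_of_rank_le`). The reduced norm is multiplicative with
values in K[y], so the norm of f divides a scalar multiple of F^n, and by its degree it is a scalar
multiple of F^k. Its extreme coefficients give N(f_0) = (-1)^{sk} N(f_{sk}) F_0^k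
(`norm_of_mul_eq`). For a codeword, f_0 and f_{sk}/γ lie in L', over which L is quadratic, so their
norms are squares; hence (-1)^{sk} F_0^k N(γ) would be a square (`rank_codeD_gt`). Counting
codewords gives the opposite inequality.

Nuclear parameters: the code contains every c x^j with 0 < j < r, and N ≥ r + 2 leaves room for
degree arguments without reduction modulo F(x^n). They show that both idealisers consist of the
constants in L' (`leftStab_codeD`, `rightStab_codeD`).

Newness: for additive codes, equivalence preserves the sizes of the code, of its idealisers and of
the central part of the left idealiser. Transposition swaps the two idealisers and the dual
transposes them; as both have size q^t here, all four comparisons reduce to one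
(`invariants_of_equivalent`). Families I, III, IV and V have left idealisers with at least q^{st}
elements, too many. Family II is family VI with F' = y - 1. For VI with nonzero η the idealisers are
the sets ρ = id and ρ = φ in L', with φ = σ'^{s'k'}. If both have size q^t, then ρ is the involution
on the subfield of q^{2t} elements, which forces φ = id there (`apply_eq_self_of_card_fixed`). This
means n ∣ sk' with k' = k or k' = n - k, contrary to n ∤ sk (`not_invariants_codeS`). -/

namespace SkewMRD

/-! ### Coefficients and degrees in the skew polynomial ring. -/

section Coefficients

variable {K L : Type u} [Field K] [Field L] [Algebra K L] (σ : L ≃ₐ[K] L)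

/-- The coefficient of `x ^ i` in a skew polynomial, as an additive map. -/
noncomputable def cf (i : ℕ) : SkewRing σ →+ L where
  toFun f := SkewPolynomial.coeff f i
  map_zero' := rfl
  map_add' f g := by
    change SkewMonoidAlgebra.coeff (f + g) _ = _
    rw [SkewMonoidAlgebra.coeff_add]
    rfl

variable {σ}

theorem cf_mono (i j : ℕ) (a : L) : cf σ j (mono σ i a) = if i = j then a else 0 := by
  have := SkewPolynomial.coeff_monomial (R := Twisted σ) (n := i) (m := j) (a := a)
  exact this

@[simp] theorem cf_mono_self (i : ℕ) (a : L) : cf σ i (mono σ i a) = a := by simp [cf_mono]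

theorem cf_mono_ne {i j : ℕ} (h : i ≠ j) (a : L) : cf σ j (mono σ i a) = 0 := by simp [cf_mono, h]

@[simp] theorem mono_zero (i : ℕ) : mono σ i 0 = 0 :=
  SkewPolynomial.monomial_zero_right (R := Twisted σ) i

theorem mono_add (i : ℕ) (a b : L) : mono σ i (a + b) = mono σ i a + mono σ i b :=
  SkewPolynomial.monomial_add (R := Twisted σ) i a b

variable (σ) in
/-- The map `a ↦ a x ^ i`. -/
noncomputable def monoHom (i : ℕ) : L →+ SkewRing σ where
  toFun := mono σ i
  map_zero' := mono_zero i
  map_add' := mono_add i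

theorem mono_sub (i : ℕ) (a b : L) : mono σ i (a - b) = mono σ i a - mono σ i b :=
  (monoHom σ i).map_sub a b

theorem mono_zero_one : mono σ 0 1 = 1 := rfl

theorem skew_induction {p : SkewRing σ → Prop} (f : SkewRing σ) (hm : ∀ i a, p (mono σ i a))
    (hadd : ∀ f g, p f → p g → p (f + g)) : p f := by
  refine SkewPolynomial.induction (R := Twisted σ) f ?_ fun n r q _ _ hq => hadd _ _ (hm n r) hq
  simpa using hm 0 0

theorem skew_ext {f g : SkewRing σ} (h : ∀ i, cf σ i f = cf σ i g) : f = g := by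
  refine SkewMonoidAlgebra.ext fun i => ?_
  exact h i.toAdd

theorem cf_mul (f g : SkewRing σ) (k : ℕ) :
    cf σ k (f * g) = ∑ p ∈ Finset.HasAntidiagonal.antidiagonal k, cf σ p.1 f * (σ ^ p.1) (cf σ p.2 g) := by
  induction f using skew_induction with
  | hadd f f' h h' => simp [add_mul, h, h', Finset.sum_add_distrib]
  | hm i a =>
    induction g using skew_induction with
    | hadd f f' h h' => simp [mul_add, h, h', Finset.sum_add_distrib]
    | hm j b =>
      rw [mono_mul_mono]
      by_cases hij : i + j = k
      · subst hij
        rw [Finset.sum_eq_single (i, j)]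
        · simp
        · rintro ⟨i', j'⟩ hp hne
          simp only [Finset.HasAntidiagonal.mem_antidiagonal] at hp
          by_cases hi : i = i'
          · have : j ≠ j' := by rintro rfl; exact hne (by rw [hi])
            simp [cf_mono_ne this]
          · simp [cf_mono_ne hi]
        · simp
      · rw [cf_mono_ne hij, Finset.sum_eq_zero]
        rintro ⟨i', j'⟩ hp
        simp only [Finset.HasAntidiagonal.mem_antidiagonal] at hp
        by_cases hi : i = i'
        · have : j ≠ j' := by rintro rfl; exact hij (by rw [hi, hp])
          simp [cf_mono_ne this]
        · simp [cf_mono_ne hi]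

theorem cf_mul_mono (f : SkewRing σ) (i j : ℕ) (b : L) :
    cf σ (i + j) (f * mono σ j b) = cf σ i f * (σ ^ i) b := by
  rw [cf_mul, Finset.sum_eq_single (i, j)]
  · simp
  · rintro ⟨i', j'⟩ hp hne
    simp only [Finset.HasAntidiagonal.mem_antidiagonal] at hp
    have : j ≠ j' := by rintro rfl; exact hne (by rw [Nat.add_right_cancel hp])
    simp [cf_mono_ne this]
  · simp

theorem cf_mul_mono_lt (f : SkewRing σ) {l j : ℕ} (h : l < j) (b : L) :
    cf σ l (f * mono σ j b) = 0 := by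
  rw [cf_mul, Finset.sum_eq_zero]
  rintro ⟨i', j'⟩ hp
  simp only [Finset.HasAntidiagonal.mem_antidiagonal] at hp
  simp [cf_mono_ne (show j ≠ j' by lia)]

theorem cf_mono_mul (f : SkewRing σ) (i j : ℕ) (a : L) :
    cf σ (i + j) (mono σ i a * f) = a * (σ ^ i) (cf σ j f) := by
  rw [cf_mul, Finset.sum_eq_single (i, j)]
  · simp
  · rintro ⟨i', j'⟩ hp hne
    simp only [Finset.HasAntidiagonal.mem_antidiagonal] at hp
    have : i ≠ i' := by rintro rfl; exact hne (by rw [Nat.add_left_cancel hp])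
    simp [cf_mono_ne this]
  · simp

theorem cf_mono_mul_lt (f : SkewRing σ) {l i : ℕ} (h : l < i) (a : L) :
    cf σ l (mono σ i a * f) = 0 := by
  rw [cf_mul, Finset.sum_eq_zero]
  rintro ⟨i', j'⟩ hp
  simp only [Finset.HasAntidiagonal.mem_antidiagonal] at hp
  simp [cf_mono_ne (show i ≠ i' by lia)]

variable (σ) in
/-- The skew polynomials of degree less than `m`. -/
def degLT (m : ℕ) : AddSubgroup (SkewRing σ) where
  carrier := {f | ∀ i, m ≤ i → cf σ i f = 0}
  zero_mem' := fun i _ => map_zero _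
  add_mem' := fun {f g} hf hg i hi => by rw [map_add, hf i hi, hg i hi, add_zero]
  neg_mem' := fun {f} hf i hi => by rw [map_neg, hf i hi, neg_zero]

theorem degLT_mono {m m' : ℕ} (h : m ≤ m') : degLT σ m ≤ degLT σ m' :=
  fun _ hf i hi => hf i (h.trans hi)

theorem mono_mem_degLT {i m : ℕ} (h : i < m) (a : L) : mono σ i a ∈ degLT σ m :=
  fun j hj => cf_mono_ne (by lia) a

theorem exists_mem_degLT (f : SkewRing σ) : ∃ m, f ∈ degLT σ m := by
  induction f using skew_induction with
  | hm i a => exact ⟨i + 1, mono_mem_degLT (Nat.lt_succ_self i) a⟩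
  | hadd f g hf hg =>
    obtain ⟨m, hm⟩ := hf
    obtain ⟨l, hl⟩ := hg
    exact ⟨max m l, add_mem (degLT_mono (le_max_left _ _) hm) (degLT_mono (le_max_right _ _) hl)⟩

theorem eq_zero_of_mem_degLT_zero {f : SkewRing σ} (h : f ∈ degLT σ 0) : f = 0 :=
  skew_ext fun i => by rw [h i (Nat.zero_le i), map_zero]

theorem mem_degLT_of_succ {m : ℕ} {f : SkewRing σ} (h : f ∈ degLT σ (m + 1))
    (h0 : cf σ m f = 0) : f ∈ degLT σ m := fun i hi => by
  rcases hi.eq_or_lt with rfl | hi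
  · exact h0
  · exact h i hi

theorem exists_lead {f : SkewRing σ} (hf : f ≠ 0) : ∃ m, f ∈ degLT σ (m + 1) ∧ cf σ m f ≠ 0 := by
  classical
  have hex := exists_mem_degLT f
  have h1 := Nat.find_spec hex
  have h2 : Nat.find hex ≠ 0 := fun h => hf (eq_zero_of_mem_degLT_zero (h ▸ h1))
  obtain ⟨m, hm⟩ := Nat.exists_eq_succ_of_ne_zero h2
  rw [hm] at h1
  refine ⟨m, h1, fun h0 => ?_⟩
  exact Nat.find_min hex (m := m) (by lia) (mem_degLT_of_succ h1 h0)

theorem exists_lead_lt {f : SkewRing σ} (hf : f ≠ 0) {l : ℕ} (hl : f ∈ degLT σ l) :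
    ∃ m, m < l ∧ f ∈ degLT σ (m + 1) ∧ cf σ m f ≠ 0 := by
  obtain ⟨m, h1, h2⟩ := exists_lead hf
  exact ⟨m, not_le.1 fun h => h2 (hl m h), h1, h2⟩

theorem cf_mul_top {f g : SkewRing σ} {a b : ℕ} (hf : f ∈ degLT σ (a + 1))
    (hg : g ∈ degLT σ (b + 1)) : cf σ (a + b) (f * g) = cf σ a f * (σ ^ a) (cf σ b g) := by
  rw [cf_mul, Finset.sum_eq_single (a, b)]
  · rintro ⟨i, j⟩ hp hne
    simp only [Finset.HasAntidiagonal.mem_antidiagonal] at hp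
    rcases lt_trichotomy i a with h | rfl | h
    · simp [hg j (by lia)]
    · exact absurd (by rw [Nat.add_left_cancel hp]) hne
    · simp [hf i (by lia)]
  · simp

theorem mul_mem_degLT {f g : SkewRing σ} {a b : ℕ} (hf : f ∈ degLT σ (a + 1))
    (hg : g ∈ degLT σ (b + 1)) : f * g ∈ degLT σ (a + b + 1) := by
  intro k hk
  rw [cf_mul, Finset.sum_eq_zero]
  rintro ⟨i, j⟩ hp
  simp only [Finset.HasAntidiagonal.mem_antidiagonal] at hp
  rcases lt_or_ge a i with h | h
  · simp [hf i (by lia)]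
  · simp [hg j (by lia)]

theorem mul_mono_mem_degLT {f : SkewRing σ} {m : ℕ} (hf : f ∈ degLT σ m) (j : ℕ) (b : L) :
    f * mono σ j b ∈ degLT σ (m + j) := by
  rcases m with _ | m
  · rw [eq_zero_of_mem_degLT_zero hf, zero_mul]
    exact zero_mem _
  · have := mul_mem_degLT hf (mono_mem_degLT (Nat.lt_succ_self j) b)
    rwa [show m + 1 + j = m + j + 1 by lia]

theorem mono_mul_mem_degLT {f : SkewRing σ} {m : ℕ} (hf : f ∈ degLT σ m) (j : ℕ) (b : L) :
    mono σ j b * f ∈ degLT σ (j + m) := by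
  rcases m with _ | m
  · rw [eq_zero_of_mem_degLT_zero hf, mul_zero]
    exact zero_mem _
  · exact mul_mem_degLT (mono_mem_degLT (Nat.lt_succ_self j) b) hf

theorem skew_mul_ne_zero {f g : SkewRing σ} (hf : f ≠ 0) (hg : g ≠ 0) : f * g ≠ 0 := by
  obtain ⟨a, ha, ha'⟩ := exists_lead hf
  obtain ⟨b, hb, hb'⟩ := exists_lead hg
  intro h
  have := cf_mul_top ha hb
  rw [h, map_zero] at this
  exact mul_ne_zero ha' ((map_ne_zero (σ ^ a)).2 hb') this.symm

theorem cf_sum_mono (m : ℕ) (a : ℕ → L) (j : ℕ) :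
    cf σ j (∑ i ∈ Finset.range m, mono σ i (a i)) = if j < m then a j else 0 := by
  rw [map_sum]
  simp only [cf_mono]
  rw [Finset.sum_ite_eq']
  simp only [Finset.mem_range]

theorem eq_sum_mono {m : ℕ} {f : SkewRing σ} (hf : f ∈ degLT σ m) :
    f = ∑ i ∈ Finset.range m, mono σ i (cf σ i f) := by
  refine skew_ext fun j => ?_
  rw [cf_sum_mono]
  split_ifs with h
  · rfl
  · exact hf j (not_lt.1 h)

theorem sum_mono_mem_degLT (m : ℕ) (a : ℕ → L) :
    ∑ i ∈ Finset.range m, mono σ i (a i) ∈ degLT σ m :=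
  sum_mem fun _ hi => mono_mem_degLT (Finset.mem_range.1 hi) _

/-- Skew polynomials of degree less than `m` are tuples of `m` coefficients. -/
noncomputable def degLTEquiv (m : ℕ) : degLT σ m ≃ (Fin m → L) where
  toFun f i := cf σ i f.1
  invFun a := ⟨∑ i ∈ Finset.range m, mono σ i (if h : i < m then a ⟨i, h⟩ else 0),
    sum_mono_mem_degLT m _⟩
  left_inv f := by
    refine Subtype.ext ?_
    change ∑ i ∈ Finset.range m, mono σ i (if _h : i < m then cf σ i f.1 else 0) = f.1
    conv_rhs => rw [eq_sum_mono f.2]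
    refine Finset.sum_congr rfl fun i hi => ?_
    rw [dif_pos (Finset.mem_range.1 hi)]
  right_inv a := by
    ext i
    exact (cf_sum_mono m _ i).trans (by simp)

theorem card_degLT (m : ℕ) : Nat.card (degLT σ m) = Nat.card L ^ m := by
  rw [Nat.card_congr (degLTEquiv m), Nat.card_fun, Nat.card_fin]

/-- The constants together with x generate L[x;σ]. -/
theorem commute_of_commute_gens {f : SkewRing σ} (hx : mono σ 1 1 * f = f * mono σ 1 1)
    (ha : ∀ a, mono σ 0 a * f = f * mono σ 0 a) (g : SkewRing σ) : g * f = f * g := by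
  have hpow : ∀ i, mono σ i 1 * f = f * mono σ i 1 := by
    intro i
    induction i with
    | zero => exact ha 1
    | succ i ih =>
      have : mono σ (i + 1) 1 = mono σ i 1 * mono σ 1 1 := by simp [mono_mul_mono]
      rw [this, mul_assoc, hx, ← mul_assoc, ih, mul_assoc]
  induction g using skew_induction with
  | hadd g g' h h' => rw [add_mul, mul_add, h, h']
  | hm i a =>
    have : mono σ i a = mono σ 0 a * mono σ i 1 := by simp [mono_mul_mono]
    rw [this, mul_assoc, hpow, ← mul_assoc, ha, mul_assoc]

end Coefficients

/-! ### The central elements G(x^n) and the quotient R_F. -/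

section Modulus

variable {K L : Type u} [Field K] [Field L] [Algebra K L] {σ : L ≃ₐ[K] L}

variable (σ) in
/-- The map `G ↦ G(x ^ n)` from `K[y]` to `L[x;σ]`, as a ring homomorphism. -/
noncomputable def evalXPowHom : K[X] →+* SkewRing σ :=
  Polynomial.eval₂RingHom'
    ((SkewPolynomial.CRingHom (R := Twisted σ)).comp (algebraMap K L : K →+* Twisted σ))
    (mono σ (Module.finrank K L) 1) fun a => by
      change mono σ 0 (algebraMap K L a) * mono σ _ 1 = mono σ _ 1 * mono σ 0 (algebraMap K L a)
      simp [mono_mul_mono]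

theorem mono_one_pow (i j : ℕ) : mono σ i 1 ^ j = mono σ (i * j) 1 := by
  induction j with
  | zero => rfl
  | succ j ih => rw [pow_succ, ih, mono_mul_mono, map_one, mul_one, Nat.mul_succ]

theorem evalXPowHom_apply (G : K[X]) : evalXPowHom σ G = evalXPow σ G := by
  change Polynomial.eval₂ _ _ _ = _
  rw [Polynomial.eval₂_eq_sum, evalXPow]
  refine Finset.sum_congr rfl fun i _ => ?_
  change mono σ 0 (algebraMap K L (G.coeff i)) * mono σ (Module.finrank K L) 1 ^ i =
    mono σ (Module.finrank K L * i) (algebraMap K L (G.coeff i))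
  rw [mono_one_pow, mono_mul_mono]
  simp

theorem cf_evalXPow_mul [FiniteDimensional K L] (G : K[X]) (i : ℕ) :
    cf σ (Module.finrank K L * i) (evalXPow σ G) = algebraMap K L (G.coeff i) := by
  have hn : 0 < Module.finrank K L := Module.finrank_pos
  rw [evalXPow, Polynomial.sum_def, map_sum]
  have : ∀ j, cf σ (Module.finrank K L * i) (mono σ (Module.finrank K L * j)
      (algebraMap K L (G.coeff j))) = if i = j then algebraMap K L (G.coeff i) else 0 := by
    intro j
    rw [cf_mono]
    by_cases h : i = j
    · simp [h]
    · rw [if_neg h, if_neg]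
      exact fun h' => h (Nat.eq_of_mul_eq_mul_left hn h').symm
  simp only [this]
  rw [Finset.sum_ite_eq]
  split_ifs with h
  · rfl
  · rw [Polynomial.notMem_support_iff.1 h, map_zero]

theorem cf_evalXPow_of_not_dvd (G : K[X]) {i : ℕ} (hi : ¬ Module.finrank K L ∣ i) :
    cf σ i (evalXPow σ G) = 0 := by
  rw [evalXPow, Polynomial.sum_def, map_sum]
  refine Finset.sum_eq_zero fun j _ => cf_mono_ne ?_ _
  rintro rfl
  exact hi (dvd_mul_right _ _)

theorem cf_zero_evalXPow [FiniteDimensional K L] (G : K[X]) :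
    cf σ 0 (evalXPow σ G) = algebraMap K L (G.coeff 0) :=
  cf_evalXPow_mul G 0

theorem evalXPow_mem_degLT [FiniteDimensional K L] (G : K[X]) :
    evalXPow σ G ∈ degLT σ (Module.finrank K L * G.natDegree + 1) := by
  intro i hi
  by_cases h : Module.finrank K L ∣ i
  · obtain ⟨j, rfl⟩ := h
    rw [cf_evalXPow_mul, Polynomial.coeff_eq_zero_of_natDegree_lt, map_zero]
    exact lt_of_mul_lt_mul_left (Nat.lt_of_succ_le hi) (Nat.zero_le _)
  · exact cf_evalXPow_of_not_dvd G h

/-- The recognition criterion for G(x^n), used for the centre and for simplicity: exponents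
divisible by n and coefficients in K. -/
theorem evalXPow_eq_of_cf [FiniteDimensional K L] {f : SkewRing σ} {m : ℕ}
    (hf : f ∈ degLT σ (Module.finrank K L * m))
    (h0 : ∀ i, ¬ Module.finrank K L ∣ i → cf σ i f = 0)
    (h1 : ∀ i, ∃ c : K, algebraMap K L c = cf σ i f) :
    ∃ G : K[X], G.degree < m ∧ f = evalXPow σ G := by
  choose c hc using h1
  refine ⟨∑ i ∈ Finset.range m, Polynomial.monomial i (c (Module.finrank K L * i)), ?_, ?_⟩
  · rw [Polynomial.degree_lt_iff_coeff_zero]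
    intro j hj
    simp [Polynomial.finsetSum_coeff, Polynomial.coeff_monomial, not_lt.2 hj]
  · refine skew_ext fun j => ?_
    by_cases h : Module.finrank K L ∣ j
    · obtain ⟨i, rfl⟩ := h
      rw [cf_evalXPow_mul]
      simp only [Polynomial.finsetSum_coeff, Polynomial.coeff_monomial, Finset.sum_ite_eq',
        Finset.mem_range]
      split_ifs with him
      · exact (hc _).symm
      · rw [map_zero]
        exact hf _ (Nat.mul_le_mul_left _ (not_lt.1 him))
    · rw [h0 j h, cf_evalXPow_of_not_dvd _ h]

section Finite

variable [Finite K] [FiniteDimensional K L]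

theorem card_aut : Nat.card (L ≃ₐ[K] L) = Module.finrank K L :=
  have : Finite L := Module.finite_of_finite K
  IsGalois.card_aut_eq_finrank K L

theorem pow_finrank (σ : L ≃ₐ[K] L) : σ ^ Module.finrank K L = 1 := by
  rw [← card_aut (K := K) (L := L), pow_card_eq_one']

theorem orderOf_of_isGenerator (hσ : IsGenerator σ) : orderOf σ = Module.finrank K L := by
  rw [← card_aut, orderOf_eq_card_of_forall_mem_zpowers hσ]

theorem mem_base_of_fixed (hσ : IsGenerator σ) {a : L} (ha : σ a = a) :
    ∃ c : K, algebraMap K L c = a := by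
  have : Finite L := Module.finite_of_finite K
  rw [← Set.mem_range]
  rw [IsGalois.mem_range_algebraMap_iff_fixed]
  intro τ
  have : Subgroup.zpowers σ ≤ MulAction.stabilizer (L ≃ₐ[K] L) a := by
    rw [Subgroup.zpowers_le]
    exact ha
  exact this (hσ τ)

theorem evalXPow_central (G : K[X]) (g : SkewRing σ) : g * evalXPow σ G = evalXPow σ G * g := by
  induction g using skew_induction with
  | hadd g g' h h' => rw [add_mul, mul_add, h, h']
  | hm i a =>
    rw [evalXPow, Polynomial.sum_def, Finset.mul_sum, Finset.sum_mul]
    refine Finset.sum_congr rfl fun j _ => ?_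
    rw [mono_mul_mono, mono_mul_mono, pow_mul, pow_finrank, one_pow]
    simp [mul_comm, add_comm]

/-- As F(x^n) is central, its left multiples are already closed under multiplication on both sides,
so they are the whole two-sided ideal. -/
theorem toQuot_eq_zero_iff (F : K[X]) (f : SkewRing σ) :
    toQuot σ F f = 0 ↔ ∃ g, f = g * evalXPow σ F := by
  have hker : toQuot σ F f = 0 ↔ f ∈ modulus σ F := by
    rw [TwoSidedIdeal.mem_iff, ← map_zero (toQuot σ F)]
    exact RingCon.eq _
  rw [hker]
  constructor
  · intro h
    have hle : modulus σ F ≤ TwoSidedIdeal.mk' {f | ∃ g, f = g * evalXPow σ F}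
        ⟨0, by simp⟩
        (by rintro _ _ ⟨g, rfl⟩ ⟨g', rfl⟩; exact ⟨g + g', by rw [add_mul]⟩)
        (by rintro _ ⟨g, rfl⟩; exact ⟨-g, by rw [neg_mul]⟩)
        (by rintro x _ ⟨g, rfl⟩; exact ⟨x * g, by rw [mul_assoc]⟩)
        (by rintro _ y ⟨g, rfl⟩; exact ⟨g * y, by rw [mul_assoc, mul_assoc, evalXPow_central]⟩) := by
      refine TwoSidedIdeal.span_le.2 ?_
      rintro _ rfl
      simp only [TwoSidedIdeal.coe_mk', Set.mem_ofPred_eq]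
      exact ⟨1, (one_mul _).symm⟩
    simpa using hle h
  · rintro ⟨g, rfl⟩
    exact TwoSidedIdeal.mul_mem_left _ _ _ (TwoSidedIdeal.subset_span rfl)

theorem toQuot_surjective (F : K[X]) : Function.Surjective (toQuot σ F) :=
  RingCon.mk'_surjective _

/-- A nonzero multiple of the monic F(x^n) has degree at least n deg F. This turns equalities in R_F
into equalities of coefficients whenever both sides have small degree. -/
theorem eq_zero_of_toQuot {F : K[X]} (hF : F.Monic) {f : SkewRing σ}
    (hf : f ∈ degLT σ (Module.finrank K L * F.natDegree)) (h : toQuot σ F f = 0) : f = 0 := by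
  obtain ⟨g, rfl⟩ := (toQuot_eq_zero_iff F f).1 h
  by_contra hne
  have hg : g ≠ 0 := by rintro rfl; simp at hne
  obtain ⟨a, ha, ha'⟩ := exists_lead hg
  have h2 := cf_mul_top ha (evalXPow_mem_degLT (σ := σ) F)
  rw [hf _ (Nat.le_add_left _ _), cf_evalXPow_mul, hF.coeff_natDegree] at h2
  simp at h2
  exact ha' h2.symm

theorem eq_of_toQuot {F : K[X]} (hF : F.Monic) {f g : SkewRing σ}
    (hf : f ∈ degLT σ (Module.finrank K L * F.natDegree))
    (hg : g ∈ degLT σ (Module.finrank K L * F.natDegree)) (h : toQuot σ F f = toQuot σ F g) :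
    f = g :=
  sub_eq_zero.1 (eq_zero_of_toQuot hF (sub_mem hf hg) (by rw [map_sub, h, sub_self]))

theorem exists_rep {F : K[X]} (hF : F.Monic) (z : SkewQuot σ F) :
    ∃ f ∈ degLT σ (Module.finrank K L * F.natDegree), toQuot σ F f = z := by
  obtain ⟨f, rfl⟩ := toQuot_surjective F z
  obtain ⟨m, hm⟩ := exists_mem_degLT f
  induction m generalizing f with
  | zero => exact ⟨f, degLT_mono (Nat.zero_le _) hm, rfl⟩
  | succ m ih =>
    rcases lt_or_ge m (Module.finrank K L * F.natDegree) with h | h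
    · exact ⟨f, degLT_mono h hm, rfl⟩
    · obtain ⟨j, rfl⟩ := Nat.exists_eq_add_of_le h
      set u := mono σ j (cf σ (Module.finrank K L * F.natDegree + j) f)
      have hmem : f - u * evalXPow σ F ∈ degLT σ (Module.finrank K L * F.natDegree + j) := by
        have h1 : u ∈ degLT σ (j + 1) := mono_mem_degLT (Nat.lt_succ_self j) _
        have h2 := evalXPow_mem_degLT (σ := σ) F
        refine mem_degLT_of_succ (sub_mem hm ?_) ?_
        · have := mul_mem_degLT h1 h2
          rwa [add_comm j] at this
        · have := cf_mul_top h1 h2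
          rw [add_comm j] at this
          rw [map_sub, this, cf_evalXPow_mul, hF.coeff_natDegree]
          simp [u]
      obtain ⟨g, hg, hg'⟩ := ih _ hmem
      refine ⟨g, hg, hg'.trans ?_⟩
      rw [map_sub, (toQuot_eq_zero_iff F (u * evalXPow σ F)).2 ⟨u, rfl⟩, sub_zero]

theorem card_skewQuot {F : K[X]} (hF : F.Monic) :
    Nat.card (SkewQuot σ F) = Nat.card L ^ (Module.finrank K L * F.natDegree) := by
  rw [← card_degLT (σ := σ)]
  refine (Nat.card_congr (Equiv.ofBijective
    (fun f : degLT σ (Module.finrank K L * F.natDegree) => toQuot σ F f.1) ⟨?_, ?_⟩)).symm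
  · intro f g h
    exact Subtype.ext (eq_of_toQuot hF f.2 g.2 h)
  · intro z
    obtain ⟨f, hf, h⟩ := exists_rep hF z
    exact ⟨⟨f, hf⟩, h⟩

theorem evalXPow_mul (G H : K[X]) : evalXPow σ (G * H) = evalXPow σ G * evalXPow σ H := by
  simp only [← evalXPowHom_apply, map_mul]

theorem evalXPow_add (G H : K[X]) : evalXPow σ (G + H) = evalXPow σ G + evalXPow σ H := by
  simp only [← evalXPowHom_apply, map_add]

theorem evalXPow_one : evalXPow σ (1 : K[X]) = 1 := by
  simp only [← evalXPowHom_apply, map_one]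

theorem toQuot_evalXPow_self (F : K[X]) : toQuot σ F (evalXPow σ F) = 0 :=
  (toQuot_eq_zero_iff F _).2 ⟨1, (one_mul _).symm⟩

/-- A Bézout relation in K[y] is transported by y ↦ x^n. -/
theorem isUnit_toQuot_evalXPow {F G : K[X]} (h : IsCoprime F G) :
    IsUnit (toQuot σ F (evalXPow σ G)) := by
  obtain ⟨a, b, hab⟩ := h
  have h1 : toQuot σ F (evalXPow σ b) * toQuot σ F (evalXPow σ G) = 1 := by
    have := congrArg (fun P => toQuot σ F (evalXPow σ P)) hab
    simpa [evalXPow_mul, evalXPow_add, evalXPow_one, toQuot_evalXPow_self] using this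
  refine ⟨⟨_, _, ?_, h1⟩, rfl⟩
  rw [← map_mul, ← evalXPow_central, map_mul, h1]

theorem evalXPow_X : evalXPow σ (X : K[X]) = mono σ (Module.finrank K L) 1 := by
  rw [← evalXPowHom_apply]
  change Polynomial.eval₂ _ _ _ = _
  simp

/-- The class of x^n is a unit because y is prime to F, and an element with a unit power is a unit.
-/
theorem isUnit_toQuot_mono {F : K[X]} (h : IsCoprime F X) (i : ℕ) :
    IsUnit (toQuot σ F (mono σ i 1)) := by
  have hn : 0 < Module.finrank K L := Module.finrank_pos
  have h1 := isUnit_toQuot_evalXPow (σ := σ) h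
  have hx : mono σ i 1 = mono σ 1 1 ^ i := by rw [mono_one_pow, one_mul]
  rw [evalXPow_X, show Module.finrank K L = 1 * Module.finrank K L by rw [one_mul],
    ← mono_one_pow, map_pow, isUnit_pow_iff hn.ne'] at h1
  rw [hx, map_pow]
  exact h1.pow i

theorem isCoprime_X_of_irreducible {F : K[X]} (hF : F.Monic) (hirr : Irreducible F) (hFX : F ≠ X) :
    IsCoprime F X := by
  rw [hirr.coprime_iff_not_dvd]
  intro h
  exact hFX (Polynomial.eq_of_monic_of_associated hF Polynomial.monic_X
    (hirr.associated_of_dvd Polynomial.irreducible_X h))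

theorem coeff_zero_ne_of_isCoprime {F : K[X]} (h : IsCoprime F X) : F.coeff 0 ≠ 0 := by
  intro h0
  have := h.isUnit_of_dvd' (Polynomial.X_dvd_iff.2 h0) dvd_rfl
  exact Polynomial.not_isUnit_X this

end Finite

end Modulus

end SkewMRD

namespace SkewMRD

/-! ### R_F is simple, its centre, and the isomorphism with a matrix ring. -/

section Simple

variable {K L : Type u} [Field K] [Field L] [Algebra K L] {σ : L ≃ₐ[K] L}
  [Finite K] [FiniteDimensional K L]

theorem pow_eq_pow_of_forall_mul {f : SkewRing σ} {i m : ℕ}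
    (hf : ∀ a, cf σ i f * (σ ^ i) a = (σ ^ m) a * cf σ i f) (h : cf σ i f ≠ 0) :
    σ ^ i = σ ^ m := by
  ext a
  have := hf a
  rw [mul_comm] at this
  exact mul_right_cancel₀ h this

theorem dvd_of_pow_eq_one (hσ : IsGenerator σ) {i : ℕ} (h : σ ^ i = 1) :
    Module.finrank K L ∣ i := by
  rw [← orderOf_of_isGenerator hσ]
  exact orderOf_dvd_of_pow_eq_one h

/-- Commuting with constants confines the support to exponents i with σ^i = 1; commuting with x
makes the coefficients σ-invariant. -/
theorem exists_evalXPow_of_commute (hσ : IsGenerator σ) (hn : 2 ≤ Module.finrank K L)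
    {F : K[X]} (hF : F.Monic) (hF0 : 0 < F.natDegree) {z : SkewQuot σ F}
    (hx : toQuot σ F (mono σ 1 1) * z = z * toQuot σ F (mono σ 1 1))
    (ha : ∀ a, toQuot σ F (mono σ 0 a) * z = z * toQuot σ F (mono σ 0 a)) :
    ∃ G : K[X], G.degree < F.natDegree ∧ z = toQuot σ F (evalXPow σ G) := by
  obtain ⟨f, hf, rfl⟩ := exists_rep hF z
  have h0 : ∀ i, ¬ Module.finrank K L ∣ i → cf σ i f = 0 := by
    intro i hi
    by_contra hne
    refine hi (dvd_of_pow_eq_one hσ ?_)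
    rw [← pow_zero σ]
    refine pow_eq_pow_of_forall_mul (fun a => ?_) hne
    have h := ha a
    rw [← map_mul, ← map_mul] at h
    have h := eq_of_toQuot hF (by simpa using mono_mul_mem_degLT hf 0 a)
      (mul_mono_mem_degLT hf 0 a) h
    have h := congrArg (cf σ i) h
    have h1 := cf_mono_mul f 0 i a
    rw [zero_add] at h1
    rw [h1] at h
    exact ((cf_mul_mono f i 0 a).symm.trans h.symm)
  have hN : 2 ≤ Module.finrank K L * F.natDegree := le_trans hn (Nat.le_mul_of_pos_right _ hF0)
  -- The exponent N - 1 is not a multiple of n because n ≥ 2. The top coefficient therefore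
  -- vanishes, and multiplication by x causes no reduction.
  have hf' : f ∈ degLT σ (Module.finrank K L * F.natDegree - 1) := by
    refine mem_degLT_of_succ (by rwa [Nat.sub_add_cancel (by lia)]) (h0 _ fun h => ?_)
    have h1 : Module.finrank K L ∣ 1 := by
      have := (Nat.dvd_sub (dvd_mul_right _ F.natDegree) h)
      rwa [Nat.sub_sub_self (by lia)] at this
    have := Nat.le_of_dvd one_pos h1
    lia
  have h1 : ∀ i, σ (cf σ i f) = cf σ i f := by
    intro i
    rw [← map_mul, ← map_mul] at hx
    have h := eq_of_toQuot hF (by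
        have := mono_mul_mem_degLT hf' 1 1
        rwa [Nat.add_sub_cancel' (by lia)] at this)
      (by
        have := mul_mono_mem_degLT hf' 1 1
        rwa [Nat.sub_add_cancel (by lia)] at this) hx
    have h := congrArg (cf σ (1 + i)) h
    rw [cf_mono_mul, add_comm 1 i, cf_mul_mono] at h
    simpa using h
  obtain ⟨G, hG, rfl⟩ := evalXPow_eq_of_cf hf h0 fun i => mem_base_of_fixed hσ (h1 i)
  exact ⟨G, hG, rfl⟩

theorem toQuot_evalXPow_mem_center (F G : K[X]) :
    toQuot σ F (evalXPow σ G) ∈ Subring.center (SkewQuot σ F) := by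
  rw [Subring.mem_center_iff]
  intro z
  obtain ⟨g, rfl⟩ := toQuot_surjective F z
  rw [← map_mul, evalXPow_central, map_mul]

theorem card_center (hσ : IsGenerator σ) (hn : 2 ≤ Module.finrank K L)
    {F : K[X]} (hF : F.Monic) (hF0 : 0 < F.natDegree) :
    Nat.card (Subring.center (SkewQuot σ F)) = Nat.card K ^ F.natDegree := by
  rw [show Nat.card K ^ F.natDegree = Nat.card (Polynomial.degreeLT K F.natDegree) by
    rw [Nat.card_congr (Polynomial.degreeLTEquiv K F.natDegree).toEquiv, Nat.card_fun,
      Nat.card_fin]]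
  refine (Nat.card_congr (Equiv.ofBijective (fun G : Polynomial.degreeLT K F.natDegree =>
    (⟨toQuot σ F (evalXPow σ G.1), toQuot_evalXPow_mem_center F G.1⟩ :
      Subring.center (SkewQuot σ F))) ⟨?_, ?_⟩)).symm
  · intro G H h
    have h := congrArg Subtype.val h
    have hmem : ∀ G : Polynomial.degreeLT K F.natDegree,
        evalXPow σ G.1 ∈ degLT σ (Module.finrank K L * F.natDegree) := by
      intro G i hi
      by_cases hd : Module.finrank K L ∣ i
      · obtain ⟨j, rfl⟩ := hd
        rw [cf_evalXPow_mul, Polynomial.degree_lt_iff_coeff_zero _ _ |>.1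
          (Polynomial.mem_degreeLT.1 G.2) j
          (le_of_mul_le_mul_left hi (by lia)), map_zero]
      · exact cf_evalXPow_of_not_dvd _ hd
    have h := eq_of_toQuot hF (hmem G) (hmem H) h
    refine Subtype.ext (Polynomial.ext fun i => ?_)
    have h := congrArg (cf σ (Module.finrank K L * i)) h
    rw [cf_evalXPow_mul, cf_evalXPow_mul] at h
    exact (algebraMap K L).injective h
  · rintro ⟨z, hz⟩
    rw [Subring.mem_center_iff] at hz
    obtain ⟨G, hG, rfl⟩ := exists_evalXPow_of_commute hσ hn hF hF0 (hz _) (fun a => hz _)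
    exact ⟨⟨G, Polynomial.mem_degreeLT.2 hG⟩, rfl⟩

theorem finite_skewQuot {F : K[X]} (hF : F.Monic) : Finite (SkewQuot σ F) := by
  have : Finite L := Module.finite_of_finite K
  have : 0 < Nat.card (SkewQuot σ F) := by
    rw [card_skewQuot hF]
    exact pow_pos Nat.card_pos _
  exact (Nat.card_pos_iff.1 this).2

/-- Let f be monic of least degree m in a nonzero ideal. The elements fa - σ^m(a)f and xf - fx have
smaller degree, hence vanish, so f x^e is central for a suitable e. -/
theorem isSimpleRing_skewQuot (hσ : IsGenerator σ) (hn : 2 ≤ Module.finrank K L)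
    {F : K[X]} (hF : F.Monic) (hirr : Irreducible F) (hFX : F ≠ X) :
    IsSimpleRing (SkewQuot σ F) := by
  classical
  have hF0 : 0 < F.natDegree := hirr.natDegree_pos
  have hcop := isCoprime_X_of_irreducible hF hirr hFX
  have hN : 0 < Module.finrank K L * F.natDegree := Nat.mul_pos (by lia) hF0
  have : Nontrivial (SkewQuot σ F) := by
    refine ⟨0, 1, fun h => ?_⟩
    rw [← map_one (toQuot σ F), eq_comm] at h
    have h := eq_zero_of_toQuot hF (mono_mem_degLT hN 1) h
    have h := congrArg (cf σ 0) h
    rw [cf_mono_self, map_zero] at h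
    exact one_ne_zero (α := L) h
  refine ⟨⟨fun I => or_iff_not_imp_left.2 fun hI => ?_⟩⟩
  have hmulr : ∀ f g : SkewRing σ, toQuot σ F f ∈ I → toQuot σ F (f * g) ∈ I := fun f g h => by
    rw [map_mul]
    exact I.mul_mem_right _ _ h
  have hmull : ∀ f g : SkewRing σ, toQuot σ F f ∈ I → toQuot σ F (g * f) ∈ I := fun f g h => by
    rw [map_mul]
    exact I.mul_mem_left _ _ h
  have hsub : ∀ f g : SkewRing σ, toQuot σ F f ∈ I → toQuot σ F g ∈ I →
      toQuot σ F (f - g) ∈ I := fun f g h h' => by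
    rw [map_sub]
    exact I.sub_mem h h'
  have hex : ∃ m, ∃ f : SkewRing σ, m < Module.finrank K L * F.natDegree ∧
      f ∈ degLT σ (m + 1) ∧ cf σ m f ≠ 0 ∧ toQuot σ F f ∈ I := by
    obtain ⟨z, hz, hz0⟩ : ∃ z ∈ I, z ≠ 0 := by
      by_contra! h
      exact hI (eq_bot_iff.2 fun z hz => (TwoSidedIdeal.mem_bot _).2 (h z hz))
    obtain ⟨f, hf, rfl⟩ := exists_rep hF z
    have hf0 : f ≠ 0 := by rintro rfl; exact hz0 (map_zero _)
    obtain ⟨m, hm, h1, h2⟩ := exists_lead_lt hf0 hf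
    exact ⟨m, f, hm, h1, h2, hz⟩
  set m := Nat.find hex with hmdef
  obtain ⟨f, hmN, hfm, hf0, hfI⟩ := Nat.find_spec hex
  rw [← hmdef] at hmN hfm hf0
  have hmin : ∀ g ∈ degLT σ m, toQuot σ F g ∈ I → g = 0 := by
    intro g hg hgI
    by_contra hne
    obtain ⟨l, hl, h1, h2⟩ := exists_lead_lt hne hg
    exact Nat.find_min hex hl ⟨g, by lia, h1, h2, hgI⟩
  obtain ⟨f, hfm, hf1, hfI⟩ : ∃ f : SkewRing σ, f ∈ degLT σ (m + 1) ∧ cf σ m f = 1 ∧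
      toQuot σ F f ∈ I := by
    refine ⟨mono σ 0 (cf σ m f)⁻¹ * f, by simpa using mono_mul_mem_degLT hfm 0 _, ?_,
      hmull _ _ hfI⟩
    have := cf_mono_mul f 0 m (cf σ m f)⁻¹
    rw [zero_add] at this
    rw [this]
    simp [hf0]
  have hcoef : ∀ i a, cf σ i f * (σ ^ i) a = (σ ^ m) a * cf σ i f := by
    intro i a
    have h := hmin (f * mono σ 0 a - mono σ 0 ((σ ^ m) a) * f) ?_
      (hsub _ _ (hmulr _ _ hfI) (hmull _ _ hfI))
    · have h := congrArg (cf σ i) (sub_eq_zero.1 h)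
      have h1 := cf_mono_mul f 0 i ((σ ^ m) a)
      rw [zero_add] at h1
      rw [h1] at h
      exact ((cf_mul_mono f i 0 a).symm.trans h)
    · refine mem_degLT_of_succ (sub_mem (mul_mono_mem_degLT hfm 0 a)
        (by simpa using mono_mul_mem_degLT hfm 0 ((σ ^ m) a))) ?_
      have h1 := cf_mono_mul f 0 m ((σ ^ m) a)
      rw [zero_add] at h1
      rw [map_sub, h1]
      have h2 := cf_mul_mono f m 0 a
      rw [add_zero] at h2
      rw [h2, hf1]
      simp
  have hsupp : ∀ i, cf σ i f ≠ 0 → σ ^ i = σ ^ m := fun i hi =>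
    pow_eq_pow_of_forall_mul (hcoef i) hi
  have hfix : ∀ i, σ (cf σ i f) = cf σ i f := by
    set h := mono σ 1 1 * f - f * mono σ 1 1 with hh
    have hcf : ∀ i, cf σ (i + 1) h = σ (cf σ i f) - cf σ i f := by
      intro i
      rw [hh, map_sub, cf_mul_mono, add_comm i, cf_mono_mul]
      simp
    have hhm : h ∈ degLT σ (m + 1) := by
      refine mem_degLT_of_succ (sub_mem ?_ (mul_mono_mem_degLT hfm 1 1)) ?_
      · have := mono_mul_mem_degLT hfm 1 1
        rwa [add_comm] at this
      · rw [hcf, hf1]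
        simp
    -- The coefficient is σ(f_{m-1}) - f_{m-1}, and f_{m-1} = 0 because σ^{m-1} ≠ σ^m.
    have hc : cf σ m h = 0 := by
      rcases Nat.eq_zero_or_pos m with hm0 | hm0
      · rw [hm0, hh, map_sub, cf_mono_mul_lt _ one_pos, cf_mul_mono_lt _ one_pos, sub_zero]
      · obtain ⟨l, hl⟩ := Nat.exists_eq_succ_of_ne_zero hm0.ne'
        have hl0 : cf σ l f = 0 := by
          by_contra hne
          have := hsupp l hne
          rw [hl, pow_succ, left_eq_mul] at this
          have := Nat.le_of_dvd one_pos (dvd_of_pow_eq_one hσ (i := 1) (by rw [pow_one, this]))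
          lia
        rw [hl, hcf, hl0, map_zero, sub_zero]
    have := hmin h (mem_degLT_of_succ hhm hc) (hsub _ _ (hmull _ _ hfI) (hmulr _ _ hfI))
    intro i
    rw [← sub_eq_zero, ← hcf, this, map_zero]
  -- The exponents of f are congruent to m modulo n, and m + e = nm, so f x^e is supported on
  -- multiples of n.
  set e := m * (Module.finrank K L - 1) with he
  have hme : m + e = Module.finrank K L * m := by
    rw [he, mul_comm m, Nat.sub_mul, one_mul,
      Nat.add_sub_cancel' (Nat.le_mul_of_pos_left _ (by lia))]
  obtain ⟨G, -, hG⟩ := evalXPow_eq_of_cf (f := f * mono σ e 1) (m := m + 1)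
    (degLT_mono (by rw [mul_add]; lia) (mul_mono_mem_degLT hfm e 1))
    (by
      intro i hi
      rcases lt_or_ge i e with h | h
      · exact cf_mul_mono_lt _ h _
      · obtain ⟨j, rfl⟩ := Nat.exists_eq_add_of_le h
        rw [add_comm, cf_mul_mono, map_one, mul_one]
        by_contra hne
        refine hi (dvd_of_pow_eq_one hσ ?_)
        rw [add_comm, pow_add, hsupp j hne, ← pow_add, hme, pow_mul, pow_finrank, one_pow])
    (by
      intro i
      refine mem_base_of_fixed hσ ?_
      rcases lt_or_ge i e with h | h
      · rw [cf_mul_mono_lt _ h, map_zero]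
      · obtain ⟨j, rfl⟩ := Nat.exists_eq_add_of_le h
        rw [add_comm, cf_mul_mono, map_one, mul_one, hfix])
  have hGI : toQuot σ F (evalXPow σ G) ∈ I := hG ▸ hmulr _ _ hfI
  have hG0 : toQuot σ F (evalXPow σ G) ≠ 0 := by
    rw [← hG, map_mul, ne_eq, (isUnit_toQuot_mono hcop e).mul_left_eq_zero]
    intro h
    have := eq_zero_of_toQuot hF (degLT_mono hmN hfm) h
    rw [this, map_zero] at hf1
    exact zero_ne_one hf1
  have hunit : IsUnit (toQuot σ F (evalXPow σ G)) := by
    refine isUnit_toQuot_evalXPow (hirr.coprime_iff_not_dvd.2 ?_)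
    rintro ⟨H, rfl⟩
    rw [evalXPow_mul, map_mul, toQuot_evalXPow_self, zero_mul] at hG0
    exact hG0 rfl
  obtain ⟨v, hv⟩ := hunit.exists_left_inv
  refine eq_top_iff.2 fun z _ => ?_
  have := I.mul_mem_left (z * v) _ hGI
  rwa [mul_assoc, hv, mul_one] at this

theorem card_center_matrix {D : Type*} [Field D] (m : ℕ) [NeZero m] :
    Nat.card (Subring.center (Matrix (Fin m) (Fin m) D)) = Nat.card D := by
  refine (Nat.card_congr (Equiv.ofBijective (fun d : D =>
    (⟨Matrix.scalar (Fin m) d, ?_⟩ : Subring.center (Matrix (Fin m) (Fin m) D))) ⟨?_, ?_⟩)).symm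
  · rw [← SetLike.mem_coe, Subring.coe_center, Matrix.center_eq_range]
    exact ⟨d, rfl⟩
  · intro a b h
    exact Matrix.scalar_inj.1 (congrArg Subtype.val h)
  · rintro ⟨z, hz⟩
    rw [← SetLike.mem_coe, Subring.coe_center, Matrix.center_eq_range] at hz
    obtain ⟨d, rfl⟩ := hz
    exact ⟨d, rfl⟩

/-- By Artin–Wedderburn and the commutativity of finite division rings, R_F is M_m(D) with D a
finite field. The size of the centre determines D, and the size of R_F then determines m. -/
theorem nonempty_ringEquiv_matrix {E : Type*} [Field E] [Finite E] (hσ : IsGenerator σ) {n : ℕ}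
    (hn : Module.finrank K L = n) (hn2 : 2 ≤ n) {F : K[X]} (hF : F.Monic) (hirr : Irreducible F)
    (hFX : F ≠ X) (hE : Nat.card E = Nat.card K ^ F.natDegree) :
    Nonempty (SkewQuot σ F ≃+* Matrix (Fin n) (Fin n) E) := by
  subst hn
  have := finite_skewQuot (σ := σ) hF
  have := isSimpleRing_skewQuot hσ hn2 hF hirr hFX
  obtain ⟨m, hm, D, _, ⟨e⟩⟩ := IsSimpleRing.exists_ringEquiv_matrix_divisionRing (SkewQuot σ F)
  have hfD : Finite D := by
    refine Finite.of_injective (fun d => e.symm (Matrix.scalar (Fin m) d)) fun a b h => ?_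
    exact Matrix.scalar_inj.1 (e.symm.injective h)
  have hDE : Nat.card D = Nat.card E := by
    rw [← card_center_matrix (D := D) m, hE, ← card_center hσ hn2 hF hirr.natDegree_pos]
    exact (Nat.card_congr (Subring.centerCongr e).toEquiv).symm
  have hmn : m = Module.finrank K L := by
    have h := Nat.card_congr e.toEquiv
    rw [card_skewQuot hF, Module.natCard_eq_pow_finrank (K := K) (V := L)] at h
    have hM : Nat.card (Matrix (Fin m) (Fin m) D) = Nat.card D ^ (m * m) := by
      rw [Nat.card_congr (Matrix.of (m := Fin m) (n := Fin m) (α := D)).symm, Nat.card_fun,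
        Nat.card_fun, Nat.card_fin, pow_mul]
    rw [hM, hDE, hE, ← pow_mul, ← pow_mul] at h
    have h := Nat.pow_right_injective (Finite.one_lt_card (α := K)) h
    have h : (m * m) = Module.finrank K L * Module.finrank K L := by
      refine Nat.eq_of_mul_eq_mul_left hirr.natDegree_pos ?_
      rw [← h]
      ring
    exact Nat.mul_self_inj.1 h
  subst hmn
  have := Fintype.ofFinite D
  have := Fintype.ofFinite E
  exact ⟨e.trans (RingEquiv.mapMatrix (FiniteField.ringEquivOfCardEq
    (by rw [← Nat.card_eq_fintype_card, ← Nat.card_eq_fintype_card, hDE])))⟩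

end Simple

end SkewMRD

namespace SkewMRD

/-! ### The reduced norm as a determinant, and its extreme coefficients. -/

section ReducedNorm

open scoped Classical

variable {K L : Type u} [Field K] [Field L] [Algebra K L] [FiniteDimensional K L]

variable (K) in
/-- The diagonal matrix of the conjugates of `a`. -/
noncomputable def conjDiag (a : L) : Matrix (L ≃ₐ[K] L) (L ≃ₐ[K] L) L[X] :=
  Matrix.diagonal fun τ => C (τ a)

/-- The matrix of right translation by `σ`, times `X`. -/
noncomputable def shiftMat (σ : L ≃ₐ[K] L) : Matrix (L ≃ₐ[K] L) (L ≃ₐ[K] L) L[X] :=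
  Matrix.of fun τ τ' => if τ' = τ * σ then X else 0

theorem shiftMat_apply (σ τ τ' : L ≃ₐ[K] L) :
    shiftMat σ τ τ' = if τ' = τ * σ then X else 0 := rfl

theorem shiftMat_mul_conjDiag (σ : L ≃ₐ[K] L) (a : L) :
    shiftMat σ * conjDiag K a = conjDiag K (σ a) * shiftMat σ := by
  ext τ τ' : 2
  rw [conjDiag, conjDiag, Matrix.mul_diagonal, Matrix.diagonal_mul]
  simp only [shiftMat, Matrix.of_apply]
  split_ifs with h
  · rw [h, mul_comm]
    rfl
  · simp

theorem shiftMat_pow_mul_conjDiag (σ : L ≃ₐ[K] L) (i : ℕ) (a : L) :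
    shiftMat σ ^ i * conjDiag K a = conjDiag K ((σ ^ i) a) * shiftMat σ ^ i := by
  induction i generalizing a with
  | zero => simp
  | succ i ih => rw [pow_succ, mul_assoc, shiftMat_mul_conjDiag, ← mul_assoc, ih, mul_assoc]; rfl

theorem conjDiag_mul (a b : L) : conjDiag K (a * b) = conjDiag K a * conjDiag K b := by
  simp [conjDiag, Matrix.diagonal_mul_diagonal]

theorem conjDiag_one : conjDiag K (1 : L) = 1 := by simp [conjDiag]

theorem shiftMat_pow_apply (σ : L ≃ₐ[K] L) (i : ℕ) (τ τ' : L ≃ₐ[K] L) :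
    (shiftMat σ ^ i) τ τ' = if τ' = τ * σ ^ i then X ^ i else 0 := by
  induction i generalizing τ' with
  | zero => simp [Matrix.one_apply, eq_comm]
  | succ i ih =>
    rw [pow_succ, Matrix.mul_apply]
    simp only [ih, shiftMat_apply, ite_mul, zero_mul, mul_ite, mul_zero]
    rw [Finset.sum_eq_single (τ * σ ^ i)]
    · rw [if_pos rfl, mul_assoc, ← pow_succ, ← pow_succ]
    · intro x _ hx
      simp [hx]
    · simp

variable (K L) in
/-- `conjDiag` as an additive map. -/
noncomputable def conjDiagHom : L →+ Matrix (L ≃ₐ[K] L) (L ≃ₐ[K] L) L[X] where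
  toFun a := conjDiag K a
  map_zero' := by simp [conjDiag]
  map_add' a b := by simp [conjDiag, Matrix.diagonal_add]

/-- The regular representation of `L[x;σ]` by matrices over `L[X]`. -/
noncomputable def regMatAdd (σ : L ≃ₐ[K] L) :
    SkewRing σ →+ Matrix (L ≃ₐ[K] L) (L ≃ₐ[K] L) L[X] :=
  SkewMonoidAlgebra.liftNC (k := Twisted σ) (show L →+ _ from conjDiagHom K L)
    fun i => shiftMat σ ^ i.toAdd

theorem regMatAdd_mono (σ : L ≃ₐ[K] L) (i : ℕ) (a : L) :
    regMatAdd σ (mono σ i a) = conjDiag K a * shiftMat σ ^ i :=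
  SkewMonoidAlgebra.liftNC_single _ _ _ _

/-- The regular representation of `L[x;σ]`, as a ring homomorphism. -/
noncomputable def regMat (σ : L ≃ₐ[K] L) :
    SkewRing σ →+* Matrix (L ≃ₐ[K] L) (L ≃ₐ[K] L) L[X] where
  __ := regMatAdd σ
  map_one' := by
    change regMatAdd σ (mono σ 0 1) = 1
    rw [regMatAdd_mono, conjDiag_one, pow_zero, one_mul]
  map_mul' f g := by
    change regMatAdd σ (f * g) = regMatAdd σ f * regMatAdd σ g
    induction f using skew_induction with
    | hadd f f' h h' => rw [add_mul, map_add, map_add, add_mul, h, h']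
    | hm i a =>
      induction g using skew_induction with
      | hadd f f' h h' => rw [mul_add, map_add, map_add, mul_add, h, h']
      | hm j b =>
        rw [mono_mul_mono]
        simp only [regMatAdd_mono]
        rw [conjDiag_mul, pow_add, mul_assoc, mul_assoc, ← mul_assoc (conjDiag K ((σ ^ i) b)),
          ← shiftMat_pow_mul_conjDiag]
        simp only [mul_assoc]

variable {σ : L ≃ₐ[K] L}

theorem regMat_mono (i : ℕ) (a : L) :
    regMat σ (mono σ i a) = conjDiag K a * shiftMat σ ^ i := regMatAdd_mono σ i a

theorem coeff_regMat (f : SkewRing σ) (i : ℕ) (τ τ' : L ≃ₐ[K] L) :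
    (regMat σ f τ τ').coeff i = if τ' = τ * σ ^ i then τ (cf σ i f) else 0 := by
  induction f using skew_induction with
  | hadd f g hf hg =>
    rw [map_add, Matrix.add_apply, Polynomial.coeff_add, hf, hg]
    split_ifs <;> simp
  | hm j a =>
    rw [regMat_mono, conjDiag, Matrix.diagonal_mul, shiftMat_pow_apply, Polynomial.coeff_C_mul,
      cf_mono]
    by_cases hij : j = i
    · subst hij
      rw [if_pos (rfl : j = j)]
      split_ifs <;> simp
    · have : i ≠ j := fun h => hij h.symm
      split_ifs <;> simp [Polynomial.coeff_X_pow, this]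

theorem natDegree_regMat_le {f : SkewRing σ} {m : ℕ} (hf : f ∈ degLT σ (m + 1))
    (τ τ' : L ≃ₐ[K] L) : (regMat σ f τ τ').natDegree ≤ m := by
  rw [Polynomial.natDegree_le_iff_coeff_eq_zero]
  intro i hi
  rw [coeff_regMat, hf i hi]
  simp

theorem coeff_det_of_natDegree_le {ι R : Type*} [Fintype ι] [DecidableEq ι] [CommRing R]
    {M : Matrix ι ι R[X]} {m : ℕ} (hM : ∀ i j, (M i j).natDegree ≤ m) :
    M.det.coeff (Fintype.card ι * m) = (Matrix.of fun i j => (M i j).coeff m).det := by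
  rw [Matrix.det_apply, Matrix.det_apply, Polynomial.finsetSum_coeff]
  refine Finset.sum_congr rfl fun π _ => ?_
  rw [Units.smul_def, Units.smul_def, zsmul_eq_mul, zsmul_eq_mul, ← Polynomial.C_eq_intCast,
    Polynomial.coeff_C_mul]
  congr 1
  exact Polynomial.coeff_prod_of_natDegree_le _ _ m fun i _ => hM _ _

theorem natDegree_det_le_of_natDegree_le {ι R : Type*} [Fintype ι] [DecidableEq ι] [CommRing R]
    {M : Matrix ι ι R[X]} {m : ℕ} (hM : ∀ i j, (M i j).natDegree ≤ m) :
    M.det.natDegree ≤ Fintype.card ι * m := by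
  rw [Matrix.det_apply]
  refine Polynomial.natDegree_sum_le_of_forall_le _ _ fun π _ => ?_
  rw [Units.smul_def, zsmul_eq_mul, ← Polynomial.C_eq_intCast]
  refine (Polynomial.natDegree_C_mul_le _ _).trans ((Polynomial.natDegree_prod_le _ _).trans ?_)
  refine (Finset.sum_le_card_nsmul _ _ m fun i _ => hM _ _).trans ?_
  simp

variable [Finite K]

theorem prod_conj (a : L) :
    ∏ τ : L ≃ₐ[K] L, τ a = algebraMap K L (Algebra.norm K a) := by
  have : Finite L := Module.finite_of_finite K
  exact (Algebra.norm_eq_prod_automorphisms K a).symm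

/-- At X = 0 only the constant coefficient survives, and the matrix is the diagonal of its
conjugates. -/
theorem coeff_zero_det_regMat (f : SkewRing σ) :
    (regMat σ f).det.coeff 0 = algebraMap K L (Algebra.norm K (cf σ 0 f)) := by
  rw [← prod_conj, Polynomial.coeff_zero_eq_eval_zero, ← Polynomial.coe_evalRingHom,
    RingHom.map_det]
  have : (Polynomial.evalRingHom 0).mapMatrix (regMat σ f) =
      Matrix.diagonal fun τ : L ≃ₐ[K] L => τ (cf σ 0 f) := by
    ext τ τ'
    rw [RingHom.mapMatrix_apply, Matrix.map_apply, Polynomial.coe_evalRingHom,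
      ← Polynomial.coeff_zero_eq_eval_zero, coeff_regMat, pow_zero, mul_one,
      Matrix.diagonal_apply]
    simp only [eq_comm]
  rw [this, Matrix.det_diagonal]

/-- Right translation by a generator is a single cycle of length n; for n even it is odd. The sign
(-1)^{sk} of the admissibility condition comes from here. -/
theorem sign_mulRight (hσ : IsGenerator σ) (hn : Even (Module.finrank K L)) :
    Equiv.Perm.sign (Equiv.mulRight σ) = -1 := by
  have h1 : σ ≠ 1 := by
    rintro rfl
    have := orderOf_of_isGenerator hσ
    rw [orderOf_one] at this
    rw [← this] at hn
    exact absurd hn (by decide)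
  have hc : (Equiv.mulRight σ).IsCycle := by
    refine ⟨1, by simpa using h1, fun τ _ => ?_⟩
    obtain ⟨i, hi⟩ := hσ τ
    refine ⟨i, ?_⟩
    rw [Equiv.zpow_mulRight]
    simpa using hi
  have hs : (Equiv.mulRight σ).support = Finset.univ := by
    ext τ
    simp [h1]
  rw [hc.sign, hs, Finset.card_univ, ← Nat.card_eq_fintype_card, card_aut, hn.neg_one_pow]

/-- The coefficients of X^m form a monomial matrix: the conjugates of the leading coefficient times
the permutation τ ↦ τσ^m, whose sign is (-1)^m. -/
theorem coeff_top_det_regMat (hσ : IsGenerator σ) (hn : Even (Module.finrank K L))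
    {f : SkewRing σ} {m : ℕ} (hf : f ∈ degLT σ (m + 1)) :
    (regMat σ f).det.coeff (Module.finrank K L * m) =
      algebraMap K L ((-1) ^ m * Algebra.norm K (cf σ m f)) := by
  rw [← card_aut, Nat.card_eq_fintype_card, coeff_det_of_natDegree_le (natDegree_regMat_le hf)]
  have : (Matrix.of fun τ τ' => (regMat σ f τ τ').coeff m) =
      Matrix.diagonal (fun τ : L ≃ₐ[K] L => τ (cf σ m f)) *
        (Equiv.mulRight (σ ^ m)).permMatrix L := by
    ext τ τ'
    rw [Matrix.of_apply, coeff_regMat, Matrix.diagonal_mul, Equiv.Perm.permMatrix,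
      PEquiv.toMatrix_apply]
    simp [eq_comm]
  rw [this, Matrix.det_mul, Matrix.det_diagonal, Matrix.det_permutation, prod_conj,
    ← Equiv.pow_mulRight, map_pow, sign_mulRight hσ hn]
  simp [mul_comm]

/-- Applying τ to all entries only relabels rows and columns simultaneously by left translation.
Hence the determinant has coefficients in K. -/
theorem det_regMat_map (τ : L ≃ₐ[K] L) (f : SkewRing σ) :
    (regMat σ f).det.map (τ : L →+* L) = (regMat σ f).det := by
  have : (Polynomial.mapRingHom (τ : L →+* L)).mapMatrix (regMat σ f) =
      (regMat σ f).submatrix (Equiv.mulLeft τ) (Equiv.mulLeft τ) := by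
    ext τ₁ τ₂ i
    simp only [RingHom.mapMatrix_apply, Matrix.map_apply, Polynomial.coe_mapRingHom,
      Polynomial.coeff_map, Matrix.submatrix_apply, coeff_regMat, Equiv.coe_mulLeft, mul_assoc,
      mul_right_inj]
    split_ifs <;> simp
  rw [← Polynomial.coe_mapRingHom, RingHom.map_det, this, Matrix.det_submatrix_equiv_self]

/-- Here r is the discrete logarithm to base σ in [0, n). The term with the integer quotient records
the wrap from n - 1 to 0. -/
theorem exists_log (hσ : IsGenerator σ) : ∃ r : (L ≃ₐ[K] L) → ℕ,
    ∀ τ, r (τ * σ) + Module.finrank K L * ((r τ + 1) / Module.finrank K L) = r τ + 1 := by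
  have hex : ∀ τ : L ≃ₐ[K] L, ∃ i, i < Module.finrank K L ∧ σ ^ i = τ := by
    intro τ
    have hfin : IsOfFinOrder σ := isOfFinOrder_of_finite σ
    obtain ⟨i, hi⟩ := (hfin.mem_zpowers_iff_mem_range_orderOf).1 (hσ τ) |> Finset.mem_image.1
    exact ⟨i, by simpa [orderOf_of_isGenerator hσ] using hi.1, hi.2⟩
  choose r hr hr' using hex
  refine ⟨r, fun τ => ?_⟩
  have h : σ ^ r (τ * σ) = σ ^ (r τ + 1) := by rw [hr', pow_succ, hr']
  rw [pow_eq_pow_iff_modEq, orderOf_of_isGenerator hσ] at h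
  have h' : r (τ * σ) = (r τ + 1) % Module.finrank K L := by
    rw [← h, Nat.mod_eq_of_lt (hr _)]
  rw [h', Nat.mod_add_div]

/-- Conjugation by the diagonal matrix of X^{r(τ)} multiplies the entry X^i at (τ, τσ^i) by X^{r(τ)
- r(τσ^i)}. The total exponent is divisible by n, so the conjugated matrix, which has the same
determinant, has entries in L[X^n]. -/
theorem det_regMat_eq_expand (hσ : IsGenerator σ) (f : SkewRing σ) :
    ∃ p : L[X], (regMat σ f).det = expand L (Module.finrank K L) p := by
  obtain ⟨r, hr⟩ := exists_log hσ
  set Δ : Matrix (L ≃ₐ[K] L) (L ≃ₐ[K] L) L[X] := Matrix.diagonal fun τ => X ^ r τ with hΔ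
  set e : Matrix (L ≃ₐ[K] L) (L ≃ₐ[K] L) L[X] →+* Matrix (L ≃ₐ[K] L) (L ≃ₐ[K] L) L[X] :=
    (expand L (Module.finrank K L) : L[X] →+* L[X]).mapMatrix with he
  have hd : ∀ a, Δ * conjDiag K a = e (conjDiag K a) * Δ := by
    intro a
    have : e (conjDiag K a) = conjDiag K a := by
      ext τ τ' : 2
      simp only [he, conjDiag, RingHom.mapMatrix_apply, Matrix.map_apply, Matrix.diagonal_apply]
      split_ifs <;> simp
    rw [this, hΔ, conjDiag, Matrix.diagonal_mul_diagonal, Matrix.diagonal_mul_diagonal]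
    simp only [mul_comm]
  have hs : ∃ M, Δ * shiftMat σ = e M * Δ := by
    refine ⟨Matrix.of fun τ τ' => if τ' = τ * σ then X ^ ((r τ + 1) / Module.finrank K L) else 0, ?_⟩
    ext τ τ' : 2
    rw [hΔ, Matrix.diagonal_mul, Matrix.mul_diagonal]
    simp only [shiftMat, Matrix.of_apply, he, RingHom.mapMatrix_apply, Matrix.map_apply]
    split_ifs with h
    · subst h
      simp only [RingHom.coe_coe, map_pow, expand_X]
      rw [← pow_mul, ← pow_add, add_comm _ (r _), hr, pow_succ]
    · simp
  have hsp : ∀ i, ∃ M, Δ * shiftMat σ ^ i = e M * Δ := by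
    intro i
    induction i with
    | zero => exact ⟨1, by simp⟩
    | succ i ih =>
      obtain ⟨M, hM⟩ := ih
      obtain ⟨S, hS⟩ := hs
      exact ⟨M * S, by rw [pow_succ, ← mul_assoc, hM, mul_assoc, hS, map_mul, mul_assoc]⟩
  obtain ⟨M, hM⟩ : ∃ M, Δ * regMat σ f = e M * Δ := by
    induction f using skew_induction with
    | hadd f g hf hg =>
      obtain ⟨M, hM⟩ := hf
      obtain ⟨M', hM'⟩ := hg
      exact ⟨M + M', by rw [map_add, mul_add, hM, hM', map_add, add_mul]⟩
    | hm i a =>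
      obtain ⟨M, hM⟩ := hsp i
      exact ⟨conjDiag K a * M, by
        rw [regMat_mono, ← mul_assoc, hd, mul_assoc, hM, map_mul, mul_assoc]⟩
  refine ⟨M.det, ?_⟩
  have hdet := congrArg Matrix.det hM
  rw [Matrix.det_mul, Matrix.det_mul, mul_comm] at hdet
  have hΔ0 : Δ.det ≠ 0 := by
    rw [hΔ, Matrix.det_diagonal]
    exact Finset.prod_ne_zero_iff.2 fun τ _ => pow_ne_zero _ X_ne_zero
  rw [mul_right_cancel₀ hΔ0 hdet, he, ← RingHom.map_det]
  rfl

/-- The reduced norm of a skew polynomial is a polynomial over the base field. -/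
theorem exists_reducedNorm (hσ : IsGenerator σ) (f : SkewRing σ) :
    ∃ p : K[X], (regMat σ f).det = (expand K (Module.finrank K L) p).map (algebraMap K L) := by
  obtain ⟨p, hp⟩ := det_regMat_eq_expand hσ f
  have hn : 0 < Module.finrank K L := Module.finrank_pos
  have hlift : p ∈ Polynomial.lifts (algebraMap K L) := by
    rw [Polynomial.lifts_iff_coeff_lifts]
    intro i
    refine mem_base_of_fixed hσ ?_
    have := congrArg (fun P => Polynomial.coeff P (i * Module.finrank K L)) (det_regMat_map σ f)
    simp only [hp, Polynomial.coeff_map, coeff_expand_mul hn] at this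
    exact this
  obtain ⟨p', rfl⟩ := (Polynomial.mem_lifts p).1 hlift
  exact ⟨p', by rw [hp, Polynomial.map_expand]⟩

/-- Both sides are ring homomorphisms in G, so constants and y suffice. The determinant is then
G(X^n)^n, which makes F^n appear below. -/
theorem regMat_evalXPow (G : K[X]) :
    regMat σ (evalXPow σ G) = Matrix.scalar _
      ((expand K (Module.finrank K L) G).map (algebraMap K L)) := by
  rw [← evalXPowHom_apply]
  have : (regMat σ).comp (evalXPowHom σ) = (Matrix.scalar (L ≃ₐ[K] L)).comp
      ((Polynomial.mapRingHom (algebraMap K L)).comp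
        (expand K (Module.finrank K L) : K[X] →+* K[X])) := by
    refine Polynomial.ringHom_ext (fun a => ?_) ?_
    · rw [RingHom.comp_apply, evalXPowHom_apply]
      have : evalXPow σ (C a) = mono σ 0 (algebraMap K L a) := by
        rw [evalXPow, Polynomial.sum_C_index] <;> simp
      rw [this, regMat_mono, pow_zero, mul_one, conjDiag]
      simp
    · rw [RingHom.comp_apply, evalXPowHom_apply, evalXPow_X, regMat_mono, conjDiag_one, one_mul]
      ext τ τ' : 2
      rw [shiftMat_pow_apply, pow_finrank]
      simp [Matrix.diagonal_apply, eq_comm]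
  exact RingHom.congr_fun this G

/-- If `f`, of degree `m = sk`, divides `F(x ^ n)` on the right, then its reduced norm is a scalar
multiple of `F ^ k`. -/
theorem norm_of_mul_eq (hσ : IsGenerator σ) (hn : Even (Module.finrank K L)) {F : K[X]}
    (hF : F.Monic) (hirr : Irreducible F) {k : ℕ} {f h : SkewRing σ}
    (hf : f ∈ degLT σ (F.natDegree * k + 1)) (hfm : cf σ (F.natDegree * k) f ≠ 0) {c : L}
    (hc : c ≠ 0) (heq : h * f = mono σ 0 c * evalXPow σ F) :
    Algebra.norm K (cf σ 0 f) = (-1) ^ (F.natDegree * k) *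
      Algebra.norm K (cf σ (F.natDegree * k) f) * F.coeff 0 ^ k := by
  have hn0 : 0 < Module.finrank K L := Module.finrank_pos
  obtain ⟨p, hp⟩ := exists_reducedNorm hσ f
  obtain ⟨p', hp'⟩ := exists_reducedNorm hσ h
  set m := F.natDegree * k with hm
  have hinj : Function.Injective (Polynomial.map (algebraMap K L)) :=
    Polynomial.map_injective _ (algebraMap K L).injective
  have hnc : Algebra.norm K c ≠ 0 := Algebra.norm_ne_zero_iff.2 hc
  -- Determinants of `heq` give p p' = N(c) F^n once X^n is replaced by y.
  have hdvd : p ∣ F ^ Module.finrank K L := by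
    have h1 := congrArg (fun g => (regMat σ g).det) heq
    simp only [map_mul, Matrix.det_mul, hp, hp', regMat_mono, regMat_evalXPow] at h1
    rw [pow_zero, Matrix.det_one, mul_one, conjDiag, Matrix.det_diagonal, Matrix.scalar_apply,
      Matrix.det_diagonal, ← map_prod, prod_conj, Finset.prod_const, Finset.card_univ,
      ← Nat.card_eq_fintype_card, card_aut, ← Polynomial.map_mul, ← map_mul,
      ← Polynomial.map_pow, ← map_pow, ← Polynomial.map_C, ← Polynomial.map_mul] at h1
    have h2 := hinj h1
    rw [← expand_C (R := K) (Module.finrank K L), ← map_mul] at h2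
    have h3 := Polynomial.expand_injective hn0 h2
    have h4 : p ∣ C (Algebra.norm K c) * F ^ Module.finrank K L := ⟨p', by rw [← h3, mul_comm]⟩
    exact (IsUnit.dvd_mul_left (Polynomial.isUnit_C.2 hnc.isUnit)).1 h4
  obtain ⟨j, -, hj⟩ := (dvd_prime_pow hirr.prime _).1 hdvd
  have hcoef : ∀ i, algebraMap K L (p.coeff i) =
      (regMat σ f).det.coeff (Module.finrank K L * i) := fun i => by
    rw [hp, Polynomial.coeff_map, mul_comm, coeff_expand_mul hn0]
  have hpm : p.coeff m = (-1) ^ m * Algebra.norm K (cf σ m f) :=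
    (algebraMap K L).injective (by rw [hcoef, coeff_top_det_regMat hσ hn hf])
  have hp0 : p.coeff 0 = Algebra.norm K (cf σ 0 f) :=
    (algebraMap K L).injective (by rw [hcoef, mul_zero, coeff_zero_det_regMat])
  have hpm0 : p.coeff m ≠ 0 := by
    rw [hpm]
    exact mul_ne_zero (pow_ne_zero _ (neg_ne_zero.2 one_ne_zero)) (Algebra.norm_ne_zero_iff.2 hfm)
  -- The entries have degree at most m, so p(X^n) has degree at most nm; the coefficient of p at m
  -- is a nonzero norm up to sign.
  have hdeg : p.natDegree = m := by
    refine le_antisymm ?_ (Polynomial.le_natDegree_of_ne_zero hpm0)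
    have h1 := natDegree_det_le_of_natDegree_le (natDegree_regMat_le hf)
    rw [hp, Polynomial.natDegree_map, natDegree_expand, ← Nat.card_eq_fintype_card, card_aut,
      mul_comm] at h1
    exact le_of_mul_le_mul_left h1 hn0
  have hjk : j = k := by
    have h1 := Polynomial.natDegree_eq_of_degree_eq (Polynomial.degree_eq_degree_of_associated hj)
    rw [hdeg, Polynomial.natDegree_pow, hm, mul_comm] at h1
    exact (Nat.eq_of_mul_eq_mul_right hirr.natDegree_pos h1).symm
  subst hjk
  obtain ⟨v, hv⟩ := hj.symm
  obtain ⟨w, -, hw⟩ := Polynomial.isUnit_iff.1 v.isUnit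
  rw [← hw] at hv
  have hw' : w = p.coeff m := by
    rw [← hv, Polynomial.coeff_mul_C, hm, mul_comm F.natDegree, ← hF.natDegree_pow, (hF.pow j).coeff_natDegree,
      one_mul]
  rw [← hp0, ← hpm, ← hw', ← hv, Polynomial.coeff_mul_C, mul_comm]
  congr 1
  rw [Polynomial.coeff_zero_eq_eval_zero, Polynomial.eval_pow, Polynomial.coeff_zero_eq_eval_zero]

end ReducedNorm

end SkewMRD

namespace SkewMRD

/-! ### The families D and S in terms of coefficients, and their sizes. -/

section Codes

variable {K L : Type u} [Field K] [Field L] [Algebra K L] {σ : L ≃ₐ[K] L}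

theorem cf_sum_mono_finset (S : Finset ℕ) (a : ℕ → L) (j : ℕ) :
    cf σ j (∑ i ∈ S, mono σ i (a i)) = if j ∈ S then a j else 0 := by
  rw [map_sum]
  simp only [cf_mono]
  rw [Finset.sum_ite_eq']

theorem mem_codeD_iff {L' : IntermediateField K L} {F : K[X]} {k : ℕ} {γ : L}
    (hr : 0 < F.natDegree * k) (z : SkewQuot σ F) :
    z ∈ codeD σ L' F k γ ↔ ∃ f ∈ degLT σ (F.natDegree * k + 1), toQuot σ F f = z ∧
      cf σ 0 f ∈ L' ∧ ∃ a ∈ L', cf σ (F.natDegree * k) f = γ * a := by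
  constructor
  · rintro ⟨a, a', a'', h', h'', rfl⟩
    refine ⟨_, ?_, rfl, ?_, a'', h'', ?_⟩
    · refine add_mem (add_mem (mono_mem_degLT (by lia) _) (sum_mem fun i hi => ?_))
        (mono_mem_degLT (by lia) _)
      exact mono_mem_degLT (by have := Finset.mem_Ico.1 hi; lia) _
    · rw [map_add, map_add, cf_sum_mono_finset, cf_mono_self, if_neg (by simp),
        cf_mono_ne hr.ne', add_zero, add_zero]
      exact h'
    · rw [map_add, map_add, cf_sum_mono_finset, cf_mono_self, if_neg (by simp),
        cf_mono_ne hr.ne, zero_add, zero_add]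
  · rintro ⟨f, hf, rfl, h', a'', h'', hr'⟩
    refine ⟨fun i => cf σ i f, cf σ 0 f, a'', h', h'', congrArg _ (skew_ext fun j => ?_)⟩
    rw [← hr', map_add, map_add, cf_sum_mono_finset, cf_mono, cf_mono]
    simp only [Finset.mem_Ico]
    clear hr'
    generalize F.natDegree * k = r at *
    rcases Nat.eq_zero_or_pos j with rfl | hj
    · simp [hr.ne']
    · rcases lt_trichotomy j r with h | rfl | h
      · rw [if_neg hj.ne, if_pos ⟨hj, h⟩, if_neg h.ne', zero_add, add_zero]
      · simp [hj.ne]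
      · rw [hf j h, if_neg hj.ne, if_neg (by lia), if_neg (by lia)]
        simp

theorem mem_codeS_iff {ρ : L ≃+* L} {F : K[X]} {k : ℕ} {η : L}
    (hr : 0 < F.natDegree * k) (z : SkewQuot σ F) :
    z ∈ codeS σ ρ F k η ↔ ∃ f ∈ degLT σ (F.natDegree * k + 1), toQuot σ F f = z ∧
      cf σ (F.natDegree * k) f = η * ρ (cf σ 0 f) := by
  constructor
  · rintro ⟨a, rfl⟩
    refine ⟨_, ?_, rfl, ?_⟩
    · exact add_mem (degLT_mono (by lia) (sum_mono_mem_degLT _ _)) (mono_mem_degLT (by lia) _)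
    · rw [map_add, map_add, cf_sum_mono, cf_sum_mono, cf_mono_self, cf_mono_ne (by lia),
        if_neg (by lia), if_pos hr, zero_add, add_zero]
  · rintro ⟨f, hf, rfl, hr'⟩
    refine ⟨fun i => cf σ i f, congrArg _ (skew_ext fun j => ?_)⟩
    rw [← hr', map_add, cf_sum_mono, cf_mono]
    rcases lt_trichotomy j (F.natDegree * k) with h | rfl | h
    · rw [if_pos h, if_neg h.ne', add_zero]
    · rw [if_neg (lt_irrefl _), if_pos rfl, zero_add]
    · rw [hf j h, if_neg (by lia), if_neg (by lia)]
      simp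

variable (σ) in
/-- The codes of the family `D` as additive groups. -/
noncomputable def codeDGroup (L' : IntermediateField K L) (F : K[X]) (k : ℕ) (γ : L)
    (hr : 0 < F.natDegree * k) : AddSubgroup (SkewQuot σ F) where
  carrier := codeD σ L' F k γ
  zero_mem' := (mem_codeD_iff hr _).2 ⟨0, zero_mem _, map_zero _, by simp [zero_mem], 0,
    zero_mem _, by simp⟩
  add_mem' := by
    intro x y hx hy
    obtain ⟨f, hf, rfl, hf0, a, ha, hfr⟩ := (mem_codeD_iff hr _).1 hx
    obtain ⟨g, hg, rfl, hg0, b, hb, hgr⟩ := (mem_codeD_iff hr _).1 hy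
    exact (mem_codeD_iff hr _).2 ⟨f + g, add_mem hf hg, map_add _ _ _,
      by rw [map_add]; exact add_mem hf0 hg0, a + b, add_mem ha hb,
      by rw [map_add, hfr, hgr, mul_add]⟩
  neg_mem' := by
    intro x hx
    obtain ⟨f, hf, rfl, hf0, a, ha, hfr⟩ := (mem_codeD_iff hr _).1 hx
    exact (mem_codeD_iff hr _).2 ⟨-f, neg_mem hf, map_neg _ _,
      by rw [map_neg]; exact neg_mem hf0, -a, neg_mem ha, by rw [map_neg, hfr, mul_neg]⟩

variable (σ) in
/-- The codes of the family `S` as additive groups. -/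
noncomputable def codeSGroup (ρ : L ≃+* L) (F : K[X]) (k : ℕ) (η : L)
    (hr : 0 < F.natDegree * k) : AddSubgroup (SkewQuot σ F) where
  carrier := codeS σ ρ F k η
  zero_mem' := (mem_codeS_iff hr _).2 ⟨0, zero_mem _, map_zero _, by simp⟩
  add_mem' := by
    intro x y hx hy
    obtain ⟨f, hf, rfl, hfr⟩ := (mem_codeS_iff hr _).1 hx
    obtain ⟨g, hg, rfl, hgr⟩ := (mem_codeS_iff hr _).1 hy
    exact (mem_codeS_iff hr _).2 ⟨f + g, add_mem hf hg, map_add _ _ _,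
      by rw [map_add, map_add, map_add, hfr, hgr, mul_add]⟩
  neg_mem' := by
    intro x hx
    obtain ⟨f, hf, rfl, hfr⟩ := (mem_codeS_iff hr _).1 hx
    exact (mem_codeS_iff hr _).2 ⟨-f, neg_mem hf, map_neg _ _,
      by rw [map_neg, map_neg, map_neg, hfr, mul_neg]⟩

variable [Finite K] [FiniteDimensional K L]

theorem card_codeS {ρ : L ≃+* L} {F : K[X]} (hF : F.Monic) {k : ℕ} {η : L}
    (hr : 0 < F.natDegree * k) (hk : k < Module.finrank K L) :
    (codeS σ ρ F k η).ncard = Nat.card L ^ (F.natDegree * k) := by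
  have hlt : F.natDegree * k < Module.finrank K L * F.natDegree := by
    rw [mul_comm (Module.finrank K L)]
    exact Nat.mul_lt_mul_of_pos_left hk (Nat.pos_of_mul_pos_right hr)
  rw [← card_degLT (σ := σ), ← Nat.card_coe_set_eq]
  refine (Nat.card_congr (Equiv.ofBijective (fun f : degLT σ (F.natDegree * k) =>
    (⟨toQuot σ F (f.1 + mono σ (F.natDegree * k) (η * ρ (cf σ 0 f.1))),
      (mem_codeS_iff hr _).2 ⟨_, add_mem (degLT_mono (by lia) f.2) (mono_mem_degLT (by lia) _), rfl,
        by rw [map_add, map_add, f.2 _ le_rfl, cf_mono_self, cf_mono_ne hr.ne', zero_add,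
          add_zero]⟩⟩ : codeS σ ρ F k η)) ⟨?_, ?_⟩)).symm
  · intro f g h
    have h := eq_of_toQuot hF
      (add_mem (degLT_mono (by lia) f.2) (mono_mem_degLT (by lia) _))
      (add_mem (degLT_mono (by lia) g.2) (mono_mem_degLT (by lia) _)) (congrArg Subtype.val h)
    refine Subtype.ext (skew_ext fun i => ?_)
    rcases lt_or_ge i (F.natDegree * k) with hi | hi
    · have h := congrArg (cf σ i) h
      rwa [map_add, map_add, cf_mono_ne hi.ne', cf_mono_ne hi.ne', add_zero, add_zero] at h
    · rw [f.2 i hi, g.2 i hi]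
  · rintro ⟨z, hz⟩
    obtain ⟨f, hf, rfl, hfr⟩ := (mem_codeS_iff hr _).1 hz
    refine ⟨⟨f - mono σ (F.natDegree * k) (cf σ (F.natDegree * k) f),
      mem_degLT_of_succ (sub_mem hf (mono_mem_degLT (by lia) _)) (by simp)⟩, Subtype.ext ?_⟩
    change toQuot σ F (f - mono σ (F.natDegree * k) (cf σ (F.natDegree * k) f) +
      mono σ (F.natDegree * k) (η * ρ (cf σ 0 (f - mono σ (F.natDegree * k)
        (cf σ (F.natDegree * k) f))))) = _
    rw [map_sub (cf σ 0), cf_mono_ne hr.ne', sub_zero, ← hfr, sub_add_cancel]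

theorem card_codeD {L' : IntermediateField K L} {F : K[X]} (hF : F.Monic) {k : ℕ} {γ : L}
    (hγ : γ ≠ 0) (hr : 0 < F.natDegree * k) (hk : k < Module.finrank K L)
    (hL' : 2 * Module.finrank K L' = Module.finrank K L) :
    (codeD σ L' F k γ).ncard = Nat.card L ^ (F.natDegree * k) := by
  have hlt : F.natDegree * k < Module.finrank K L * F.natDegree := by
    rw [mul_comm (Module.finrank K L)]
    exact Nat.mul_lt_mul_of_pos_left hk (Nat.pos_of_mul_pos_right hr)
  obtain ⟨r, hr'⟩ := Nat.exists_eq_succ_of_ne_zero hr.ne'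
  -- The two coordinates in L' together count as one in L, because L has degree 2 over L'.
  have hcard : Nat.card (L' × (Fin r → L) × L') = Nat.card L ^ (F.natDegree * k) := by
    have h1 : Nat.card L = Nat.card L' * Nat.card L' := by
      rw [Module.natCard_eq_pow_finrank (K := K) (V := L), ← hL', two_mul, pow_add,
        ← Module.natCard_eq_pow_finrank]
    rw [Nat.card_prod, Nat.card_prod, Nat.card_fun, Nat.card_fin, hr', pow_succ]
    rw [mul_left_comm, ← h1]
  rw [← hcard, ← Nat.card_coe_set_eq]
  set φ : L' × (Fin r → L) × L' → SkewRing σ := fun p => mono σ 0 p.1 +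
    ∑ i ∈ Finset.range r, mono σ (i + 1) (if h : i < r then p.2.1 ⟨i, h⟩ else 0) +
      mono σ (r + 1) (γ * p.2.2) with hφ
  have hdeg : ∀ p, φ p ∈ degLT σ (r + 2) := fun p =>
    add_mem (add_mem (mono_mem_degLT (by lia) _) (sum_mem fun i hi =>
      mono_mem_degLT (by have := Finset.mem_range.1 hi; lia) _)) (mono_mem_degLT (by lia) _)
  have hcf : ∀ p j, cf σ j (∑ i ∈ Finset.range r, mono σ (i + 1)
      (if h : i < r then p.2.1 ⟨i, h⟩ else 0)) = if h : 0 < j ∧ j - 1 < r then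
        (p : L' × (Fin r → L) × L').2.1 ⟨j - 1, h.2⟩ else 0 := by
    intro p j
    rw [map_sum]
    rcases j with _ | j
    · simp [cf_mono]
    · simp only [cf_mono, Nat.add_right_cancel_iff]
      rw [Finset.sum_ite_eq']
      by_cases h : j < r
      · simp [h]
      · simp [h]
  have h0 : ∀ p, cf σ 0 (φ p) = p.1 := by
    intro p
    simp only [hφ, map_add]
    rw [hcf, cf_mono_self, cf_mono_ne (by lia), dif_neg (by lia)]
    simp
  have htop : ∀ p, cf σ (r + 1) (φ p) = γ * p.2.2 := by
    intro p
    simp only [hφ, map_add]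
    rw [hcf, cf_mono_self, cf_mono_ne (by lia), dif_neg (by lia)]
    simp
  have hmid : ∀ p (i : Fin r), cf σ (i + 1) (φ p) = p.2.1 i := by
    intro p i
    simp only [hφ, map_add]
    rw [hcf, cf_mono_ne (by lia), cf_mono_ne (by lia), dif_pos (by lia)]
    simp
  refine (Nat.card_congr (Equiv.ofBijective (fun p : L' × (Fin r → L) × L' =>
    (⟨toQuot σ F (φ p), (mem_codeD_iff hr _).2 ⟨φ p, by rw [hr']; exact hdeg p, rfl,
      by rw [h0]; exact p.1.2, p.2.2, p.2.2.2, by rw [hr']; exact htop p⟩⟩ :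
      codeD σ L' F k γ)) ⟨?_, ?_⟩)).symm
  · intro p p' h
    have h := eq_of_toQuot hF (degLT_mono (by lia) (hdeg p)) (degLT_mono (by lia) (hdeg p'))
      (congrArg Subtype.val h)
    refine Prod.ext (Subtype.ext ?_) (Prod.ext (funext fun i => ?_) (Subtype.ext ?_))
    · rw [← h0, ← h0, h]
    · rw [← hmid, ← hmid, h]
    · have := htop p
      rw [h, htop] at this
      exact (mul_left_cancel₀ hγ this).symm
  · rintro ⟨z, hz⟩
    obtain ⟨f, hf, rfl, hf0, a, ha, hfr⟩ := (mem_codeD_iff hr _).1 hz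
    refine ⟨⟨⟨_, hf0⟩, fun i => cf σ (i + 1) f, ⟨a, ha⟩⟩, Subtype.ext (congrArg (toQuot σ F) (skew_ext fun j => ?_))⟩
    rcases Nat.eq_zero_or_pos j with rfl | hj
    · rw [h0]
    · rcases lt_trichotomy j (r + 1) with h | rfl | h
      · obtain ⟨i, rfl⟩ := Nat.exists_eq_succ_of_ne_zero hj.ne'
        exact hmid _ ⟨i, by lia⟩
      · rw [htop, ← hfr, hr']
      · rw [hdeg _ j h, hf j (by lia)]

end Codes

/-! ### Counting bounds for ranks of matrices. -/

section Rank

variable {n : ℕ} {E : Type u} [Field E] [Finite E]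

/-- Every row of BA lies in the row space of A. -/
theorem card_range_mul_right_le (A : Matrix (Fin n) (Fin n) E) :
    Nat.card (Set.range fun B : Matrix (Fin n) (Fin n) E => B * A) ≤ Nat.card E ^ (n * A.rank) := by
  set W := Submodule.span E (Set.range A.row) with hW
  have hcard : Nat.card (Fin n → W) = Nat.card E ^ (n * A.rank) := by
    rw [Nat.card_fun, Nat.card_fin, Module.natCard_eq_pow_finrank (K := E) (V := W), ← pow_mul,
      Matrix.rank_eq_finrank_span_row, mul_comm]
  rw [← hcard]
  have hmem : ∀ M ∈ Set.range (fun B : Matrix (Fin n) (Fin n) E => B * A), ∀ i, M i ∈ W := by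
    rintro _ ⟨B, rfl⟩ i
    rw [hW, ← range_vecMulLinear]
    exact ⟨B i, rfl⟩
  refine Nat.card_le_card_of_injective (fun M i => (⟨M.1 i, hmem M.1 M.2 i⟩ : W)) ?_
  intro M N h
  refine Subtype.ext (funext fun i => ?_)
  exact congrArg Subtype.val (congrFun h i)

theorem rank_le_of_zero_rows {M : Matrix (Fin n) (Fin n) E} {m : ℕ}
    (h : ∀ i : Fin n, (i : ℕ) < m → M i = 0) : M.rank ≤ n - m := by
  classical
  rw [Matrix.rank_eq_finrank_span_row]
  set S : Finset (Fin n) := Finset.univ.filter fun i => m ≤ (i : ℕ) with hS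
  have hle : Submodule.span E (Set.range M.row) ≤
      Submodule.span E ((S.image M.row : Finset (Fin n → E)) : Set (Fin n → E)) := by
    rw [Submodule.span_le]
    rintro _ ⟨i, rfl⟩
    rcases lt_or_ge (i : ℕ) m with hi | hi
    · have : M.row i = 0 := h i hi
      rw [this]
      exact zero_mem _
    · refine Submodule.subset_span ?_
      rw [Finset.mem_coe, Finset.mem_image]
      exact ⟨i, by simp [hS, hi], rfl⟩
  refine (Submodule.finrank_mono hle).trans ((finrank_span_finset_le_card _).trans
    (Finset.card_image_le.trans ?_))
  have : S.card ≤ (Finset.Ico m n).card := by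
    refine Finset.card_le_card_of_injOn (fun i => (i : ℕ)) (fun i hi => ?_) ?_
    · simp only [hS, Finset.coe_filter, Finset.mem_univ, true_and] at hi
      have hi : m ≤ (i : ℕ) := hi
      simp [hi]
    · exact fun i _ j _ hij => Fin.ext hij
  simpa using this

/-- The pigeonhole form of the Singleton bound: two codewords agree in their first m rows. -/
theorem exists_rank_sub_le {C : Set (Matrix (Fin n) (Fin n) E)} {m : ℕ} (hm : m ≤ n)
    (hC : Nat.card E ^ (n * m) < C.ncard) : ∃ A ∈ C, ∃ B ∈ C, A ≠ B ∧ (A - B).rank ≤ n - m := by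
  have hcard : Nat.card (Fin m → Fin n → E) < Nat.card C := by
    rw [Nat.card_coe_set_eq, Nat.card_fun, Nat.card_fun, Nat.card_fin, Nat.card_fin, ← pow_mul]
    exact hC
  have : ¬ Function.Injective (fun (A : C) (i : Fin m) => A.1 (Fin.castLE hm i)) := fun h =>
    absurd (Nat.card_le_card_of_injective _ h) (not_le.2 hcard)
  simp only [Function.Injective, not_forall] at this
  obtain ⟨A, B, hAB, hne⟩ := this
  refine ⟨A, A.2, B, B.2, fun h => hne (Subtype.ext h), rank_le_of_zero_rows fun i hi => ?_⟩
  have := congrFun hAB ⟨i, hi⟩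
  funext j
  have := congrFun this j
  simpa [sub_eq_zero] using this

end Rank

end SkewMRD

namespace SkewMRD

/-! ### The minimum distance, linearity and MRD property of D. -/

section MinDist

variable {K L E : Type u} [Field K] [Field L] [Algebra K L] {σ : L ≃ₐ[K] L}
  [Finite K] [FiniteDimensional K L] [Field E] [Finite E] {n : ℕ}

/-- The left ideal of f has at most |K|^{sn(n-k)} elements, fewer than the |K|^{n(s(n-k)+1)}
polynomials of degree at most s(n - k). So some nonzero h of such degree has hf in the ideal of
F(x^n); since hf has degree at most ns, the cofactor of F(x^n) is constant. -/
theorem exists_mul_eq_of_rank_le (hn : Module.finrank K L = n) {F : K[X]} (hF : F.Monic)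
    (hE : Nat.card E = Nat.card K ^ F.natDegree)
    (θ : SkewQuot σ F ≃+* Matrix (Fin n) (Fin n) E) {k : ℕ} (hk : k ≤ n) {f : SkewRing σ}
    (hf : f ∈ degLT σ (F.natDegree * k + 1)) (hf0 : f ≠ 0)
    (hrank : (θ (toQuot σ F f)).rank ≤ n - k) :
    ∃ (h : SkewRing σ) (c : L), c ≠ 0 ∧ h * f = mono σ 0 c * evalXPow σ F ∧
      cf σ (F.natDegree * k) f ≠ 0 := by
  have hLfin : Finite L := Module.finite_of_finite K
  set m := F.natDegree * (n - k) with hm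
  have hmN : m + F.natDegree * k = n * F.natDegree := by
    rw [hm, ← mul_add, Nat.sub_add_cancel hk, mul_comm]
  have hcard : Nat.card (Set.range fun B : Matrix (Fin n) (Fin n) E => B * θ (toQuot σ F f)) <
      Nat.card (degLT σ (m + 1)) := by
    refine (card_range_mul_right_le _).trans_lt ?_
    rw [card_degLT, hE, Module.natCard_eq_pow_finrank (K := K) (V := L), hn, ← pow_mul, ← pow_mul]
    refine Nat.pow_lt_pow_right (Finite.one_lt_card) ?_
    rw [hm, mul_add, mul_one, mul_left_comm]
    have h1 : n * (θ (toQuot σ F f)).rank ≤ n * (n - k) := Nat.mul_le_mul_left _ hrank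
    have h2 := Nat.mul_le_mul_left F.natDegree h1
    have h3 : 0 < n := hn ▸ Module.finrank_pos
    rw [mul_left_comm] at h2 ⊢
    rw [mul_left_comm n] at h2
    rw [mul_left_comm n]
    lia
  have hninj : ¬ Function.Injective (fun h : degLT σ (m + 1) =>
      (⟨θ (toQuot σ F h.1) * θ (toQuot σ F f), _, rfl⟩ :
        Set.range fun B : Matrix (Fin n) (Fin n) E => B * θ (toQuot σ F f))) := fun h =>
    absurd (Nat.card_le_card_of_injective _ h) (not_le.2 hcard)
  obtain ⟨h, hh, hh0, hhf⟩ : ∃ h ∈ degLT σ (m + 1), h ≠ 0 ∧ toQuot σ F (h * f) = 0 := by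
    simp only [Function.Injective, not_forall] at hninj
    obtain ⟨a, b, hab, hne⟩ := hninj
    refine ⟨a - b, sub_mem a.2 b.2, fun h => hne (Subtype.ext (sub_eq_zero.1 h)), ?_⟩
    have hab := congrArg Subtype.val hab
    simp only [← map_mul] at hab
    rw [sub_mul, map_sub, map_mul, map_mul, ← map_mul, ← map_mul, map_mul, map_mul, sub_eq_zero]
    exact θ.injective (by simpa using hab)
  obtain ⟨u, hu⟩ := (toQuot_eq_zero_iff F _).1 hhf
  have hu0 : u ≠ 0 := by
    rintro rfl
    rw [zero_mul] at hu
    exact skew_mul_ne_zero hh0 hf0 hu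
  obtain ⟨a, ha, ha'⟩ := exists_lead hu0
  have h1 := cf_mul_top ha (evalXPow_mem_degLT (σ := σ) F)
  rw [← hu, cf_evalXPow_mul, hF.coeff_natDegree, map_one, map_one, mul_one, hn] at h1
  -- A cofactor of degree a > 0 would give hf the nonzero coefficient at ns + a, beyond its degree
  -- bound.
  have h2 : a = 0 := by
    by_contra hne
    refine ha' (h1.symm.trans (mul_mem_degLT hh hf _ ?_))
    rw [hmN]
    lia
  subst h2
  refine ⟨h, cf σ 0 u, ha', ?_, ?_⟩
  · rw [hu]
    congr 1
    have := eq_sum_mono ha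
    rwa [zero_add, Finset.sum_range_one] at this
  · intro h0
    rw [zero_add, ← hmN, cf_mul_top hh hf, h0, map_zero, mul_zero] at h1
    exact ha' h1.symm

/-- Since [L : L'] = 2, the norm of a from L to L' is a^2; transitivity of norms does the rest. -/
theorem isSquare_norm_of_mem {L' : IntermediateField K L}
    (hL' : 2 * Module.finrank K L' = Module.finrank K L) {a : L} (ha : a ∈ L') :
    IsSquare (Algebra.norm K a) := by
  have h2 : Module.finrank L' L = 2 := by
    have h1 := Module.finrank_mul_finrank K L' L
    rw [← hL', mul_comm] at h1
    exact Nat.eq_of_mul_eq_mul_right Module.finrank_pos h1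
  have h3 : Algebra.norm L' a = (⟨a, ha⟩ : L') ^ 2 := by
    rw [← h2, ← Algebra.norm_algebraMap]
    rfl
  rw [← Algebra.norm_norm (S := L'), h3, map_pow]
  exact ⟨_, sq _⟩

/-- Too small a rank gives the norm identity of `norm_of_mul_eq`. Dividing it by N(a''), which is a
nonzero square like N(a_0') is a square, exhibits the admissibility quantity as a square. -/
theorem rank_codeD_gt (hσ : IsGenerator σ) (hn : Module.finrank K L = n) (hev : Even n) {F : K[X]}
    (hF : F.Monic) (hirr : Irreducible F) (hE : Nat.card E = Nat.card K ^ F.natDegree)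
    (θ : SkewQuot σ F ≃+* Matrix (Fin n) (Fin n) E) {k : ℕ} (hk0 : 0 < k) (hk : k ≤ n)
    {L' : IntermediateField K L} (hL' : 2 * Module.finrank K L' = n) {γ : L}
    (hγ : ¬ IsSquare ((-1) ^ (F.natDegree * k) * F.coeff 0 ^ k * Algebra.norm K γ))
    {z : SkewQuot σ F} (hz : z ∈ codeD σ L' F k γ) (hz0 : z ≠ 0) : n - k < (θ z).rank := by
  have hr : 0 < F.natDegree * k := Nat.mul_pos hirr.natDegree_pos hk0
  obtain ⟨f, hf, rfl, hf0, a, ha, hfr⟩ := (mem_codeD_iff hr _).1 hz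
  by_contra! hle
  obtain ⟨h, c, hc, heq, hne⟩ := exists_mul_eq_of_rank_le hn hF hE θ hk hf
    (by rintro rfl; exact hz0 (map_zero _)) hle
  have hnorm := norm_of_mul_eq hσ (hn ▸ hev) hF hirr hf hne hc heq
  obtain ⟨v, hv⟩ := isSquare_norm_of_mem (hL'.trans hn.symm) ha
  obtain ⟨w, hw⟩ := isSquare_norm_of_mem (hL'.trans hn.symm) hf0
  rw [hfr] at hne
  have hv0 : v ≠ 0 := by
    rintro rfl
    rw [mul_zero, Algebra.norm_eq_zero_iff] at hv
    exact hne (by rw [hv, mul_zero])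
  refine hγ ⟨w / v, ?_⟩
  rw [hfr, map_mul, hw, hv] at hnorm
  field_simp
  rw [pow_two w, hnorm]
  ring

theorem isMinDist_codeD (hσ : IsGenerator σ) (hn : Module.finrank K L = n) (hev : Even n) {F : K[X]}
    (hF : F.Monic) (hirr : Irreducible F) (hE : Nat.card E = Nat.card K ^ F.natDegree)
    (θ : SkewQuot σ F ≃+* Matrix (Fin n) (Fin n) E) {k : ℕ} (hk0 : 0 < k) (hk : k < n)
    {L' : IntermediateField K L} (hL' : 2 * Module.finrank K L' = n) {γ : L}
    (hγ : ¬ IsSquare ((-1) ^ (F.natDegree * k) * F.coeff 0 ^ k * Algebra.norm K γ)) :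
    IsMinDist (θ '' codeD σ L' F k γ) (n - k + 1) := by
  have hr : 0 < F.natDegree * k := Nat.mul_pos hirr.natDegree_pos hk0
  have hγ0 : γ ≠ 0 := by
    rintro rfl
    refine hγ ⟨0, ?_⟩
    have : Nontrivial L := inferInstance
    rw [Algebra.norm_zero]
    simp
  have hlow : ∀ A ∈ θ '' codeD σ L' F k γ, ∀ B ∈ θ '' codeD σ L' F k γ, A ≠ B →
      n - k + 1 ≤ (A - B).rank := by
    rintro _ ⟨x, hx, rfl⟩ _ ⟨y, hy, rfl⟩ hne
    rw [← map_sub]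
    exact rank_codeD_gt hσ hn hev hF hirr hE θ hk0 hk.le hL' hγ
      ((codeDGroup σ L' F k γ hr).sub_mem hx hy) (sub_ne_zero.2 fun h => hne (congrArg θ h))
  constructor
  -- The codewords outnumber the possible first k - 1 rows, so some nonzero difference vanishes
  -- there and has rank at most n - k + 1.
  · obtain ⟨A, hA, B, hB, hne, hAB⟩ := exists_rank_sub_le (E := E) (n := n) (m := k - 1)
      (C := θ '' codeD σ L' F k γ) (by lia) (by
        rw [Set.ncard_image_of_injective _ θ.injective, card_codeD hF hγ0 hr (hn ▸ hk)
          (hL'.trans hn.symm), hE, Module.natCard_eq_pow_finrank (K := K) (V := L), hn,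
          ← pow_mul, ← pow_mul]
        refine Nat.pow_lt_pow_right Finite.one_lt_card ?_
        rw [mul_left_comm]
        refine Nat.mul_lt_mul_of_pos_left ?_ (by lia)
        exact Nat.mul_lt_mul_of_pos_left (by lia) hirr.natDegree_pos)
    exact ⟨A, hA, B, hB, hne, le_antisymm (hlow A hA B hB hne) (by lia)⟩
  · rintro _ ⟨A, hA, B, hB, hne, rfl⟩
    exact hlow A hA B hB hne

theorem ncard_pow_eq_self_le {M : Type*} [Field M] {N : ℕ} (hN : 1 < N) :
    {x : M | x ^ N = x}.Finite ∧ {x : M | x ^ N = x}.ncard ≤ N := by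
  classical
  have h0 : (X ^ N - X : M[X]) ≠ 0 := FiniteField.X_pow_card_sub_X_ne_zero M hN
  have hsub : {x : M | x ^ N = x} = ((X ^ N - X : M[X]).roots.toFinset : Set M) := by
    ext x
    simp [h0, sub_eq_zero]
  rw [hsub]
  refine ⟨Finset.finite_toSet _, ?_⟩
  rw [Set.ncard_coe_finset]
  refine (Multiset.toFinset_card_le _).trans ((Polynomial.card_roots' _).trans ?_)
  rw [FiniteField.X_pow_card_sub_X_natDegree_eq M hN]

/-- A set of `N` fixed points of `x ↦ x ^ N` in a field contains all of them. -/
theorem eq_pow_eq_self {M : Type*} [Field M] {S : Set M} (hN : 1 < S.ncard)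
    (hS : ∀ x ∈ S, x ^ S.ncard = x) : S = {x : M | x ^ S.ncard = x} :=
  Set.eq_of_subset_of_ncard_le hS (ncard_pow_eq_self_le hN).2 (ncard_pow_eq_self_le hN).1

theorem mem_range_scalar_of_mem_center {m : ℕ} {A : Matrix (Fin m) (Fin m) E}
    (hA : ∀ B, B * A = A * B) : ∃ e : E, Matrix.scalar (Fin m) e = A := by
  have : A ∈ Set.center (Matrix (Fin m) (Fin m) E) := Semigroup.mem_center_iff.2 hA
  rwa [Matrix.center_eq_range] at this

theorem commute_toQuot_base (F : K[X]) (c : K) (z : SkewQuot σ F) :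
    z * toQuot σ F (mono σ 0 (algebraMap K L c)) = toQuot σ F (mono σ 0 (algebraMap K L c)) * z := by
  obtain ⟨g, rfl⟩ := toQuot_surjective F z
  rw [← map_mul, ← map_mul]
  congr 1
  refine commute_of_commute_gens ?_ (fun a => ?_) g
  · simp [mono_mul_mono]
  · simp [mono_mul_mono, mul_comm]

theorem mono_zero_pow (a : L) (i : ℕ) : mono σ 0 a ^ i = mono σ 0 (a ^ i) := by
  induction i with
  | zero => rw [pow_zero, pow_zero, mono_zero_one]
  | succ i ih => rw [pow_succ, ih, mono_mul_mono, pow_zero, pow_succ]; rfl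

variable (σ) in
/-- The embedding of the coefficient field in the skew polynomial ring. -/
noncomputable def constHom : L →+* SkewRing σ where
  toFun := mono σ 0
  map_one' := rfl
  map_zero' := mono_zero 0
  map_add' := mono_add 0
  map_mul' a b := by simp [mono_mul_mono]

theorem toQuot_mono_zero_injective {F : K[X]} [Nontrivial (SkewQuot σ F)] :
    Function.Injective fun a : L => toQuot σ F (mono σ 0 a) :=
  ((toQuot σ F).comp (constHom σ)).injective

/-- The scalar matrices with entries in `K` correspond to the constants in `K`. -/
theorem exists_base_of_algebraMap [Algebra K E] [NeZero n] {F : K[X]}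
    (θ : SkewQuot σ F ≃+* Matrix (Fin n) (Fin n) E) (e : K) :
    ∃ c : K, θ (toQuot σ F (mono σ 0 (algebraMap K L c))) =
      Matrix.scalar (Fin n) (algebraMap K E e) := by
  have hnt : Nontrivial (SkewQuot σ F) := θ.toEquiv.nontrivial
  have hex : ∀ c : K, ∃ x : E, Matrix.scalar (Fin n) x =
      θ (toQuot σ F (mono σ 0 (algebraMap K L c))) := fun c =>
    mem_range_scalar_of_mem_center fun B => by
      obtain ⟨z, rfl⟩ := θ.surjective B
      rw [← map_mul, commute_toQuot_base, map_mul]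
  choose φ hφ using hex
  have hinj : Function.Injective φ := fun a b h => (algebraMap K L).injective
    (toQuot_mono_zero_injective (θ.injective (by rw [← hφ, h, hφ])))
  have hc1 : (Set.range φ).ncard = Nat.card K := Set.ncard_range_of_injective hinj
  have hc2 : (Set.range (algebraMap K E)).ncard = Nat.card K :=
    Set.ncard_range_of_injective (algebraMap K E).injective
  have hK : 1 < Nat.card K := Finite.one_lt_card
  have hpow : ∀ c : K, c ^ Nat.card K = c := fun c => by
    have := Fintype.ofFinite K
    rw [Nat.card_eq_fintype_card, FiniteField.pow_card]
  -- Nothing says that θ is K-linear. But the two copies of K in E both have q elements satisfying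
  -- x^q = x, so they coincide as sets, which is enough for closure under scalars.
  have h1 := eq_pow_eq_self (S := Set.range φ) (by rwa [hc1]) (by
    rintro _ ⟨c, rfl⟩
    rw [hc1]
    refine Matrix.scalar_inj.1 (?_ : Matrix.scalar (Fin n) _ = Matrix.scalar (Fin n) _)
    rw [map_pow, hφ, ← map_pow, ← map_pow, mono_zero_pow, ← map_pow, hpow])
  have h2 := eq_pow_eq_self (S := Set.range (algebraMap K E)) (by rwa [hc2]) (by
    rintro _ ⟨c, rfl⟩
    rw [hc2, ← map_pow, hpow])
  rw [hc1] at h1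
  rw [hc2, ← h1] at h2
  obtain ⟨c, hc⟩ : algebraMap K E e ∈ Set.range φ := h2 ▸ ⟨e, rfl⟩
  exact ⟨c, by rw [← hφ, hc]⟩

theorem isLinearMRD_codeD [Algebra K E] (hσ : IsGenerator σ) (hn : Module.finrank K L = n)
    (hev : Even n) {F : K[X]} (hF : F.Monic) (hirr : Irreducible F)
    (hE : Module.finrank K E = F.natDegree)
    (θ : SkewQuot σ F ≃+* Matrix (Fin n) (Fin n) E) {k : ℕ} (hk0 : 0 < k) (hk : k < n)
    {L' : IntermediateField K L} (hL' : 2 * Module.finrank K L' = n) {γ : L}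
    (hγ : ¬ IsSquare ((-1) ^ (F.natDegree * k) * F.coeff 0 ^ k * Algebra.norm K γ)) :
    IsLinearMRD K (θ '' codeD σ L' F k γ) (n - k + 1) := by
  have hEfin : FiniteDimensional K E :=
    Module.finite_of_finrank_pos (hE ▸ hirr.natDegree_pos)
  have hcE : Nat.card E = Nat.card K ^ F.natDegree := by
    rw [Module.natCard_eq_pow_finrank (K := K) (V := E), hE]
  refine ⟨isMinDist_codeD hσ hn hev hF hirr hcE θ hk0 hk hL' hγ, ?_⟩
  have hr : 0 < F.natDegree * k := Nat.mul_pos hirr.natDegree_pos hk0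
  have hγ0 : γ ≠ 0 := by
    rintro rfl
    refine hγ ⟨0, ?_⟩
    rw [Algebra.norm_zero]
    simp
  have : NeZero n := ⟨by lia⟩
  let V : Submodule K (Matrix (Fin n) (Fin n) E) :=
    { (codeDGroup σ L' F k γ hr).map (θ : SkewQuot σ F →+ Matrix (Fin n) (Fin n) E) with
      smul_mem' := by
        rintro e _ ⟨z, hz, rfl⟩
        obtain ⟨c, hc⟩ := exists_base_of_algebraMap θ e
        obtain ⟨f, hf, rfl, hf0, a, ha, hfr⟩ := (mem_codeD_iff hr _).1 hz
        refine ⟨toQuot σ F (mono σ 0 (algebraMap K L c) * f), (mem_codeD_iff hr _).2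
          ⟨_, by simpa using mono_mul_mem_degLT hf 0 (algebraMap K L c), rfl, ?_,
            algebraMap K L c * a, mul_mem (L'.algebraMap_mem c) ha, ?_⟩, ?_⟩
        · have := cf_mono_mul f 0 0 (algebraMap K L c)
          rw [add_zero] at this
          rw [this]
          exact mul_mem (L'.algebraMap_mem c) hf0
        · have := cf_mono_mul f 0 (F.natDegree * k) (algebraMap K L c)
          rw [zero_add] at this
          rw [this, pow_zero]
          change _ * cf σ _ f = _
          rw [hfr, mul_left_comm]
        · change θ _ = e • θ _
          rw [map_mul, map_mul, hc]
          ext i j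
          simp [Algebra.smul_def] }
  refine ⟨V, rfl, ?_⟩
  have hcard : Nat.card V = (codeD σ L' F k γ).ncard := by
    rw [← Set.ncard_image_of_injective _ θ.injective]
    rfl
  rw [card_codeD hF hγ0 hr (hn ▸ hk) (hL'.trans hn.symm),
    Module.natCard_eq_pow_finrank (K := K) (V := V),
    Module.natCard_eq_pow_finrank (K := K) (V := L), hn, ← pow_mul] at hcard
  rw [Nat.pow_right_injective (Finite.one_lt_card (α := K)) hcard, hE,
    show n - (n - k + 1) + 1 = k by lia]
  ring

end MinDist

end SkewMRD

namespace SkewMRD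

/-! ### Idealisers in an arbitrary ring and their transport along isomorphisms. -/

section Stabilisers

variable {A B : Type*} [Ring A] [Ring B]

/-- The left stabiliser of a subset of a ring. -/
def leftStab (S : Set A) : Set A := {a | ∀ m ∈ S, a * m ∈ S}

/-- The right stabiliser of a subset of a ring. -/
def rightStab (S : Set A) : Set A := {a | ∀ m ∈ S, m * a ∈ S}

theorem leftStab_image (θ : A ≃+* B) (S : Set A) : leftStab (θ '' S) = θ '' leftStab S := by
  ext b
  obtain ⟨a, rfl⟩ := θ.surjective b
  rw [θ.injective.mem_set_image]
  refine ⟨fun h m hm => ?_, ?_⟩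
  · have := h _ ⟨m, hm, rfl⟩
    rwa [← map_mul, θ.injective.mem_set_image] at this
  · rintro h _ ⟨m, hm, rfl⟩
    exact ⟨a * m, h m hm, map_mul _ _ _⟩

theorem rightStab_image (θ : A ≃+* B) (S : Set A) : rightStab (θ '' S) = θ '' rightStab S := by
  ext b
  obtain ⟨a, rfl⟩ := θ.surjective b
  rw [θ.injective.mem_set_image]
  refine ⟨fun h m hm => ?_, ?_⟩
  · have := h _ ⟨m, hm, rfl⟩
    rwa [← map_mul, θ.injective.mem_set_image] at this
  · rintro h _ ⟨m, hm, rfl⟩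
    exact ⟨m * a, h m hm, map_mul _ _ _⟩

theorem leftIdealiser_eq {n : ℕ} {E : Type u} [Field E] (C : Set (Matrix (Fin n) (Fin n) E)) :
    leftIdealiser C = leftStab C := rfl

theorem rightIdealiser_eq {n : ℕ} {E : Type u} [Field E] (C : Set (Matrix (Fin n) (Fin n) E)) :
    rightIdealiser C = rightStab C := rfl

end Stabilisers

/-! ### Degree arguments for idealisers in R_F. -/

section SkewStabilisers

variable {K L : Type u} [Field K] [Field L] [Algebra K L] {σ : L ≃ₐ[K] L}
  [Finite K] [FiniteDimensional K L]

theorem mem_degLT_of_forall {f : SkewRing σ} {a b : ℕ} (hab : a ≤ b) (hf : f ∈ degLT σ b)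
    (h : ∀ m, a ≤ m → m < b → f ∈ degLT σ (m + 1) → cf σ m f = 0) : f ∈ degLT σ a := by
  induction b, hab using Nat.le_induction with
  | base => exact hf
  | succ b hb ih =>
    exact ih (mem_degLT_of_succ hf (h b hb (Nat.lt_succ_self b) hf)) fun m h1 h2 h3 =>
      h m h1 (by lia) h3

theorem cf_zero_mul_mono (f : SkewRing σ) (i : ℕ) (a : L) :
    cf σ i (f * mono σ 0 a) = cf σ i f * (σ ^ i) a := cf_mul_mono f i 0 a

theorem cf_mono_zero_mul (f : SkewRing σ) (i : ℕ) (a : L) :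
    cf σ i (mono σ 0 a * f) = a * cf σ i f := by
  have := cf_mono_mul f 0 i a
  rw [zero_add] at this
  rw [this]
  rfl

variable {F : K[X]} {r : ℕ} {S : Set (SkewQuot σ F)}

/-- The left stabiliser of a code that contains all `c x ^ j` with `0 < j < r` and lies in degree
at most `r` consists of elements `b` such that `b x` has degree at most 2. -/
theorem exists_of_mem_leftStab (hF : F.Monic) (hr2 : 2 ≤ r)
    (hrN : r + 2 ≤ Module.finrank K L * F.natDegree)
    (hsub : ∀ z ∈ S, ∃ f ∈ degLT σ (r + 1), toQuot σ F f = z)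
    (hmem : ∀ j c, 1 ≤ j → j < r → toQuot σ F (mono σ j c) ∈ S)
    {b : SkewQuot σ F} (hb : b ∈ leftStab S) :
    ∃ P ∈ degLT σ 3, b * toQuot σ F (mono σ 1 1) = toQuot σ F P ∧
      toQuot σ F P ∈ S ∧ ∀ c, toQuot σ F (P * mono σ (r - 2) c) ∈ S := by
  have h1 : ∀ P : SkewRing σ, toQuot σ F P = b * toQuot σ F (mono σ 1 1) →
      ∀ j c, j + 1 < r → toQuot σ F (P * mono σ j c) ∈ S := by
    intro P hP j c hj
    rw [map_mul, hP, mul_assoc, ← map_mul, mono_mul_mono]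
    exact hb _ (hmem _ _ (by lia) (by lia))
  have hx : b * toQuot σ F (mono σ 1 1) ∈ S := hb _ (hmem 1 1 le_rfl (by lia))
  obtain ⟨P, hP, hPeq⟩ := hsub _ hx
  -- If P had degree m ≥ 3, then P x^{r+1-m} = b x^{r+2-m} would be a codeword of degree r + 1,
  -- because r + 2 - m < r; and r + 1 < N excludes reduction.
  refine ⟨P, mem_degLT_of_forall (b := r + 1) (by lia) hP fun m hm hmr hPm => ?_, hPeq.symm,
    hPeq ▸ hx, fun c => h1 P hPeq _ c (by lia)⟩
  obtain ⟨f, hf, hfeq⟩ := hsub _ (h1 P hPeq (r + 1 - m) 1 (by lia))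
  have hdeg := mul_mono_mem_degLT hPm (r + 1 - m) (1 : L)
  have heq := eq_of_toQuot hF (degLT_mono (by lia) hf) (degLT_mono (by lia) hdeg) hfeq
  have := cf_mul_mono P m (r + 1 - m) 1
  rw [← heq, hf _ (by lia), map_one, mul_one] at this
  exact this.symm

/-- The version of `exists_of_mem_leftStab` for right stabilisers. -/
theorem exists_of_mem_rightStab (hF : F.Monic) (hr2 : 2 ≤ r)
    (hrN : r + 2 ≤ Module.finrank K L * F.natDegree)
    (hsub : ∀ z ∈ S, ∃ f ∈ degLT σ (r + 1), toQuot σ F f = z)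
    (hmem : ∀ j c, 1 ≤ j → j < r → toQuot σ F (mono σ j c) ∈ S)
    {b : SkewQuot σ F} (hb : b ∈ rightStab S) :
    ∃ P ∈ degLT σ 3, toQuot σ F (mono σ 1 1) * b = toQuot σ F P ∧
      toQuot σ F P ∈ S ∧ ∀ c, toQuot σ F (mono σ (r - 2) c * P) ∈ S := by
  have h1 : ∀ P : SkewRing σ, toQuot σ F P = toQuot σ F (mono σ 1 1) * b →
      ∀ j c, j + 1 < r → toQuot σ F (mono σ j c * P) ∈ S := by
    intro P hP j c hj
    rw [map_mul, hP, ← mul_assoc, ← map_mul, mono_mul_mono]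
    exact hb _ (hmem _ _ (by lia) (by lia))
  have hx : toQuot σ F (mono σ 1 1) * b ∈ S := hb _ (hmem 1 1 le_rfl (by lia))
  obtain ⟨P, hP, hPeq⟩ := hsub _ hx
  refine ⟨P, mem_degLT_of_forall (b := r + 1) (by lia) hP fun m hm hmr hPm => ?_, hPeq.symm,
    hPeq ▸ hx, fun c => h1 P hPeq _ c (by lia)⟩
  obtain ⟨f, hf, hfeq⟩ := hsub _ (h1 P hPeq (r + 1 - m) 1 (by lia))
  have hdeg := mono_mul_mem_degLT hPm (r + 1 - m) (1 : L)
  have heq := eq_of_toQuot hF (degLT_mono (by lia) hf) (degLT_mono (by lia) hdeg) hfeq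
  have := cf_mono_mul P (r + 1 - m) m 1
  rw [← heq, hf _ (by lia), one_mul] at this
  exact (map_eq_zero _).1 this.symm

theorem commute_of_commute_gens_quot {z : SkewQuot σ F}
    (hx : toQuot σ F (mono σ 1 1) * z = z * toQuot σ F (mono σ 1 1))
    (ha : ∀ a, toQuot σ F (mono σ 0 a) * z = z * toQuot σ F (mono σ 0 a)) (y : SkewQuot σ F) :
    y * z = z * y := by
  obtain ⟨g, rfl⟩ := toQuot_surjective F y
  have hpow : ∀ i, toQuot σ F (mono σ i 1) * z = z * toQuot σ F (mono σ i 1) := by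
    intro i
    rw [show i = 1 * i by rw [one_mul], ← mono_one_pow, map_pow]
    exact (Commute.pow_left hx i :)
  induction g using skew_induction with
  | hadd g g' h h' => rw [map_add, add_mul, mul_add, h, h']
  | hm i a =>
    have : mono σ i a = mono σ 0 a * mono σ i 1 := by simp [mono_mul_mono]
    rw [this, map_mul, mul_assoc, hpow, ← mul_assoc, ha, mul_assoc]

theorem eq_const_of_mem_degLT {f : SkewRing σ} (hf : f ∈ degLT σ 1) : f = mono σ 0 (cf σ 0 f) := by
  have := eq_sum_mono hf
  rwa [Finset.sum_range_one] at this

/-! ### Idealisers, centraliser and centre of D. -/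

section CodeD

variable {L' : IntermediateField K L} {k : ℕ} {γ : L}

/-- An intermediate field of a finite field is the solution set of y^{|L'|} = y, which every
automorphism preserves. -/
theorem map_mem_intermediateField (τ : L ≃ₐ[K] L) {a : L} (ha : a ∈ L') : τ a ∈ L' := by
  have hLfin : Finite L := Module.finite_of_finite K
  have hcard : (L' : Set L).ncard = Nat.card L' := Nat.card_coe_set_eq _ |>.symm
  have hpow : ∀ x ∈ (L' : Set L), x ^ (L' : Set L).ncard = x := by
    intro x hx
    have := Fintype.ofFinite L'
    rw [hcard, Nat.card_eq_fintype_card]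
    exact congrArg Subtype.val (FiniteField.pow_card (⟨x, hx⟩ : L'))
  have h := eq_pow_eq_self (S := (L' : Set L)) (by rw [hcard]; exact Finite.one_lt_card) hpow
  have h1 : (τ a) ^ (L' : Set L).ncard = τ a := by rw [← map_pow, hpow a ha]
  have : τ a ∈ (L' : Set L) := by
    rw [h]
    exact h1
  exact this

/-- For p ≠ 0 the products p τ(c) fill L, while γL' is a proper subset. -/
theorem eq_zero_of_forall_mul_mem (hγ : γ ≠ 0)
    (hL' : 2 * Module.finrank K L' = Module.finrank K L) {p : L} {τ : L ≃ₐ[K] L}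
    (h : ∀ c, ∃ a ∈ L', p * τ c = γ * a) : p = 0 := by
  by_contra hp
  have htop : L' = ⊤ := by
    rw [eq_top_iff]
    intro x _
    obtain ⟨a, ha, hc⟩ := h (τ.symm (p⁻¹ * (γ * x)))
    rw [AlgEquiv.apply_symm_apply, mul_inv_cancel_left₀ hp] at hc
    rwa [mul_left_cancel₀ hγ hc]
  rw [htop, IntermediateField.finrank_top'] at hL'
  have : 0 < Module.finrank K L := Module.finrank_pos
  lia

theorem one_mem_codeD (hr : 0 < F.natDegree * k) : (1 : SkewQuot σ F) ∈ codeD σ L' F k γ :=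
  (mem_codeD_iff hr _).2 ⟨mono σ 0 1, mono_mem_degLT (by lia) _, map_one _,
    by rw [cf_mono_self]; exact one_mem _, 0, zero_mem _, by rw [cf_mono_ne hr.ne, mul_zero]⟩

theorem mono_mem_codeD {j : ℕ} (c : L) (hj : 1 ≤ j) (hjr : j < F.natDegree * k) :
    toQuot σ F (mono σ j c) ∈ codeD σ L' F k γ :=
  (mem_codeD_iff (by lia) _).2 ⟨mono σ j c, mono_mem_degLT (by lia) _, rfl,
    by rw [cf_mono_ne (by lia)]; exact zero_mem _, 0, zero_mem _,
    by rw [cf_mono_ne (by lia), mul_zero]⟩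

theorem codeD_sub (hr : 0 < F.natDegree * k) (z : SkewQuot σ F) (hz : z ∈ codeD σ L' F k γ) :
    ∃ f ∈ degLT σ (F.natDegree * k + 1), toQuot σ F f = z := by
  obtain ⟨f, hf, h, -⟩ := (mem_codeD_iff hr _).1 hz
  exact ⟨f, hf, h⟩

theorem cf_of_mem_codeD (hF : F.Monic) (hr : 0 < F.natDegree * k)
    (hrN : F.natDegree * k + 1 ≤ Module.finrank K L * F.natDegree) {f : SkewRing σ}
    (hf : f ∈ degLT σ (F.natDegree * k + 1)) (hz : toQuot σ F f ∈ codeD σ L' F k γ) :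
    cf σ 0 f ∈ L' ∧ ∃ a ∈ L', cf σ (F.natDegree * k) f = γ * a := by
  obtain ⟨g, hg, h, h'⟩ := (mem_codeD_iff hr _).1 hz
  rwa [eq_of_toQuot hF (degLT_mono hrN hg) (degLT_mono hrN hf) h] at h'

/-- As 1 is a codeword, b = b·1 has a representative w of degree at most sk, and wx = P as
polynomials since sk + 2 ≤ N. The top coefficient of P c x^{sk-2} is P_2 σ^2(c), which lies in γL'
for all c, so P_2 = 0. Then w is a constant, and as a codeword it lies in L'. -/
theorem leftStab_codeD (hF : F.Monic) (hγ : γ ≠ 0) (hr2 : 2 ≤ F.natDegree * k)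
    (hrN : F.natDegree * k + 2 ≤ Module.finrank K L * F.natDegree)
    (hL' : 2 * Module.finrank K L' = Module.finrank K L) :
    leftStab (codeD σ L' F k γ) = (fun a => toQuot σ F (mono σ 0 a)) '' (L' : Set L) := by
  have hr : 0 < F.natDegree * k := by lia
  ext b
  constructor
  · intro hb
    obtain ⟨P, hP, hbP, -, hPS⟩ := exists_of_mem_leftStab hF hr2 hrN (codeD_sub hr)
      (fun j c h1 h2 => mono_mem_codeD c h1 h2) hb
    have hb1 : b ∈ codeD σ L' F k γ := by simpa using hb 1 (one_mem_codeD hr)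
    obtain ⟨w, hw, rfl⟩ := codeD_sub hr b hb1
    have hP2 : cf σ 2 P = 0 := by
      refine eq_zero_of_forall_mul_mem (L' := L') (τ := σ ^ 2) hγ hL' fun c => ?_
      have hdeg := mul_mono_mem_degLT hP (F.natDegree * k - 2) c
      rw [show 3 + (F.natDegree * k - 2) = F.natDegree * k + 1 by lia] at hdeg
      obtain ⟨-, a, ha, h⟩ := cf_of_mem_codeD hF hr (by lia) hdeg (hPS c)
      refine ⟨a, ha, ?_⟩
      rw [← h, ← cf_mul_mono, Nat.add_sub_cancel' hr2]
    rw [← map_mul] at hbP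
    have heq := eq_of_toQuot hF (degLT_mono hrN (mul_mono_mem_degLT hw 1 1))
      (degLT_mono (by lia) hP) hbP
    have hwP : ∀ i, cf σ i w = cf σ (i + 1) P := fun i => by
      rw [← heq, cf_mul_mono, map_one, mul_one]
    have hw1 : w ∈ degLT σ 1 := by
      intro i hi
      rw [hwP]
      rcases hi.eq_or_lt with rfl | hi
      · exact hP2
      · exact hP _ (by lia)
    refine ⟨cf σ 0 w, (cf_of_mem_codeD hF hr (by lia) hw hb1).1, ?_⟩
    exact congrArg (toQuot σ F) (eq_const_of_mem_degLT hw1).symm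
  · rintro ⟨α, hα, rfl⟩ m hm
    obtain ⟨f, hf, rfl, hf0, a, ha, hfr⟩ := (mem_codeD_iff hr _).1 hm
    refine (mem_codeD_iff hr _).2 ⟨mono σ 0 α * f, by simpa using mono_mul_mem_degLT hf 0 α,
      map_mul _ _ _, ?_, α * a, mul_mem hα ha, ?_⟩
    · rw [cf_mono_zero_mul]
      exact mul_mem hα hf0
    · rw [cf_mono_zero_mul, hfr, mul_left_comm]

theorem rightStab_codeD (hF : F.Monic) (hγ : γ ≠ 0) (hr2 : 2 ≤ F.natDegree * k)
    (hrN : F.natDegree * k + 2 ≤ Module.finrank K L * F.natDegree)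
    (hL' : 2 * Module.finrank K L' = Module.finrank K L) :
    rightStab (codeD σ L' F k γ) = (fun a => toQuot σ F (mono σ 0 a)) '' (L' : Set L) := by
  have hr : 0 < F.natDegree * k := by lia
  ext b
  constructor
  · intro hb
    obtain ⟨P, hP, hbP, -, hPS⟩ := exists_of_mem_rightStab hF hr2 hrN (codeD_sub hr)
      (fun j c h1 h2 => mono_mem_codeD c h1 h2) hb
    have hb1 : b ∈ codeD σ L' F k γ := by simpa using hb 1 (one_mem_codeD hr)
    obtain ⟨w, hw, rfl⟩ := codeD_sub hr b hb1
    have hP2 : cf σ 2 P = 0 := by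
      refine (map_eq_zero (σ ^ (F.natDegree * k - 2))).1 ?_
      refine eq_zero_of_forall_mul_mem (L' := L') (τ := 1) hγ hL' fun c => ?_
      have hdeg := mono_mul_mem_degLT hP (F.natDegree * k - 2) c
      rw [show F.natDegree * k - 2 + 3 = F.natDegree * k + 1 by lia] at hdeg
      obtain ⟨-, a, ha, h⟩ := cf_of_mem_codeD hF hr (by lia) hdeg (hPS c)
      refine ⟨a, ha, ?_⟩
      rw [← h, mul_comm, AlgEquiv.one_apply, ← cf_mono_mul, Nat.sub_add_cancel hr2]
    rw [← map_mul] at hbP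
    have hdeg := mono_mul_mem_degLT hw 1 (1 : L)
    have heq := eq_of_toQuot hF (degLT_mono (by lia) hdeg) (degLT_mono (by lia) hP) hbP
    have hwP : ∀ i, σ (cf σ i w) = cf σ (1 + i) P := fun i => by
      rw [← heq, cf_mono_mul, one_mul, pow_one]
    have hw1 : w ∈ degLT σ 1 := by
      intro i hi
      refine (map_eq_zero σ).1 ?_
      rw [hwP]
      rcases hi.eq_or_lt with rfl | hi
      · exact hP2
      · exact hP _ (by lia)
    refine ⟨cf σ 0 w, (cf_of_mem_codeD hF hr (by lia) hw hb1).1, ?_⟩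
    exact congrArg (toQuot σ F) (eq_const_of_mem_degLT hw1).symm
  · rintro ⟨α, hα, rfl⟩ m hm
    obtain ⟨f, hf, rfl, hf0, a, ha, hfr⟩ := (mem_codeD_iff hr _).1 hm
    refine (mem_codeD_iff hr _).2 ⟨f * mono σ 0 α, mul_mono_mem_degLT hf 0 α,
      map_mul _ _ _, ?_, a * (σ ^ (F.natDegree * k)) α,
      mul_mem ha (map_mem_intermediateField _ hα), ?_⟩
    · rw [cf_zero_mul_mono]
      exact mul_mem hf0 (map_mem_intermediateField _ hα)
    · rw [cf_zero_mul_mono, hfr, mul_assoc]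

/-- The code contains x and every ax, and x is a unit, so commuting with both means commuting with
a. -/
theorem commute_of_commute_codeD (hr2 : 2 ≤ F.natDegree * k) (hcop : IsCoprime F X)
    {z : SkewQuot σ F} (hz : ∀ m ∈ codeD σ L' F k γ, z * m = m * z) (y : SkewQuot σ F) :
    y * z = z * y := by
  have hx := hz _ (mono_mem_codeD (L' := L') (γ := γ) 1 le_rfl (by lia))
  refine commute_of_commute_gens_quot hx.symm (fun a => ?_) y
  have ha := hz _ (mono_mem_codeD (L' := L') (γ := γ) a le_rfl (by lia))
  have h1 : mono σ 1 a = mono σ 0 a * mono σ 1 1 := by simp [mono_mul_mono]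
  rw [h1, map_mul, ← mul_assoc, mul_assoc _ _ z, ← hx, ← mul_assoc] at ha
  exact ((isUnit_toQuot_mono hcop 1).mul_left_injective ha).symm

theorem hasNuclearParameters_codeD {n t : ℕ} {E : Type u} [Field E] [Finite E] (hσ : IsGenerator σ)
    (hn : Module.finrank K L = n) (hn2 : 2 ≤ n) (hF : F.Monic) (hcop : IsCoprime F X)
    (hγ : γ ≠ 0) (hk : k < n) (hr2 : 2 ≤ F.natDegree * k)
    (hrN : F.natDegree * k + 2 ≤ n * F.natDegree)
    (ht : Module.finrank K L' = t) (htn : 2 * t = n)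
    (θ : SkewQuot σ F ≃+* Matrix (Fin n) (Fin n) E) :
    HasNuclearParameters (θ '' codeD σ L' F k γ) (Nat.card K ^ (n * (F.natDegree * k)))
      (Nat.card K ^ t) (Nat.card K ^ t) (Nat.card E) (Nat.card K) := by
  have hr : 0 < F.natDegree * k := by lia
  have hL' : 2 * Module.finrank K L' = Module.finrank K L := by rw [ht, htn, hn]
  have : NeZero n := ⟨by lia⟩
  have hnt : Nontrivial (SkewQuot σ F) := θ.toEquiv.nontrivial
  have hcardL' : (L' : Set L).ncard = Nat.card K ^ t := by
    rw [← Nat.card_coe_set_eq, ← ht]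
    exact Module.natCard_eq_pow_finrank (K := K) (V := L')
  have hcent : centraliser (θ '' codeD σ L' F k γ) = Set.range (Matrix.scalar (Fin n)) := by
    ext A
    constructor
    · intro hA
      obtain ⟨z, rfl⟩ := θ.surjective A
      have hz : ∀ m ∈ codeD σ L' F k γ, z * m = m * z := fun m hm => θ.injective (by
        rw [map_mul, map_mul]
        exact hA _ ⟨m, hm, rfl⟩)
      refine mem_range_scalar_of_mem_center fun B => ?_
      obtain ⟨y, rfl⟩ := θ.surjective B
      rw [← map_mul, commute_of_commute_codeD hr2 hcop hz, map_mul]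
    · rintro ⟨e, rfl⟩ M _
      exact Matrix.scalar_commute e (fun _ => mul_comm _ _) M
  refine ⟨⟨1, one_mem_codeD hr, map_one θ⟩, ?_, ?_, ?_, ?_, ?_⟩
  · rw [Set.ncard_image_of_injective _ θ.injective, card_codeD hF hγ hr (hn ▸ hk) hL',
      Module.natCard_eq_pow_finrank (K := K) (V := L), hn, ← pow_mul]
  · rw [leftIdealiser_eq, leftStab_image, leftStab_codeD hF hγ hr2 (hn ▸ hrN) hL',
      Set.ncard_image_of_injective _ θ.injective,
      Set.ncard_image_of_injective _ toQuot_mono_zero_injective, hcardL']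
  · rw [rightIdealiser_eq, rightStab_image, rightStab_codeD hF hγ hr2 (hn ▸ hrN) hL',
      Set.ncard_image_of_injective _ θ.injective,
      Set.ncard_image_of_injective _ toQuot_mono_zero_injective, hcardL']
  · rw [hcent]
    exact Set.ncard_range_of_injective fun a b h => Matrix.scalar_inj.1 h
  -- A constant that commutes with the codeword x is fixed by σ, hence lies in K.
  · have : centre (θ '' codeD σ L' F k γ) =
        Set.range fun c : K => θ (toQuot σ F (mono σ 0 (algebraMap K L c))) := by
      rw [centre, leftIdealiser_eq, leftStab_image, leftStab_codeD hF hγ hr2 (hn ▸ hrN) hL']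
      ext A
      constructor
      · rintro ⟨⟨_, ⟨α, -, rfl⟩, rfl⟩, hA⟩
        have h1 := hA _ ⟨_, mono_mem_codeD (L' := L') (γ := γ) 1 le_rfl (by lia), rfl⟩
        rw [← map_mul, ← map_mul θ] at h1
        have h1 := θ.injective h1
        rw [← map_mul, ← map_mul, mono_mul_mono, mono_mul_mono] at h1
        have h1 := eq_of_toQuot hF (mono_mem_degLT (by rw [hn]; lia) _)
          (mono_mem_degLT (by rw [hn]; lia) _) h1
        have h1 := congrArg (cf σ 1) h1
        rw [zero_add, cf_mono_self, cf_mono_self, pow_zero, map_one, mul_one, one_mul,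
          pow_one] at h1
        obtain ⟨c, rfl⟩ := mem_base_of_fixed hσ h1.symm
        exact ⟨c, rfl⟩
      · rintro ⟨c, rfl⟩
        refine ⟨⟨_, ⟨_, L'.algebraMap_mem c, rfl⟩, rfl⟩, ?_⟩
        rintro _ ⟨m, -, rfl⟩
        rw [← map_mul, ← commute_toQuot_base, map_mul]
    rw [this]
    exact Set.ncard_range_of_injective fun a b h => (algebraMap K L).injective
      (toQuot_mono_zero_injective (θ.injective h))

end CodeD

end SkewStabilisers

end SkewMRD

namespace SkewMRD

/-! ### Idealisers of the family S. -/

section CodeS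

variable {K L : Type u} [Field K] [Field L] [Algebra K L] {σ : L ≃ₐ[K] L}
  [Finite K] [FiniteDimensional K L] {F : K[X]} {ρ : L ≃+* L} {k : ℕ} {η : L}

theorem mono_mem_codeS {j : ℕ} (c : L) (hj : 1 ≤ j) (hjr : j < F.natDegree * k) :
    toQuot σ F (mono σ j c) ∈ codeS σ ρ F k η :=
  (mem_codeS_iff (by lia) _).2 ⟨mono σ j c, mono_mem_degLT (by lia) _, rfl,
    by rw [cf_mono_ne (by lia), cf_mono_ne (by lia), map_zero, mul_zero]⟩

theorem codeS_sub (hr : 0 < F.natDegree * k) (z : SkewQuot σ F) (hz : z ∈ codeS σ ρ F k η) :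
    ∃ f ∈ degLT σ (F.natDegree * k + 1), toQuot σ F f = z := by
  obtain ⟨f, hf, h, -⟩ := (mem_codeS_iff hr _).1 hz
  exact ⟨f, hf, h⟩

theorem cf_of_mem_codeS (hF : F.Monic) (hr : 0 < F.natDegree * k)
    (hrN : F.natDegree * k + 1 ≤ Module.finrank K L * F.natDegree) {f : SkewRing σ}
    (hf : f ∈ degLT σ (F.natDegree * k + 1)) (hz : toQuot σ F f ∈ codeS σ ρ F k η) :
    cf σ (F.natDegree * k) f = η * ρ (cf σ 0 f) := by
  obtain ⟨g, hg, h, h'⟩ := (mem_codeS_iff hr _).1 hz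
  rwa [eq_of_toQuot hF (degLT_mono hrN hg) (degLT_mono hrN hf) h] at h'

theorem mono_add_mono_mem_codeS (hr : 0 < F.natDegree * k) (c : L) :
    toQuot σ F (mono σ 0 c + mono σ (F.natDegree * k) (η * ρ c)) ∈ codeS σ ρ F k η :=
  (mem_codeS_iff hr _).2 ⟨_, add_mem (mono_mem_degLT (by lia) _) (mono_mem_degLT (by lia) _), rfl,
    by rw [map_add, map_add, cf_mono_self, cf_mono_self, cf_mono_ne hr.ne, cf_mono_ne hr.ne',
      zero_add, add_zero]⟩

/-- An element of degree at most `N` of the ideal generated by `F(x ^ n)` is a multiple of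
`F(x ^ n)` by a constant. -/
theorem cf_zero_of_toQuot_eq_zero (hF : F.Monic) {f : SkewRing σ}
    (hf : f ∈ degLT σ (Module.finrank K L * F.natDegree + 1)) (h0 : toQuot σ F f = 0) :
    cf σ 0 f = cf σ (Module.finrank K L * F.natDegree) f * algebraMap K L (F.coeff 0) := by
  set N := Module.finrank K L * F.natDegree with hN
  set g := f - mono σ 0 (cf σ N f) * evalXPow σ F with hg
  have hgdeg : g ∈ degLT σ N := by
    refine mem_degLT_of_succ (sub_mem hf ?_) ?_
    · simpa using mono_mul_mem_degLT (evalXPow_mem_degLT (σ := σ) F) 0 (cf σ N f)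
    · rw [hg, map_sub, cf_mono_zero_mul, cf_evalXPow_mul, hF.coeff_natDegree]
      simp
  have hg0 : toQuot σ F g = 0 := by
    rw [hg, map_sub, h0, (toQuot_eq_zero_iff F _).2 ⟨_, rfl⟩, sub_zero]
  have := congrArg (cf σ 0) (eq_zero_of_toQuot hF hgdeg hg0)
  rw [hg, map_sub, cf_mono_zero_mul, cf_zero_evalXPow, map_zero] at this
  exact sub_eq_zero.1 this

theorem norm_eq_prod_pow (hσ : IsGenerator σ) (a : L) :
    algebraMap K L (Algebra.norm K a) = ∏ i ∈ Finset.range (Module.finrank K L), (σ ^ i) a := by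
  classical
  rw [← prod_conj (K := K) a]
  symm
  refine Finset.prod_nbij (fun i => σ ^ i) (fun _ _ => Finset.mem_univ _) ?_ ?_ (fun _ _ => rfl)
  · intro i hi j hj hij
    rw [← orderOf_of_isGenerator hσ, Finset.coe_range] at hi hj
    exact pow_injOn_Iio_orderOf hi hj hij
  · intro τ _
    have h := (isOfFinOrder_of_finite σ).mem_zpowers_iff_mem_range_orderOf.1 (hσ τ)
    rw [orderOf_of_isGenerator hσ] at h
    obtain ⟨i, hi, h⟩ := Finset.mem_image.1 h
    exact ⟨i, Finset.mem_coe.2 hi, h⟩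

/-- Iterating the relation gives p = w σ^2(w) p, and w σ^2(w) is c^2 times the product of the four
conjugates of η. -/
theorem norm_mul_sq_eq_one (hσ : IsGenerator σ) (hn : Module.finrank K L = 4) {p w : L} (hp : p ≠ 0)
    {c : K} {i : ℕ} (hw : w = algebraMap K L c * ((σ ^ i) η * (σ ^ (i + 1)) η))
    (h : p = w * (σ ^ 2) p) : Algebra.norm K η * c ^ 2 = 1 := by
  have h4 : σ ^ 4 = 1 := by rw [← hn, pow_finrank]
  have h1 : (σ ^ 2) p = (σ ^ 2) w * p := by
    conv_lhs => rw [h]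
    rw [map_mul, ← AlgEquiv.mul_apply (σ ^ 2) (σ ^ 2), ← pow_add, h4, AlgEquiv.one_apply]
  have h2 : w * (σ ^ 2) w = 1 := by
    rw [h1, ← mul_assoc] at h
    exact (mul_eq_right₀ hp).1 h.symm
  refine (algebraMap K L).injective ?_
  have hnorm : algebraMap K L (Algebra.norm K η) =
      (σ ^ i) (algebraMap K L (Algebra.norm K η)) := by rw [AlgEquiv.commutes]
  rw [map_mul, hnorm, norm_eq_prod_pow hσ, hn, map_one, ← h2, hw]
  simp only [Finset.prod_range_succ, Finset.prod_range_zero, map_mul, AlgEquiv.commutes,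
    ← AlgEquiv.mul_apply, ← pow_add, one_mul, map_pow]
  rw [add_comm 2 i, add_comm 2 (i + 1), add_zero, add_assoc]
  ring

variable (hσ : IsGenerator σ) (hF : F.Monic) (hcop : IsCoprime F X) (hr2 : 2 ≤ F.natDegree * k)
  (hrN : F.natDegree * k + 2 ≤ Module.finrank K L * F.natDegree)
  (hspecial : F.natDegree * k = 2 → Module.finrank K L * F.natDegree = 4 →
    Module.finrank K L = 4 ∧ Algebra.norm K η * F.coeff 0 ^ 2 ≠ 1)

include hσ hF hcop hr2 hrN hspecial

/-- Write bx = P = p_0 + p_1 x + p_2 x^2 and r = s'k'. The role of 1 in D is played by the codeword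
1 + ηx^r, which yields a polynomial `D` of degree at most r + 2 that vanishes in R_F, with constant
term p_0. Usually `D` = 0 and p_0 = p_2 = 0, so b is constant. The exception is r = 2, N = 4, where
`D` may be a nonzero multiple of F(x^n); the norm condition in `hspecial` rules this out. -/
theorem exists_const_of_mem_leftStab_codeS {b : SkewQuot σ F}
    (hb : b ∈ leftStab (codeS σ ρ F k η)) :
    ∃ α, b = toQuot σ F (mono σ 0 α) ∧ η * ρ α = α * η := by
  have hr : 0 < F.natDegree * k := by lia
  obtain ⟨P, hP, hbP, -, hPS⟩ := exists_of_mem_leftStab hF hr2 hrN (codeS_sub hr)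
    (fun j c h1 h2 => mono_mem_codeS c h1 h2) hb
  have hP2 : ∀ c, cf σ 2 P * (σ ^ 2) c = η * ρ (cf σ 0 (P * mono σ (F.natDegree * k - 2) c)) := by
    intro c
    have hdeg := mul_mono_mem_degLT hP (F.natDegree * k - 2) c
    rw [show 3 + (F.natDegree * k - 2) = F.natDegree * k + 1 by lia] at hdeg
    rw [← cf_of_mem_codeS hF hr (by lia) hdeg (hPS c), ← cf_mul_mono, Nat.add_sub_cancel' hr2]
  obtain ⟨w, hw, hweq⟩ := codeS_sub hr _ (hb _ (mono_add_mono_mem_codeS hr 1))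
  -- Chosen so that (1 + ηx^r)x = x(1 + ex^r), which moves x next to b.
  set e := σ.symm (η * ρ 1) with he
  have hse : σ e = η := by rw [he, AlgEquiv.apply_symm_apply, map_one, mul_one]
  set D := P * (mono σ 0 1 + mono σ (F.natDegree * k) e) - w * mono σ 1 1 with hD
  have hD0 : toQuot σ F D = 0 := by
    have h1 : (mono σ 0 1 + mono σ (F.natDegree * k) (η * ρ 1)) * mono σ 1 1 =
        mono σ 1 1 * (mono σ 0 1 + mono σ (F.natDegree * k) e) := by
      rw [add_mul, mul_add, mono_mul_mono, mono_mul_mono, mono_mul_mono, mono_mul_mono, pow_one,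
        hse, add_comm 1 (F.natDegree * k)]
      simp
    rw [hD, map_sub, map_mul, ← hbP, map_mul _ w, hweq, mul_assoc, mul_assoc, ← map_mul,
      ← map_mul, h1, sub_self]
  have hDc0 : cf σ 0 D = cf σ 0 P := by
    rw [hD, mul_add, map_sub, map_add, cf_zero_mul_mono, cf_mul_mono_lt _ hr,
      cf_mul_mono_lt _ one_pos]
    simp
  have hDc : cf σ (F.natDegree * k + 2) D = cf σ 2 P * σ η := by
    rw [hD, mul_add, map_sub, map_add, cf_zero_mul_mono, hP _ (by lia),
      show F.natDegree * k + 2 = F.natDegree * k + 1 + 1 by lia, cf_mul_mono _ (_ + 1), hw _ le_rfl,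
      show F.natDegree * k + 1 + 1 = 2 + F.natDegree * k by lia, cf_mul_mono, pow_two,
      AlgEquiv.mul_apply, hse]
    simp
  have hDdeg : D ∈ degLT σ (F.natDegree * k + 3) := by
    refine sub_mem ?_ (degLT_mono (by lia) (mul_mono_mem_degLT hw 1 1))
    rw [mul_add]
    exact add_mem (degLT_mono (by lia) (mul_mono_mem_degLT hP 0 1))
      (degLT_mono (by lia) (mul_mono_mem_degLT hP _ e))
  have hcases : cf σ 0 P = 0 ∧ cf σ 2 P = 0 := by
    rcases hr2.eq_or_lt with h2 | h2
    · rw [← h2] at hP2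
      simp only [Nat.sub_self, cf_zero_mul_mono, pow_zero, AlgEquiv.one_apply] at hP2
      have hP2' : cf σ 2 P = η * ρ (cf σ 0 P) := by simpa using hP2 1
      rcases hrN.eq_or_lt with h3 | h3
      · obtain ⟨hn4, hne⟩ := hspecial h2.symm (by lia)
        have h0 : cf σ 0 P = 0 := by
          by_contra hp
          refine hne ?_
          have h5 := cf_zero_of_toQuot_eq_zero hF (by rw [← h3]; exact hDdeg) hD0
          rw [← h3, hDc0, hDc] at h5
          -- For r = 2 the code condition on Pc for every c reads p_2 σ^2(c) = ηρ(p_0)ρ(c) = p_2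
          -- ρ(c), and p_2 ≠ 0.
          have hρ : ∀ c, (σ ^ 2) c = ρ c := by
            intro c
            have h6 := hP2 c
            rw [map_mul, ← mul_assoc, ← hP2'] at h6
            refine mul_left_cancel₀ (fun h => hp ?_) h6
            rw [h5, h, zero_mul, zero_mul]
          refine norm_mul_sq_eq_one hσ hn4 (i := 0) hp rfl ?_
          conv_lhs => rw [h5, hP2', ← hρ]
          rw [zero_add, pow_zero, pow_one, AlgEquiv.one_apply]
          ring
        exact ⟨h0, by rw [hP2', h0, map_zero, mul_zero]⟩
      · have h0 : cf σ 0 P = 0 := by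
          rw [← hDc0, eq_zero_of_toQuot hF (degLT_mono (by lia) hDdeg) hD0, map_zero]
        exact ⟨h0, by rw [hP2', h0, map_zero, mul_zero]⟩
    · have h0 : cf σ 2 P = 0 := by
        have := hP2 1
        rwa [cf_mul_mono_lt _ (by lia), map_one, mul_one, map_zero, mul_zero] at this
      refine ⟨?_, h0⟩
      rw [← hDc0, eq_zero_of_toQuot hF (degLT_mono hrN (mem_degLT_of_succ hDdeg ?_)) hD0, map_zero]
      rw [hDc, h0, zero_mul]
  have hPeq : P = mono σ 0 (cf σ 1 P) * mono σ 1 1 := by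
    refine (eq_sum_mono (mem_degLT_of_succ hP hcases.2)).trans ?_
    rw [Finset.sum_range_succ, Finset.sum_range_one, hcases.1]
    simp [mono_mul_mono]
  have hbα : b = toQuot σ F (mono σ 0 (cf σ 1 P)) := by
    rw [hPeq, map_mul] at hbP
    exact (isUnit_toQuot_mono hcop 1).mul_left_injective hbP
  refine ⟨_, hbα, ?_⟩
  have h1 := hb _ (mono_add_mono_mem_codeS hr 1)
  rw [hbα, ← map_mul, mul_add, mono_mul_mono, mono_mul_mono] at h1
  have h2 := cf_of_mem_codeS hF hr (by lia) (add_mem (mono_mem_degLT (by lia) _)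
    (mono_mem_degLT (by lia) _)) h1
  rw [map_add, map_add, zero_add, zero_add, cf_mono_self, cf_mono_self, cf_mono_ne hr.ne,
    cf_mono_ne hr.ne'] at h2
  simpa using h2.symm

/-- The mirror image of the left-hand argument. In the exceptional case the code condition forces ρ
= id rather than ρ = σ^2, and the norm identity arises from σ(η)σ^2(η). -/
theorem exists_const_of_mem_rightStab_codeS {b : SkewQuot σ F}
    (hb : b ∈ rightStab (codeS σ ρ F k η)) :
    ∃ β, b = toQuot σ F (mono σ 0 β) ∧ η * ρ β = η * (σ ^ (F.natDegree * k)) β := by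
  have hr : 0 < F.natDegree * k := by lia
  obtain ⟨P, hP, hbP, -, hPS⟩ := exists_of_mem_rightStab hF hr2 hrN (codeS_sub hr)
    (fun j c h1 h2 => mono_mem_codeS c h1 h2) hb
  have hP2 : ∀ c, c * (σ ^ (F.natDegree * k - 2)) (cf σ 2 P) =
      η * ρ (cf σ 0 (mono σ (F.natDegree * k - 2) c * P)) := by
    intro c
    have hdeg := mono_mul_mem_degLT hP (F.natDegree * k - 2) c
    rw [show F.natDegree * k - 2 + 3 = F.natDegree * k + 1 by lia] at hdeg
    rw [← cf_of_mem_codeS hF hr (by lia) hdeg (hPS c), ← cf_mono_mul, Nat.sub_add_cancel hr2]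
  obtain ⟨w, hw, hweq⟩ := codeS_sub hr _ (hb _ (mono_add_mono_mem_codeS hr 1))
  set D := (mono σ 0 1 + mono σ (F.natDegree * k) (σ η)) * P - mono σ 1 1 * w with hD
  have hD0 : toQuot σ F D = 0 := by
    have h1 : mono σ 1 1 * (mono σ 0 1 + mono σ (F.natDegree * k) (η * ρ 1)) =
        (mono σ 0 1 + mono σ (F.natDegree * k) (σ η)) * mono σ 1 1 := by
      rw [add_mul, mul_add, mono_mul_mono, mono_mul_mono, mono_mul_mono, mono_mul_mono, pow_one,
        add_comm 1 (F.natDegree * k)]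
      simp
    rw [hD, map_sub, map_mul, ← hbP, map_mul _ _ w, hweq, ← mul_assoc, ← mul_assoc, ← map_mul,
      ← map_mul, h1, sub_self]
  have hDc0 : cf σ 0 D = cf σ 0 P := by
    rw [hD, add_mul, map_sub, map_add, cf_mono_zero_mul, cf_mono_mul_lt _ hr,
      cf_mono_mul_lt _ one_pos]
    simp
  have hDc : cf σ (F.natDegree * k + 2) D = σ η * (σ ^ (F.natDegree * k)) (cf σ 2 P) := by
    rw [hD, add_mul, map_sub, map_add, cf_mono_zero_mul, hP _ (by lia), cf_mono_mul,
      show F.natDegree * k + 2 = 1 + (F.natDegree * k + 1) by lia, cf_mono_mul, hw _ le_rfl]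
    simp
  have hDdeg : D ∈ degLT σ (F.natDegree * k + 3) := by
    refine sub_mem ?_ (degLT_mono (by lia) (mono_mul_mem_degLT hw 1 1))
    rw [add_mul]
    exact add_mem (degLT_mono (by lia) (mono_mul_mem_degLT hP 0 1))
      (degLT_mono (by lia) (mono_mul_mem_degLT hP _ (σ η)))
  have hcases : cf σ 0 P = 0 ∧ cf σ 2 P = 0 := by
    rcases hr2.eq_or_lt with h2 | h2
    · rw [← h2] at hP2
      simp only [Nat.sub_self, cf_mono_zero_mul, pow_zero, AlgEquiv.one_apply] at hP2
      have hP2' : cf σ 2 P = η * ρ (cf σ 0 P) := by simpa using hP2 1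
      rcases hrN.eq_or_lt with h3 | h3
      · obtain ⟨hn4, hne⟩ := hspecial h2.symm (by lia)
        have h0 : cf σ 0 P = 0 := by
          by_contra hp
          refine hne ?_
          have h5 := cf_zero_of_toQuot_eq_zero hF (by rw [← h3]; exact hDdeg) hD0
          rw [← h3, hDc0, hDc, ← h2] at h5
          have hρ : ∀ c, ρ c = c := by
            intro c
            have h6 := hP2 c
            rw [map_mul, mul_left_comm, ← hP2'] at h6
            refine (mul_right_cancel₀ (fun h => hp ?_) h6).symm
            rw [h5, h, map_zero, mul_zero, zero_mul]
          refine norm_mul_sq_eq_one hσ hn4 (i := 1) hp rfl ?_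
          conv_lhs => rw [h5, hP2', hρ]
          rw [map_mul, pow_one]
          ring
        exact ⟨h0, by rw [hP2', h0, map_zero, mul_zero]⟩
      · have h0 : cf σ 0 P = 0 := by
          rw [← hDc0, eq_zero_of_toQuot hF (degLT_mono (by lia) hDdeg) hD0, map_zero]
        exact ⟨h0, by rw [hP2', h0, map_zero, mul_zero]⟩
    · have h0 : cf σ 2 P = 0 := by
        have := hP2 1
        rw [cf_mono_mul_lt _ (by lia), one_mul, map_zero, mul_zero] at this
        exact (map_eq_zero _).1 this
      refine ⟨?_, h0⟩
      rw [← hDc0, eq_zero_of_toQuot hF (degLT_mono hrN (mem_degLT_of_succ hDdeg ?_)) hD0, map_zero]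
      rw [hDc, h0, map_zero, mul_zero]
  have hPeq : P = mono σ 1 1 * mono σ 0 (σ.symm (cf σ 1 P)) := by
    refine (eq_sum_mono (mem_degLT_of_succ hP hcases.2)).trans ?_
    rw [Finset.sum_range_succ, Finset.sum_range_one, hcases.1]
    simp [mono_mul_mono]
  have hbβ : b = toQuot σ F (mono σ 0 (σ.symm (cf σ 1 P))) := by
    rw [hPeq, map_mul] at hbP
    exact (isUnit_toQuot_mono hcop 1).mul_right_injective hbP
  refine ⟨_, hbβ, ?_⟩
  have h1 := hb _ (mono_add_mono_mem_codeS hr 1)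
  rw [hbβ, ← map_mul, add_mul, mono_mul_mono, mono_mul_mono] at h1
  have h2 := cf_of_mem_codeS hF hr (by lia) (add_mem (mono_mem_degLT (by lia) _)
    (mono_mem_degLT (by lia) _)) h1
  rw [map_add, map_add, add_zero, add_zero, cf_mono_self, cf_mono_self, cf_mono_ne hr.ne,
    cf_mono_ne hr.ne'] at h2
  simpa using h2.symm

omit hσ hcop hr2 hrN hspecial

theorem const_mem_leftStab_codeS (hr : 0 < F.natDegree * k) {α : L} (hα : η * ρ α = α * η) :
    toQuot σ F (mono σ 0 α) ∈ leftStab (codeS σ ρ F k η) := by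
  intro m hm
  obtain ⟨f, hf, rfl, hfr⟩ := (mem_codeS_iff hr _).1 hm
  refine (mem_codeS_iff hr _).2 ⟨mono σ 0 α * f, by simpa using mono_mul_mem_degLT hf 0 α,
    map_mul _ _ _, ?_⟩
  rw [cf_mono_zero_mul, cf_mono_zero_mul, hfr, map_mul, ← mul_assoc, ← mul_assoc, hα]

theorem const_mem_rightStab_codeS (hr : 0 < F.natDegree * k) {β : L}
    (hβ : η * ρ β = η * (σ ^ (F.natDegree * k)) β) :
    toQuot σ F (mono σ 0 β) ∈ rightStab (codeS σ ρ F k η) := by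
  intro m hm
  obtain ⟨f, hf, rfl, hfr⟩ := (mem_codeS_iff hr _).1 hm
  refine (mem_codeS_iff hr _).2 ⟨f * mono σ 0 β, mul_mono_mem_degLT hf 0 β,
    map_mul _ _ _, ?_⟩
  rw [cf_zero_mul_mono, cf_zero_mul_mono, hfr, map_mul, pow_zero, AlgEquiv.one_apply,
    mul_left_comm, hβ]
  ring

end CodeS

end SkewMRD

namespace SkewMRD

/-! ### The effect of multiplication by units on idealisers. -/

section UnitTranslation

variable {A : Type*} [Ring A]

/-- Conjugation by a unit. -/
def conjEquiv (u : Aˣ) : A ≃+* A where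
  toFun a := u * a * ↑u⁻¹
  invFun a := ↑u⁻¹ * a * u
  left_inv a := by simp [mul_assoc]
  right_inv a := by simp [mul_assoc]
  map_mul' a b := by simp [mul_assoc]
  map_add' a b := by simp [mul_add, add_mul]

theorem conjEquiv_apply (u : Aˣ) (a : A) : conjEquiv u a = u * a * ↑u⁻¹ := rfl

theorem mem_mul_unit_image {S : Set A} (u : Aˣ) (a : A) :
    a ∈ (fun m => m * (u : A)) '' S ↔ a * ↑u⁻¹ ∈ S :=
  ⟨by rintro ⟨m, hm, rfl⟩; simpa using hm, fun h => ⟨_, h, by simp⟩⟩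

theorem leftStab_mul_unit (S : Set A) (u : Aˣ) :
    leftStab ((fun m => m * (u : A)) '' S) = leftStab S := by
  ext a
  refine ⟨fun h m hm => ?_, fun h m hm => ?_⟩
  · simpa [mul_assoc] using (mem_mul_unit_image u _).1 (h _ ⟨m, hm, rfl⟩)
  · rw [mem_mul_unit_image] at hm ⊢
    rw [mul_assoc]
    exact h _ hm

theorem rightStab_mul_unit (S : Set A) (u : Aˣ) :
    rightStab ((fun m => m * (u : A)) '' S) = conjEquiv u⁻¹ '' rightStab S := by
  ext a
  constructor
  · intro h
    refine ⟨u * a * ↑u⁻¹, fun m hm => ?_, by simp [conjEquiv_apply, mul_assoc]⟩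
    simpa [mul_assoc] using (mem_mul_unit_image u _).1 (h _ ⟨m, hm, rfl⟩)
  · rintro ⟨b, hb, rfl⟩ m hm
    rw [mem_mul_unit_image] at hm ⊢
    simpa [conjEquiv_apply, mul_assoc] using hb _ hm

theorem image_center_eq {B : Type*} [Ring B] (θ : A ≃+* B) :
    θ '' Set.center A = Set.center B := by
  ext b
  obtain ⟨a, rfl⟩ := θ.surjective b
  rw [θ.injective.mem_set_image, Semigroup.mem_center_iff, Semigroup.mem_center_iff]
  refine ⟨fun h c => ?_, fun h c => θ.injective ?_⟩
  · obtain ⟨c, rfl⟩ := θ.surjective c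
    rw [← map_mul, ← map_mul, h]
  · rw [map_mul, map_mul, h]

end UnitTranslation

/-! ### Invariants under equivalence and transposition. -/

section Invariants

variable {n : ℕ} {E : Type u} [Field E]

/-- Two codes whose left stabilisers, right stabilisers and centres (the central elements of the
left stabilisers) have the same sizes. -/
def SameStabCard {A B : Type*} [Ring A] [Ring B] (S : Set A) (T : Set B) : Prop :=
  (leftStab S).ncard = (leftStab T).ncard ∧ (rightStab S).ncard = (rightStab T).ncard ∧
    (leftStab S ∩ Set.center A).ncard = (leftStab T ∩ Set.center B).ncard

theorem sameStabCard_image {A B : Type*} [Ring A] [Ring B] (θ : A ≃+* B) (S : Set A) :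
    SameStabCard (θ '' S) S := by
  refine ⟨?_, ?_, ?_⟩
  · rw [leftStab_image, Set.ncard_image_of_injective _ θ.injective]
  · rw [rightStab_image, Set.ncard_image_of_injective _ θ.injective]
  · rw [leftStab_image, ← image_center_eq θ, ← Set.image_inter θ.injective,
      Set.ncard_image_of_injective _ θ.injective]

/-- An equivalence between additive codes preserves the sizes of the code and its stabilisers. -/
theorem sameStabCard_of_equivalent {V V' : AddSubgroup (Matrix (Fin n) (Fin n) E)}
    (h : Equivalent (V : Set (Matrix (Fin n) (Fin n) E)) V') :
    (V : Set (Matrix (Fin n) (Fin n) E)).ncard = (V' : Set (Matrix (Fin n) (Fin n) E)).ncard ∧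
      SameStabCard (V : Set (Matrix (Fin n) (Fin n) E))
        (V' : Set (Matrix (Fin n) (Fin n) E)) := by
  obtain ⟨P, Q, Z, ρ, h⟩ := h
  have hmem : ∀ A, A ∈ V' ↔ ∃ M ∈ V, (P : Matrix (Fin n) (Fin n) E) * M.map ρ * Q + Z = A := by
    intro A
    rw [← SetLike.mem_coe, h]
    rfl
  -- The translation is harmless: Z is the image of 0, hence in V'. What remains is M ↦ (P M^ρ
  -- P⁻¹)(PQ), a ring automorphism followed by right multiplication by a unit.
  have hZ : Z ∈ V' := (hmem Z).2 ⟨0, zero_mem _, by simp⟩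
  set φ : Matrix (Fin n) (Fin n) E ≃+* Matrix (Fin n) (Fin n) E :=
    (ρ.mapMatrix).trans (conjEquiv P) with hφ
  have hφa : ∀ M, φ M = P * M.map ρ * ((P⁻¹ :
    (Matrix (Fin n) (Fin n) E)ˣ) : Matrix (Fin n) (Fin n) E) := fun _ => rfl
  have hV' : (V' : Set (Matrix (Fin n) (Fin n) E)) =
      (fun m => m * ((P * Q : (Matrix (Fin n) (Fin n) E)ˣ) : Matrix (Fin n) (Fin n) E)) ''
        (φ '' V) := by
    have hid : ∀ M : Matrix (Fin n) (Fin n) E, φ M * ((P * Q : (Matrix (Fin n) (Fin n) E)ˣ) :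
        Matrix (Fin n) (Fin n) E) = P * M.map ρ * Q := by
      intro M
      rw [hφa, Units.val_mul, mul_assoc, Units.inv_mul_cancel_left]
    rw [Set.image_image]
    ext A
    rw [SetLike.mem_coe]
    constructor
    · intro hA
      obtain ⟨M, hM, hA'⟩ := (hmem _).1 (add_mem hA hZ)
      exact ⟨M, hM, (hid M).trans (add_right_cancel hA')⟩
    · rintro ⟨M, hM, rfl⟩
      have := sub_mem ((hmem _).2 ⟨M, hM, rfl⟩) hZ
      rwa [add_sub_cancel_right, ← hid] at this
  have hs := sameStabCard_image φ (V : Set (Matrix (Fin n) (Fin n) E))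
  refine ⟨?_, ?_, ?_, ?_⟩
  · rw [hV', Set.ncard_image_of_injective _ (P * Q).isUnit.mul_left_injective,
      Set.ncard_image_of_injective _ φ.injective]
  · rw [hV', leftStab_mul_unit, hs.1]
  · rw [hV', rightStab_mul_unit, Set.ncard_image_of_injective _ (RingEquiv.injective _), hs.2.1]
  · rw [hV', leftStab_mul_unit, hs.2.2]

theorem transpose_mem_image {S : Set (Matrix (Fin n) (Fin n) E)} {A : Matrix (Fin n) (Fin n) E} :
    A ∈ Matrix.transpose '' S ↔ A.transpose ∈ S :=
  ⟨by rintro ⟨m, hm, rfl⟩; simpa using hm, fun h => ⟨_, h, A.transpose_transpose⟩⟩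

theorem transpose_mem_center {A : Matrix (Fin n) (Fin n) E}
    (hA : A ∈ Set.center (Matrix (Fin n) (Fin n) E)) :
    A.transpose = A := by
  rw [Matrix.center_eq_range] at hA
  obtain ⟨e, rfl⟩ := hA
  simp

theorem leftStab_transpose (S : Set (Matrix (Fin n) (Fin n) E)) :
    leftStab (Matrix.transpose '' S) = Matrix.transpose '' rightStab S := by
  ext A
  rw [transpose_mem_image]
  refine ⟨fun h m hm => ?_, fun h m hm => ?_⟩
  · have := transpose_mem_image.1 (h _ ⟨m, hm, rfl⟩)
    rwa [Matrix.transpose_mul, Matrix.transpose_transpose] at this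
  · rw [transpose_mem_image] at hm ⊢
    rw [Matrix.transpose_mul]
    exact h _ hm

theorem rightStab_transpose (S : Set (Matrix (Fin n) (Fin n) E)) :
    rightStab (Matrix.transpose '' S) = Matrix.transpose '' leftStab S := by
  ext A
  rw [transpose_mem_image]
  refine ⟨fun h m hm => ?_, fun h m hm => ?_⟩
  · have := transpose_mem_image.1 (h _ ⟨m, hm, rfl⟩)
    rwa [Matrix.transpose_mul, Matrix.transpose_transpose] at this
  · rw [transpose_mem_image] at hm ⊢
    rw [Matrix.transpose_mul]
    exact h _ hm

/-- Central matrices are scalar, hence symmetric, and multiply equally from either side. -/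
theorem leftStab_inter_center_transpose (S : Set (Matrix (Fin n) (Fin n) E)) :
    leftStab (Matrix.transpose '' S) ∩ Set.center _ = leftStab S ∩ Set.center _ := by
  ext A
  simp only [Set.mem_inter_iff, and_congr_left_iff]
  intro hA
  rw [leftStab_transpose, transpose_mem_image, transpose_mem_center hA]
  exact forall₂_congr fun m _ => by rw [Semigroup.mem_center_iff.1 hA m]

/-- The adjoint of an additive code. -/
def adjointGroup (V : AddSubgroup (Matrix (Fin n) (Fin n) E)) :
    AddSubgroup (Matrix (Fin n) (Fin n) E) :=
  V.map (Matrix.transposeAddEquiv (Fin n) (Fin n) E).toAddMonoidHom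

theorem coe_adjointGroup (V : AddSubgroup (Matrix (Fin n) (Fin n) E)) :
    (adjointGroup V : Set (Matrix (Fin n) (Fin n) E)) = adjointCode V := rfl

theorem ncard_adjointCode (S : Set (Matrix (Fin n) (Fin n) E)) :
    (adjointCode S).ncard = S.ncard :=
  Set.ncard_image_of_injective _ Matrix.transpose_injective

end Invariants

/-! ### Invariants under duality. -/

section Dual

variable {n : ℕ} {E : Type u} [Field E] [Finite E]

/-- The dual of an additive code is orthogonal, for a nondegenerate symmetric form, to the code. -/
theorem exists_bilinForm : let _ : Algebra (ZMod (ringChar E)) E := ZMod.algebra E (ringChar E)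
    ∃ B : LinearMap.BilinForm (ZMod (ringChar E)) (Matrix (Fin n) (Fin n) E),
      (∀ M N, B M N = Algebra.trace (ZMod (ringChar E)) E (M * N.transpose).trace) ∧
        B.IsRefl ∧ B.Nondegenerate := by
  let _ : Algebra (ZMod (ringChar E)) E := ZMod.algebra E (ringChar E)
  have : Fact (ringChar E).Prime := ⟨CharP.char_is_prime E _⟩
  have hsymm : ∀ M N : Matrix (Fin n) (Fin n) E,
      (M * N.transpose).trace = (N * M.transpose).trace := by
    intro M N
    rw [← Matrix.trace_transpose, Matrix.transpose_mul, Matrix.transpose_transpose]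
  set B : LinearMap.BilinForm (ZMod (ringChar E)) (Matrix (Fin n) (Fin n) E) :=
    LinearMap.mk₂ _ (fun M N => Algebra.trace (ZMod (ringChar E)) E (M * N.transpose).trace)
      (by simp [add_mul]) (by simp) (by simp [mul_add]) (by simp)
  have hB : ∀ M N, B M N = Algebra.trace (ZMod (ringChar E)) E (M * N.transpose).trace :=
    fun _ _ => rfl
  have hrefl : B.IsRefl := fun M N h => by
    rw [hB] at h ⊢
    rwa [hsymm]
  refine ⟨B, hB, hrefl, (LinearMap.IsRefl.nondegenerate_iff_separatingLeft hrefl).2 fun M hM => ?_⟩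
  ext i j
  refine (traceForm_nondegenerate (ZMod (ringChar E)) E).1 _ fun c => ?_
  -- Matrices with one nonzero entry reduce the claim to the nondegeneracy of the trace form of E.
  have := hM (Matrix.single i j c)
  rwa [hB, Matrix.transpose_single, Matrix.trace_mul_single] at this

/-- The dual of an additive code. -/
theorem exists_dualGroup (V : AddSubgroup (Matrix (Fin n) (Fin n) E)) :
    ∃ W : AddSubgroup (Matrix (Fin n) (Fin n) E), (W : Set (Matrix (Fin n) (Fin n) E)) = dualCode V ∧
      dualCode (W : Set (Matrix (Fin n) (Fin n) E)) = V ∧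
      (W : Set (Matrix (Fin n) (Fin n) E)).ncard * (V : Set (Matrix (Fin n) (Fin n) E)).ncard =
        Nat.card (Matrix (Fin n) (Fin n) E) := by
  let _ : Algebra (ZMod (ringChar E)) E := ZMod.algebra E (ringChar E)
  have : Fact (ringChar E).Prime := ⟨CharP.char_is_prime E _⟩
  obtain ⟨B, hB, hrefl, hnd⟩ := exists_bilinForm (n := n) (E := E)
  set V' := AddSubgroup.toZModSubmodule (ringChar E) V
  have hdual : ∀ U : Submodule (ZMod (ringChar E)) (Matrix (Fin n) (Fin n) E),
      (B.orthogonal U : Set (Matrix (Fin n) (Fin n) E)) = dualCode U := by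
    intro U
    ext M
    exact forall₂_congr fun A _ => by rw [hB]
  refine ⟨(B.orthogonal V').toAddSubgroup, hdual V', ?_, ?_⟩
  · rw [Submodule.coe_toAddSubgroup, ← hdual, LinearMap.BilinForm.orthogonal_orthogonal hnd hrefl]
    rfl
  · have h1 : ∀ U : Submodule (ZMod (ringChar E)) (Matrix (Fin n) (Fin n) E),
        (U : Set (Matrix (Fin n) (Fin n) E)).ncard =
          ringChar E ^ Module.finrank (ZMod (ringChar E)) U := by
      intro U
      rw [← Nat.card_coe_set_eq]
      exact (Module.natCard_eq_pow_finrank (K := ZMod (ringChar E)) (V := U)).trans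
        (by rw [Nat.card_zmod])
    have h2 := LinearMap.BilinForm.finrank_orthogonal hnd V'
    have h3 := Submodule.finrank_le V'
    rw [Submodule.coe_toAddSubgroup, h1, show (V : Set (Matrix (Fin n) (Fin n) E)) = V' from rfl,
      h1, ← pow_add, h2, Nat.sub_add_cancel h3,
      Module.natCard_eq_pow_finrank (K := ZMod (ringChar E)), Nat.card_zmod]

/-- For the form tr(AB^T), the adjoint of left multiplication by A is left multiplication by A^T. -/
theorem transpose_mem_leftStab_dualCode {S : Set (Matrix (Fin n) (Fin n) E)}
    {A : Matrix (Fin n) (Fin n) E} (hA : A ∈ leftStab S) : A.transpose ∈ leftStab (dualCode S) := by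
  intro M hM N hN
  have := hM _ (hA _ hN)
  rwa [Matrix.transpose_mul, Matrix.transpose_transpose, ← mul_assoc, Matrix.trace_mul_comm,
    ← mul_assoc]

theorem transpose_mem_rightStab_dualCode {S : Set (Matrix (Fin n) (Fin n) E)}
    {A : Matrix (Fin n) (Fin n) E} (hA : A ∈ rightStab S) :
    A.transpose ∈ rightStab (dualCode S) := by
  intro M hM N hN
  have := hM _ (hA _ hN)
  rwa [Matrix.transpose_mul, Matrix.transpose_transpose, ← mul_assoc]

/-- Transposition maps the stabilisers of a code into those of its dual; equality follows from the
double dual. -/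
theorem sameStabCard_dualCode (V : AddSubgroup (Matrix (Fin n) (Fin n) E)) :
    SameStabCard (dualCode (V : Set (Matrix (Fin n) (Fin n) E)))
      (V : Set (Matrix (Fin n) (Fin n) E)) := by
  obtain ⟨W, hW, hWV, -⟩ := exists_dualGroup V
  have hdd : dualCode (dualCode (V : Set (Matrix (Fin n) (Fin n) E))) = V := by rw [← hW, hWV]
  have hl : leftStab (dualCode (V : Set (Matrix (Fin n) (Fin n) E))) =
      Matrix.transpose '' leftStab (V : Set (Matrix (Fin n) (Fin n) E)) := by
    ext A
    rw [transpose_mem_image]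
    refine ⟨fun h => ?_, fun h => ?_⟩
    · rw [← hdd]
      exact transpose_mem_leftStab_dualCode h
    · simpa using transpose_mem_leftStab_dualCode h
  have hr : rightStab (dualCode (V : Set (Matrix (Fin n) (Fin n) E))) =
      Matrix.transpose '' rightStab (V : Set (Matrix (Fin n) (Fin n) E)) := by
    ext A
    rw [transpose_mem_image]
    refine ⟨fun h => ?_, fun h => ?_⟩
    · rw [← hdd]
      exact transpose_mem_rightStab_dualCode h
    · simpa using transpose_mem_rightStab_dualCode h
  refine ⟨?_, ?_, ?_⟩
  · rw [hl, Set.ncard_image_of_injective _ Matrix.transpose_injective]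
  · rw [hr, Set.ncard_image_of_injective _ Matrix.transpose_injective]
  · congr 1
    ext A
    simp only [Set.mem_inter_iff, and_congr_left_iff]
    intro hA
    rw [hl, transpose_mem_image, transpose_mem_center hA]

/-- If an additive code with stabilisers of the same size is equivalent to an additive code `V₀`,
its adjoint, its dual or the adjoint of its dual, then the invariants of `V₀` are determined. -/
theorem invariants_of_equivalent {V V₀ : AddSubgroup (Matrix (Fin n) (Fin n) E)}
    (hlr : (leftStab (V : Set (Matrix (Fin n) (Fin n) E))).ncard =
      (rightStab (V : Set (Matrix (Fin n) (Fin n) E))).ncard)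
    (h : Equivalent (V : Set (Matrix (Fin n) (Fin n) E)) V₀ ∨
      Equivalent (V : Set (Matrix (Fin n) (Fin n) E)) (adjointCode V₀) ∨
      Equivalent (V : Set (Matrix (Fin n) (Fin n) E)) (dualCode V₀) ∨
      Equivalent (V : Set (Matrix (Fin n) (Fin n) E)) (adjointCode (dualCode V₀))) :
    SameStabCard (V₀ : Set (Matrix (Fin n) (Fin n) E)) (V : Set (Matrix (Fin n) (Fin n) E)) ∧
      ((V₀ : Set (Matrix (Fin n) (Fin n) E)).ncard = (V : Set (Matrix (Fin n) (Fin n) E)).ncard ∨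
        (V₀ : Set (Matrix (Fin n) (Fin n) E)).ncard *
          (V : Set (Matrix (Fin n) (Fin n) E)).ncard = Nat.card (Matrix (Fin n) (Fin n) E)) := by
  have hadj : ∀ W : AddSubgroup (Matrix (Fin n) (Fin n) E),
      Equivalent (V : Set (Matrix (Fin n) (Fin n) E)) W ∨
        Equivalent (V : Set (Matrix (Fin n) (Fin n) E)) (adjointCode W) →
      SameStabCard (W : Set (Matrix (Fin n) (Fin n) E)) (V : Set (Matrix (Fin n) (Fin n) E)) ∧
        (W : Set (Matrix (Fin n) (Fin n) E)).ncard =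
          (V : Set (Matrix (Fin n) (Fin n) E)).ncard := by
    rintro W (h | h)
    · obtain ⟨h1, h2, h3, h4⟩ := sameStabCard_of_equivalent h
      exact ⟨⟨h2.symm, h3.symm, h4.symm⟩, h1.symm⟩
    · rw [← coe_adjointGroup] at h
      obtain ⟨h1, h2, h3, h4⟩ := sameStabCard_of_equivalent h
      rw [coe_adjointGroup, ncard_adjointCode] at h1
      rw [coe_adjointGroup, adjointCode, leftStab_transpose,
        Set.ncard_image_of_injective _ Matrix.transpose_injective] at h2
      rw [coe_adjointGroup, adjointCode, rightStab_transpose,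
        Set.ncard_image_of_injective _ Matrix.transpose_injective] at h3
      rw [coe_adjointGroup, adjointCode, leftStab_inter_center_transpose] at h4
      -- Transposition has swapped left and right, which `hlr` makes harmless.
      exact ⟨⟨by rw [← h3, hlr], by rw [← h2, hlr], h4.symm⟩, h1.symm⟩
  obtain ⟨W, hW, -, hcard⟩ := exists_dualGroup V₀
  obtain ⟨d1, d2, d3⟩ := sameStabCard_dualCode V₀
  rw [← or_assoc, ← hW] at h
  rcases h with h | h
  · exact ⟨(hadj _ h).1, Or.inl (hadj _ h).2⟩
  · obtain ⟨⟨h1, h2, h3⟩, h4⟩ := hadj _ h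
    rw [hW] at h1 h2 h3
    exact ⟨⟨d1.symm.trans h1, d2.symm.trans h2, d3.symm.trans h3⟩,
      Or.inr (by rw [← h4, mul_comm, hcard])⟩

end Dual

end SkewMRD

namespace SkewMRD

/-! ### Automorphisms of finite fields and elements of given order. -/

section FiniteFields

theorem dvd_of_pow_sub_one_dvd {q a b : ℕ} (hq : 2 ≤ q) (h : q ^ a - 1 ∣ q ^ b - 1) : a ∣ b := by
  have h1 := Nat.pow_sub_one_gcd_pow_sub_one q a b
  rw [Nat.gcd_eq_left h] at h1
  have h2 : q ^ a = q ^ a.gcd b := by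
    have := Nat.one_le_pow a q (by lia)
    have := Nat.one_le_pow (a.gcd b) q (by lia)
    lia
  rw [Nat.pow_right_injective hq h2]
  exact Nat.gcd_dvd_right a b

/-- A field of `Q ^ m` elements has an element of multiplicative order `Q - 1`. -/
theorem exists_orderOf_eq {L : Type*} [Field L] [Finite L] {Q m : ℕ}
    (hL : Nat.card L = Q ^ m) : ∃ h : L, h ≠ 0 ∧ orderOf h = Q - 1 := by
  obtain ⟨g, hg⟩ := IsCyclic.exists_ofOrder_eq_natCard (α := Lˣ)
  rw [Nat.card_units, hL] at hg
  have hdvd : Q - 1 ∣ Q ^ m - 1 := Nat.sub_one_dvd_pow_sub_one Q m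
  have hL1 : 1 < Nat.card L := Finite.one_lt_card
  rw [hL] at hL1
  obtain ⟨h, hh⟩ : ∃ h : Lˣ, orderOf h = Q - 1 := by
    obtain ⟨d, hd⟩ := hdvd
    exact ⟨g ^ d, by
      rw [orderOf_pow_of_dvd (by rintro rfl; lia) (by rw [hg, hd]; exact Dvd.intro_left _ rfl), hg, hd,
        Nat.mul_div_cancel _ (Nat.pos_of_ne_zero (by rintro rfl; lia))]⟩
  exact ⟨h, h.ne_zero, by rw [orderOf_units, hh]⟩

theorem pow_eq_self_iff_of_orderOf {L : Type*} [Field L] {h : L} (h0 : h ≠ 0) {Q N : ℕ} (hN : 0 < N)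
    (ho : orderOf h = Q) : h ^ N = h ↔ Q ∣ N - 1 := by
  rw [← ho, orderOf_dvd_iff_pow_eq_one]
  obtain ⟨N, rfl⟩ := Nat.exists_eq_succ_of_ne_zero hN.ne'
  rw [Nat.succ_sub_one, pow_succ, mul_eq_right₀ h0]

/-- If the automorphisms `ρ` and `ρ⁻¹ φ` of a finite field have fixed fields of the same size
`q ^ t`, then `φ` fixes every element of order `q ^ (2 * t) - 1`. -/
theorem apply_eq_self_of_card_fixed {L : Type*} [Field L] [Finite L] {q t : ℕ} (hq : 2 ≤ q)
    (ht : 1 ≤ t) (ρ φ : L ≃+* L) (hρ : {a | ρ a = a}.ncard = q ^ t)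
    (hρφ : {a | ρ a = φ a}.ncard = q ^ t) {h : L} (h0 : h ≠ 0) (ho : orderOf h = q ^ (2 * t) - 1) :
    φ h = h := by
  have hqt : 1 < q ^ t := Nat.one_lt_pow (by lia) (by lia)
  have key : ∀ S : Subfield L, (S : Set L).ncard = q ^ t → (S : Set L) = {x | x ^ q ^ t = x} := by
    intro S hS
    rw [← hS]
    refine eq_pow_eq_self (hS ▸ hqt) fun x hx => ?_
    have := Fintype.ofFinite S
    rw [← Nat.card_coe_set_eq, Nat.card_eq_fintype_card]
    exact congrArg Subtype.val (FiniteField.pow_card (⟨x, hx⟩ : S))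
  set A : Subfield L := RingHom.eqLocusField (ρ : L →+* L) (RingHom.id L) with hA
  set B : Subfield L := RingHom.eqLocusField (ρ : L →+* L) (φ : L →+* L) with hB
  have hmA : ∀ x, ρ x = x ↔ x ^ q ^ t = x := fun x => Set.ext_iff.1 (key A hρ) x
  have hmB : ∀ x, ρ x = φ x ↔ x ^ q ^ t = x := fun x => Set.ext_iff.1 (key B hρφ) x
  have hfrob : ∀ x y : L, (x + y) ^ q ^ t = x ^ q ^ t + y ^ q ^ t := by
    intro x y
    have := Fintype.ofFinite A
    have hc : Fintype.card A = q ^ t := by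
      rw [← Nat.card_eq_fintype_card, ← hρ, ← Nat.card_coe_set_eq]
      rfl
    rw [← hc]
    exact map_add (FiniteField.frobeniusAlgHom A L) x y
  set y := h ^ q ^ t with hy
  have hyy : y ^ q ^ t = h := by
    rw [hy, ← pow_mul, ← pow_add, ← two_mul, pow_eq_self_iff_of_orderOf h0 (by positivity) ho]
  have hyh : y ≠ h := by
    rw [hy, Ne, pow_eq_self_iff_of_orderOf h0 (by positivity) ho]
    intro hd
    have := Nat.le_of_dvd (by lia) (dvd_of_pow_sub_one_dvd hq hd)
    lia
  have hsum : (h + y) ^ q ^ t = h + y := by rw [hfrob, hyy, ← hy, add_comm]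
  have hprod : (h * y) ^ q ^ t = h * y := by rw [mul_pow, hyy, ← hy, mul_comm]
  -- h and y = h^{q^t} are the roots of a quadratic with coefficients h + y and hy up to sign, both
  -- fixed by ψ.
  have hconj : ∀ ψ : L ≃+* L, (∀ x, x ^ q ^ t = x → ψ x = x) → ψ h = h ∨ ψ h = y := by
    intro ψ hψ
    have h1 := hψ _ hsum
    have h2 := hψ _ hprod
    rw [map_add] at h1
    rw [map_mul] at h2
    have : (ψ h - h) * (ψ h - y) = 0 := by linear_combination ψ h * h1 - h2
    rcases mul_eq_zero.1 this with h | h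
    · exact Or.inl (sub_eq_zero.1 h)
    · exact Or.inr (sub_eq_zero.1 h)
  -- h is not fixed by ρ, so ρ(h) = y. If also φ(h) = y, then h would lie in the field where ρ = φ,
  -- which has only q^t elements and does not contain h.
  have hρy : ρ h = y := (hconj ρ fun x hx => (hmA x).2 hx).resolve_left fun h' => hyh ((hmA h).1 h')
  refine (hconj φ fun x hx => ?_).resolve_right fun h' => hyh ((hmB h).1 (hρy.trans h'.symm))
  rw [← (hmB x).2 hx, (hmA x).2 hx]

variable {K L : Type u} [Field K] [Field L] [Algebra K L] {σ : L ≃ₐ[K] L} [Finite K]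
  [FiniteDimensional K L]

/-- The Frobenius is a power of σ, so its r-th power fixes whatever σ^r fixes. -/
theorem pow_card_pow_eq_self (hσ : IsGenerator σ) {r : ℕ} {h : L} (hr : (σ ^ r) h = h) :
    h ^ Nat.card K ^ r = h := by
  have := Fintype.ofFinite K
  obtain ⟨j, hj⟩ := Subgroup.mem_zpowers_iff.1 (hσ (FiniteField.frobeniusAlgEquivOfAlgebraic K L))
  have h1 : FiniteField.frobeniusAlgEquivOfAlgebraic K L ^ r ∈ MulAction.stabilizer (L ≃ₐ[K] L) h := by
    rw [← hj, ← zpow_natCast, ← zpow_mul, mul_comm, zpow_mul, zpow_natCast]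
    exact zpow_mem (show σ ^ r ∈ MulAction.stabilizer (L ≃ₐ[K] L) h from hr) j
  have h2 : (FiniteField.frobeniusAlgEquivOfAlgebraic K L ^ r) h = h := h1
  rwa [AlgEquiv.coe_pow, FiniteField.coe_frobeniusAlgEquivOfAlgebraic_iterate,
    ← Nat.card_eq_fintype_card] at h2

end FiniteFields

/-! ### Sizes of the idealisers and centres in the family S. -/

section CodeSInvariants

variable {K L : Type u} [Field K] [Field L] [Algebra K L] {σ : L ≃ₐ[K] L}
  [Finite K] [FiniteDimensional K L] {F : K[X]} {ρ : L ≃+* L} {k : ℕ} {η : L}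

/-- By transitivity of norms, the condition over the fixed field of ρ implies the one over K. -/
theorem norm_mul_ne_one_of_norm_fixedBase_ne {c : K}
    (hη : Algebra.norm (fixedBase K ρ) η * Algebra.norm (fixedBase K ρ) c ≠ 1) :
    Algebra.norm K η * c ≠ 1 := by
  intro h
  refine hη ?_
  have : Algebra.norm (fixedBase K ρ) (Algebra.norm K η) = Algebra.norm (fixedBase K ρ) η :=
    Algebra.norm_norm
  rw [← this, ← map_mul, h, map_one]

variable (hσ : IsGenerator σ) (hF : F.Monic) (hcop : IsCoprime F X) (hr2 : 2 ≤ F.natDegree * k)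
  (hrN : F.natDegree * k + 2 ≤ Module.finrank K L * F.natDegree)
  (hspecial : F.natDegree * k = 2 → Module.finrank K L * F.natDegree = 4 →
    Module.finrank K L = 4 ∧ Algebra.norm K η * F.coeff 0 ^ 2 ≠ 1)
  [Nontrivial (SkewQuot σ F)]

include hσ hF hcop hr2 hrN hspecial

theorem ncard_leftStab_codeS :
    (leftStab (codeS σ ρ F k η)).ncard = {α | η * ρ α = α * η}.ncard := by
  rw [← Set.ncard_image_of_injective _ (toQuot_mono_zero_injective (σ := σ) (F := F))]
  congr 1
  ext b
  refine ⟨fun hb => ?_, ?_⟩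
  · obtain ⟨α, rfl, hα⟩ := exists_const_of_mem_leftStab_codeS hσ hF hcop hr2 hrN hspecial hb
    exact ⟨α, hα, rfl⟩
  · rintro ⟨α, hα, rfl⟩
    exact const_mem_leftStab_codeS hF (by lia) hα

theorem ncard_rightStab_codeS : (rightStab (codeS σ ρ F k η)).ncard =
    {β | η * ρ β = η * (σ ^ (F.natDegree * k)) β}.ncard := by
  rw [← Set.ncard_image_of_injective _ (toQuot_mono_zero_injective (σ := σ) (F := F))]
  congr 1
  ext b
  refine ⟨fun hb => ?_, ?_⟩
  · obtain ⟨α, rfl, hα⟩ := exists_const_of_mem_rightStab_codeS hσ hF hcop hr2 hrN hspecial hb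
    exact ⟨α, hα, rfl⟩
  · rintro ⟨α, hα, rfl⟩
    exact const_mem_rightStab_codeS hF (by lia) hα

theorem ncard_leftStab_inter_center_codeS :
    (leftStab (codeS σ ρ F k η) ∩ Set.center (SkewQuot σ F)).ncard =
      {c : K | η * ρ (algebraMap K L c) = algebraMap K L c * η}.ncard := by
  rw [← Set.ncard_image_of_injective _ (Function.Injective.comp
    (toQuot_mono_zero_injective (σ := σ) (F := F)) (algebraMap K L).injective)]
  congr 1
  ext b
  constructor
  · rintro ⟨hb, hc⟩
    obtain ⟨α, rfl, hα⟩ := exists_const_of_mem_leftStab_codeS hσ hF hcop hr2 hrN hspecial hb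
    have h1 := Semigroup.mem_center_iff.1 hc (toQuot σ F (mono σ 1 1))
    rw [← map_mul, ← map_mul, mono_mul_mono, mono_mul_mono] at h1
    have h1 := eq_of_toQuot hF (mono_mem_degLT (by lia) _) (mono_mem_degLT (by lia) _) h1
    have h1 := congrArg (cf σ 1) h1
    rw [zero_add, cf_mono_self, cf_mono_self, pow_zero, map_one, mul_one, one_mul, pow_one] at h1
    obtain ⟨c, rfl⟩ := mem_base_of_fixed hσ h1
    exact ⟨c, hα, rfl⟩
  · rintro ⟨c, hc, rfl⟩
    exact ⟨const_mem_leftStab_codeS hF (by lia) hc,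
      Semigroup.mem_center_iff.2 (commute_toQuot_base F c)⟩

end CodeSInvariants

/-! ### Separating D from the family S. -/

section NotCodeS

/-- The codes `S_{n,s',k'}(η,ρ,F')` do not have the invariants of the code `D_{n,s,k}(γ,F)`. -/
theorem not_invariants_codeS {K L E : Type u} [Field K] [Field L] [Algebra K L] {σ : L ≃ₐ[K] L}
    [Finite K] [Field E] [Finite E] {F : K[X]} {ρ : L ≃+* L} {k k' q s t : ℕ} {η : L}
    (hq : 2 ≤ q) (ht : 2 ≤ t) (hk : 1 < k) (hkt : k ≤ t) (hs : 1 ≤ s) (hdvd : ¬ 2 * t ∣ s * k)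
    (hE : Nat.card E = q ^ s) (hn : Module.finrank K L = 2 * t) (hσ : IsGenerator σ)
    (hF : F.Monic) (hirr : Irreducible F) (hFX : F ≠ X)
    (θ : SkewQuot σ F ≃+* Matrix (Fin (2 * t)) (Fin (2 * t)) E) (hk' : 1 ≤ k') (hkn' : k' < 2 * t)
    (hη : Algebra.norm (fixedBase K ρ) η * Algebra.norm (fixedBase K ρ)
      ((-1 : K) ^ (F.natDegree * k' * (2 * t - 1)) * F.coeff 0 ^ k') ≠ 1)
    (hl : (leftStab (codeS σ ρ F k' η)).ncard = q ^ t)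
    (hr : (rightStab (codeS σ ρ F k' η)).ncard = q ^ t)
    (hz : (leftStab (codeS σ ρ F k' η) ∩ Set.center (SkewQuot σ F)).ncard = q)
    (hc : (codeS σ ρ F k' η).ncard = q ^ (2 * t * (s * k)) ∨
      (codeS σ ρ F k' η).ncard * q ^ (2 * t * (s * k)) =
        Nat.card (Matrix (Fin (2 * t)) (Fin (2 * t)) E)) : False := by
  have : FiniteDimensional K L := Module.finite_of_finrank_pos (by lia)
  have : Finite L := Module.finite_of_finite K
  have : NeZero (2 * t) := ⟨by lia⟩
  have : Nontrivial (SkewQuot σ F) := θ.toEquiv.nontrivial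
  have hd0 : 0 < F.natDegree := hirr.natDegree_pos
  have hcop := isCoprime_X_of_irreducible hF hirr hFX
  have hcardL : Nat.card L = Nat.card K ^ (2 * t) := by
    rw [Module.natCard_eq_pow_finrank (K := K), hn]
  have hM : Nat.card (Matrix (Fin (2 * t)) (Fin (2 * t)) E) = (q ^ s) ^ (2 * t * (2 * t)) := by
    change Nat.card (Fin (2 * t) → Fin (2 * t) → E) = _
    rw [Nat.card_fun, Nat.card_fun, hE, Nat.card_fin, pow_mul (q ^ s) (2 * t) (2 * t)]
  have hKd : Nat.card K ^ F.natDegree = q ^ s := by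
    have h1 := (card_skewQuot (σ := σ) hF).symm.trans (Nat.card_congr θ.toEquiv)
    rw [hM, hn, hcardL] at h1
    refine Nat.pow_left_injective (n := 2 * t * (2 * t)) (by positivity) ?_
    change (_ ^ _) ^ _ = (_ ^ _) ^ _
    rw [← h1, ← pow_mul, ← pow_mul]
    congr 1
    ring
  have hcS : (codeS σ ρ F k' η).ncard = q ^ (s * (2 * t * k')) := by
    rw [card_codeS hF (Nat.mul_pos hd0 hk') (by lia), hcardL, pow_mul q, ← hKd, ← pow_mul, ← pow_mul]
    congr 1
    ring
  have hpos : 0 < 2 * t * s := by positivity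
  -- The first case is equal cardinality; the second comes from the dual. Divisibility of sk and of
  -- sk' by n = 2t is equivalent in both.
  have hkk : k' = k ∨ k' + k = 2 * t := by
    rw [hcS, hM, ← pow_add, ← pow_mul] at hc
    rcases hc with hc | hc
    · refine Or.inl (Nat.eq_of_mul_eq_mul_left hpos ?_)
      have := Nat.pow_right_injective hq hc
      calc 2 * t * s * k' = s * (2 * t * k') := by ring
        _ = 2 * t * (s * k) := this
        _ = _ := by ring
    · refine Or.inr (Nat.eq_of_mul_eq_mul_left hpos ?_)
      have := Nat.pow_right_injective hq hc
      calc 2 * t * s * (k' + k) = s * (2 * t * k') + 2 * t * (s * k) := by ring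
        _ = s * (2 * t * (2 * t)) := this
        _ = _ := by ring
  have hdvd' : ¬ 2 * t ∣ s * k' := by
    rcases hkk with rfl | h
    · exact hdvd
    · intro h1
      refine hdvd ((Nat.dvd_add_right h1).1 ?_)
      rw [← mul_add, h]
      exact Dvd.intro_left s rfl
  have hr2 : 2 ≤ F.natDegree * k' :=
    le_trans (by lia : 2 ≤ k') (Nat.le_mul_of_pos_left _ hd0)
  have hrN : F.natDegree * k' + 2 ≤ Module.finrank K L * F.natDegree := by
    rw [hn]
    have : k' + 2 ≤ 2 * t := by lia
    nlinarith
  -- The exceptional case means s' = 1, n = 4, k' = 2; the sign exponent s'k'(n - 1) is then 6, so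
  -- the hypothesis on η is exactly what is needed.
  have hspecial : F.natDegree * k' = 2 → Module.finrank K L * F.natDegree = 4 →
      Module.finrank K L = 4 ∧ Algebra.norm K η * F.coeff 0 ^ 2 ≠ 1 := by
    intro h1 h2
    rw [hn] at h2 ⊢
    have hd1 : F.natDegree = 1 := by nlinarith
    have ht2 : t = 2 := by rw [hd1] at h2; lia
    have hk2 : k' = 2 := by rw [hd1] at h1; lia
    refine ⟨by lia, ?_⟩
    have h3 := norm_mul_ne_one_of_norm_fixedBase_ne hη
    rw [hd1, ht2, hk2] at h3
    rwa [Even.neg_one_pow ⟨3, rfl⟩, one_mul] at h3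
  rw [ncard_leftStab_codeS hσ hF hcop hr2 hrN hspecial] at hl
  rw [ncard_rightStab_codeS hσ hF hcop hr2 hrN hspecial] at hr
  rw [ncard_leftStab_inter_center_codeS hσ hF hcop hr2 hrN hspecial] at hz
  -- For η = 0 the idealiser is all of L and the centre all of K, so |L| = q^t and |K| = q, against
  -- |L| = |K|^{2t}.
  rcases eq_or_ne η 0 with rfl | hη0
  · simp only [zero_mul, mul_zero, Set.ofPred_true, Set.ncard_univ] at hl hz
    rw [hl, hz] at hcardL
    have := Nat.pow_right_injective hq hcardL
    lia
  have hη1 : ∀ a b : L, η * a = b * η ↔ a = b := fun a b => by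
    rw [mul_comm b, mul_right_inj' hη0]
  simp only [hη1] at hl hz
  simp only [mul_right_inj' hη0] at hr
  -- The size of the centre enters here: the fixed field of ρ in K has q elements.
  obtain ⟨m, hm⟩ : ∃ m, Nat.card K = q ^ m := by
    have h1 : Nat.card (fixedBase K ρ) = q := hz
    exact ⟨_, by rw [Module.natCard_eq_pow_finrank (K := fixedBase K ρ), h1]⟩
  obtain ⟨h, h0, ho⟩ := exists_orderOf_eq (L := L) (Q := q ^ (2 * t)) (m := m) (by
    rw [hcardL, hm, ← pow_mul, ← pow_mul, mul_comm])
  have hfix := apply_eq_self_of_card_fixed hq (by lia) ρ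
    ((σ ^ (F.natDegree * k') : L ≃ₐ[K] L) : L ≃+* L) hl hr h0 ho
  have h1 := pow_card_pow_eq_self hσ hfix
  rw [hm, ← pow_mul, pow_eq_self_iff_of_orderOf h0 (by positivity) ho] at h1
  have hms : m * F.natDegree = s := by
    rw [hm, ← pow_mul] at hKd
    exact Nat.pow_right_injective hq hKd
  -- An element of order q^{2t} - 1 is fixed by raising to the power q^{m s'k'}, so 2t divides m
  -- s'k', which is sk' because ms' = s.
  refine hdvd' ?_
  rw [← hms, mul_assoc]
  exact dvd_of_pow_sub_one_dvd hq h1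

end NotCodeS

end SkewMRD

namespace SkewMRD

/-! ### Additivity and left idealisers of the known families. -/

section KnownCodes

variable {K L : Type u} [Field K] [Field L] [Algebra K L] {σ : L ≃ₐ[K] L}

theorem exists_addSubgroup_of_sub_mem {A : Type*} [AddGroup A] {S : Set A} (h0 : S.Nonempty)
    (hS : ∀ x ∈ S, ∀ y ∈ S, x - y ∈ S) : ∃ W : AddSubgroup A, (W : Set A) = S :=
  ⟨AddSubgroup.ofSub S h0 fun x hx y hy => by rw [← sub_eq_add_neg]; exact hS x hx y hy, rfl⟩

theorem mono_zero_mul_mono (i : ℕ) (a b : L) : mono σ 0 a * mono σ i b = mono σ i (a * b) := by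
  simp [mono_mul_mono]

theorem exists_addSubgroup_codeGabidulin (k : ℕ) :
    ∃ W : AddSubgroup (SkewQuot σ (X - 1 : K[X])), (W : Set _) = codeGabidulin σ k := by
  refine exists_addSubgroup_of_sub_mem ⟨_, 0, rfl⟩ ?_
  rintro _ ⟨a, rfl⟩ _ ⟨b, rfl⟩
  exact ⟨a - b, by simp [mono_sub, Finset.sum_sub_distrib]⟩

theorem const_mem_leftStab_codeGabidulin (k : ℕ) (c : L) :
    toQuot σ _ (mono σ 0 c) ∈ leftStab (codeGabidulin σ k) := by
  rintro _ ⟨a, rfl⟩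
  refine ⟨fun i => c * a i, ?_⟩
  rw [← map_mul, Finset.mul_sum]
  simp only [mono_zero_mul_mono]

theorem exists_addSubgroup_codeTZ (L' : IntermediateField K L) (k : ℕ) (γ : L) :
    ∃ W : AddSubgroup (SkewQuot σ (X - 1 : K[X])), (W : Set _) = codeTZ σ L' k γ := by
  refine exists_addSubgroup_of_sub_mem ⟨_, 0, 0, 0, zero_mem _, zero_mem _, rfl⟩ ?_
  rintro _ ⟨a, a', a'', h', h'', rfl⟩ _ ⟨b, b', b'', g', g'', rfl⟩
  refine ⟨a - b, a' - b', a'' - b'', sub_mem h' g', sub_mem h'' g'', ?_⟩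
  rw [← map_sub, mul_sub, mono_sub, mono_sub, add_sub_add_comm, add_sub_add_comm,
    ← Finset.sum_sub_distrib]
  simp only [Pi.sub_apply, mono_sub]

theorem const_mem_leftStab_codeTZ {L' : IntermediateField K L} (k : ℕ) (γ : L) {c : L}
    (hc : c ∈ L') : toQuot σ _ (mono σ 0 c) ∈ leftStab (codeTZ σ L' k γ) := by
  rintro _ ⟨a, a', a'', h', h'', rfl⟩
  refine ⟨fun i => c * a i, c * a', c * a'', mul_mem hc h', mul_mem hc h'', ?_⟩
  rw [← map_mul, mul_add, mul_add, Finset.mul_sum, mul_left_comm γ]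
  simp only [mono_zero_mul_mono]

theorem exists_addSubgroup_codeCMPZ :
    ∃ W : AddSubgroup (SkewQuot σ (X - 1 : K[X])), (W : Set _) = codeCMPZ σ := by
  refine exists_addSubgroup_of_sub_mem ⟨_, 0, 0, 0, rfl⟩ ?_
  rintro _ ⟨a₀, a₁, a₂, rfl⟩ _ ⟨b₀, b₁, b₂, rfl⟩
  exact ⟨a₀ - b₀, a₁ - b₁, a₂ - b₂, by
    rw [← map_sub, mono_sub, mono_sub, mono_sub, add_sub_add_comm, add_sub_add_comm]⟩

theorem const_mem_leftStab_codeCMPZ (c : L) :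
    toQuot σ _ (mono σ 0 c) ∈ leftStab (codeCMPZ σ) := by
  rintro _ ⟨a₀, a₁, a₂, rfl⟩
  refine ⟨c * a₀, c * a₁, c * a₂, ?_⟩
  rw [← map_mul, mul_add, mul_add]
  simp only [mono_zero_mul_mono]

theorem exists_addSubgroup_codeTwoDim (f : ℕ → L) :
    ∃ W : AddSubgroup (SkewQuot σ (X - 1 : K[X])), (W : Set _) = codeTwoDim σ f := by
  refine exists_addSubgroup_of_sub_mem ⟨_, 0, 0, rfl⟩ ?_
  rintro _ ⟨a₀, a₁, rfl⟩ _ ⟨b₀, b₁, rfl⟩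
  exact ⟨a₀ - b₀, a₁ - b₁, by
    rw [← map_sub, mono_sub, mono_sub, add_sub_add_comm, sub_mul]⟩

theorem const_mem_leftStab_codeTwoDim (f : ℕ → L) (c : L) :
    toQuot σ _ (mono σ 0 c) ∈ leftStab (codeTwoDim σ f) := by
  rintro _ ⟨a₀, a₁, rfl⟩
  refine ⟨c * a₀, c * a₁, ?_⟩
  rw [← map_mul, mul_add, mono_zero_mul_mono, ← mul_assoc, mono_zero_mul_mono]

theorem codeAGTG_eq_codeS (τ : L ≃+* L) (k : ℕ) (η : L) :
    codeAGTG σ τ k η = codeS σ τ (X - 1 : K[X]) k η := by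
  have hd : (X - 1 : K[X]).natDegree = 1 := natDegree_X_sub_C 1
  simp only [codeAGTG, codeS, hd, one_mul, mul_comm η]

theorem ncard_le_ncard_leftStab [Finite K] [FiniteDimensional K L] {F : K[X]}
    [Finite (SkewQuot σ F)] [Nontrivial (SkewQuot σ F)]
    {S : Set (SkewQuot σ F)} {T : Set L} (hT : ∀ c ∈ T, toQuot σ F (mono σ 0 c) ∈ leftStab S) :
    T.ncard ≤ (leftStab S).ncard := by
  rw [← Set.ncard_image_of_injective T (toQuot_mono_zero_injective (σ := σ) (F := F))]
  exact Set.ncard_le_ncard (Set.image_subset_iff.2 hT) (Set.toFinite _)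

end KnownCodes

/-! ### Codes with the invariants of D are new. -/

section New

variable {E : Type u} [Field E] [Finite E]

theorem sameStabCard_of_equivalent_image {n : ℕ} {A : Type*} [Ring A]
    (θ : A ≃+* Matrix (Fin n) (Fin n) E) (W : AddSubgroup A)
    {V : AddSubgroup (Matrix (Fin n) (Fin n) E)}
    (hlr : (leftStab (V : Set (Matrix (Fin n) (Fin n) E))).ncard =
      (rightStab (V : Set (Matrix (Fin n) (Fin n) E))).ncard)
    (h : Equivalent (V : Set (Matrix (Fin n) (Fin n) E)) (θ '' W) ∨
      Equivalent (V : Set (Matrix (Fin n) (Fin n) E)) (adjointCode (θ '' W)) ∨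
      Equivalent (V : Set (Matrix (Fin n) (Fin n) E)) (dualCode (θ '' W)) ∨
      Equivalent (V : Set (Matrix (Fin n) (Fin n) E)) (adjointCode (dualCode (θ '' W)))) :
    SameStabCard (W : Set A) (V : Set (Matrix (Fin n) (Fin n) E)) ∧
      ((W : Set A).ncard = (V : Set (Matrix (Fin n) (Fin n) E)).ncard ∨
        (W : Set A).ncard *
          (V : Set (Matrix (Fin n) (Fin n) E)).ncard = Nat.card (Matrix (Fin n) (Fin n) E)) := by
  obtain ⟨⟨h1, h2, h3⟩, h4⟩ :=
    invariants_of_equivalent (V₀ := W.map (θ : A →+ Matrix (Fin n) (Fin n) E)) hlr h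
  obtain ⟨g1, g2, g3⟩ := sameStabCard_image θ (W : Set A)
  have h5 : (θ '' (W : Set A)).ncard = (W : Set A).ncard :=
    Set.ncard_image_of_injective _ θ.injective
  exact ⟨⟨g1.symm.trans h1, g2.symm.trans h2, g3.symm.trans h3⟩, h5 ▸ h4⟩

/-- An additive code with the invariants of the code `D_{n,s,k}(γ,F)` is new. -/
theorem isNew_of_invariants {k q s t : ℕ} (hq : 2 ≤ q) (ht : 2 ≤ t) (hk : 1 < k) (hkt : k ≤ t)
    (hs : 2 ≤ s) (hdvd : ¬ 2 * t ∣ s * k) (hE : Nat.card E = q ^ s)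
    {V : AddSubgroup (Matrix (Fin (2 * t)) (Fin (2 * t)) E)}
    (hl : (leftStab (V : Set (Matrix (Fin (2 * t)) (Fin (2 * t)) E))).ncard = q ^ t)
    (hr : (rightStab (V : Set (Matrix (Fin (2 * t)) (Fin (2 * t)) E))).ncard = q ^ t)
    (hz : (leftStab (V : Set (Matrix (Fin (2 * t)) (Fin (2 * t)) E)) ∩ Set.center _).ncard = q)
    (hc : (V : Set (Matrix (Fin (2 * t)) (Fin (2 * t)) E)).ncard = q ^ (2 * t * (s * k))) :
    IsNew (V : Set (Matrix (Fin (2 * t)) (Fin (2 * t)) E)) := by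
  have hnz : NeZero (2 * t) := ⟨by lia⟩
  have hlr := hl.trans hr.symm
  intro C₀ hC₀
  rw [← not_or, ← not_or, ← not_or]
  intro hequiv
  -- Disposes of families I, III, IV and V: at least |E|^t = q^{st} constants in the left idealiser
  -- exceed q^t because s ≥ 2.
  have hT : ∀ {L : Type u} [Field L] [Algebra E L] {σ : L ≃ₐ[E] L}
      (_ : Module.finrank E L = 2 * t)
      (θ : SkewQuot σ (X - 1 : E[X]) ≃+* Matrix (Fin (2 * t)) (Fin (2 * t)) E)
      (S : Set (SkewQuot σ (X - 1 : E[X]))) (T : Set L)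
      (_ : ∃ W : AddSubgroup (SkewQuot σ (X - 1 : E[X])), (W : Set _) = S)
      (_ : ∀ c ∈ T, toQuot σ _ (mono σ 0 c) ∈ leftStab S) (_ : Nat.card E ^ t ≤ T.ncard)
      (_ : C₀ = θ '' S), False := by
    rintro L _ _ σ hn θ _ T ⟨W, rfl⟩ hT hcard rfl
    have : FiniteDimensional E L := Module.finite_of_finrank_pos (by lia)
    have : Nontrivial (SkewQuot σ (X - 1 : E[X])) := θ.toEquiv.nontrivial
    have : Finite (SkewQuot σ (X - 1 : E[X])) := Finite.of_equiv _ θ.symm.toEquiv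
    have h1 := (sameStabCard_of_equivalent_image θ W hlr hequiv).1.1
    have h2 := ncard_le_ncard_leftStab hT
    rw [h1, hl] at h2
    have h3 := hcard.trans h2
    rw [hE, ← pow_mul] at h3
    have h4 := (Nat.pow_le_pow_iff_right hq).1 h3
    nlinarith
  have hcardL : ∀ (L : Type u) [Field L] [Algebra E L], Module.finrank E L = 2 * t →
      Nat.card E ^ t ≤ (Set.univ : Set L).ncard := by
    intro L _ _ hn
    have : FiniteDimensional E L := Module.finite_of_finrank_pos (by lia)
    rw [Set.ncard_univ, Module.natCard_eq_pow_finrank (K := E) (V := L), hn]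
    exact Nat.pow_le_pow_right Nat.card_pos (by lia)
  have hS : ∀ {K L : Type u} [Field K] [Finite K] [Field L] [Algebra K L]
      (_ : Module.finrank K L = 2 * t) (σ : L ≃ₐ[K] L) (_ : IsGenerator σ)
      (F : K[X]) (_ : F.Monic) (_ : Irreducible F) (_ : F ≠ X)
      (θ : SkewQuot σ F ≃+* Matrix (Fin (2 * t)) (Fin (2 * t)) E)
      (k' : ℕ) (_ : 1 ≤ k') (_ : k' < 2 * t) (ρ : L ≃+* L) (η : L)
      (_ : Algebra.norm (fixedBase K ρ) η * Algebra.norm (fixedBase K ρ)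
        ((-1 : K) ^ (F.natDegree * k' * (2 * t - 1)) * F.coeff 0 ^ k') ≠ 1)
      (_ : C₀ = θ '' codeS σ ρ F k' η), False := by
    rintro K L _ _ _ _ hn σ hσ F hF hirr hFX θ k' hk' hkn' ρ η hη rfl
    obtain ⟨⟨h1, h2, h3⟩, h4⟩ := sameStabCard_of_equivalent_image θ
      (codeSGroup (σ := σ) ρ F k' η (Nat.mul_pos hirr.natDegree_pos hk')) hlr hequiv
    rw [hc] at h4
    exact not_invariants_codeS hq ht hk hkt (by lia) hdvd hE hn hσ hF hirr hFX θ hk' hkn' hη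
      (h1.trans hl) (h2.trans hr) (h3.trans hz) h4
  cases hC₀ with
  | gabidulin L hn σ hσ θ k' hk' hkn' =>
    exact hT hn θ _ Set.univ (exists_addSubgroup_codeGabidulin k')
      (fun c _ => const_mem_leftStab_codeGabidulin k' c) (hcardL L hn) rfl
  | agtg L hn σ hσ θ k' hk' hkn' τ η hη =>
    have hd : (X - 1 : E[X]).natDegree = 1 := natDegree_X_sub_C 1
    refine hS hn σ hσ (X - 1) (monic_X_sub_C 1) (irreducible_X_sub_C 1) ?_ θ k' hk' hkn' τ η ?_
      (by rw [codeAGTG_eq_codeS])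
    · intro h
      have := congrArg (eval 0) h
      simp at this
    -- For F' = y - 1 the constant coefficient is -1 and s' = 1, so the sign exponent is k'(n - 1) +
    -- k' = k'n, which matches the norm condition of the AGTG codes.
    · have hpow : (-1 : E) ^ ((X - 1 : E[X]).natDegree * k' * (2 * t - 1)) *
          (X - 1 : E[X]).coeff 0 ^ k' = (-1) ^ (k' * (2 * t)) := by
        have h0 : (X - 1 : E[X]).coeff 0 = -1 := by simp
        rw [hd, h0, ← pow_add, one_mul, ← Nat.mul_succ, Nat.succ_eq_add_one,
          Nat.sub_add_cancel (by lia)]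
      rwa [hpow]
  | trombettiZhou L hn σ hσ θ k' hk' hkn' hn4 L' hL' γ hγ =>
    have : FiniteDimensional E L := Module.finite_of_finrank_pos (by lia)
    refine hT hn θ _ (L' : Set L) (exists_addSubgroup_codeTZ L' k' γ)
      (fun c hc => const_mem_leftStab_codeTZ k' γ hc) ?_ rfl
    rw [← Nat.card_coe_set_eq]
    refine le_of_eq ?_
    rw [show t = Module.finrank E L' by lia]
    exact (Module.natCard_eq_pow_finrank (K := E) (V := L')).symm
  | cmpz L hn σ hσ θ hcase =>
    exact hT hn θ _ Set.univ exists_addSubgroup_codeCMPZ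
      (fun c _ => const_mem_leftStab_codeCMPZ c) (hcardL L hn) rfl
  | scattered L hn σ hσ θ f hf =>
    exact hT hn θ _ Set.univ (exists_addSubgroup_codeTwoDim f)
      (fun c _ => const_mem_leftStab_codeTwoDim f c) (hcardL L hn) rfl
  | skewTwisted K L hn σ hσ F hF hirr hFX θ k' hk' hkn' ρ η hη =>
    exact hS hn σ hσ F hF hirr hFX θ k' hk' hkn' ρ η hη rfl

end New

/-! ### Existence of admissible pairs. -/

section Admissible

/-- F is the minimal polynomial of a generator of E over K. Its constant coefficient is nonzero, so
by surjectivity of the norm γ can be chosen to make the expression any prescribed nonsquare, which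
exists in odd characteristic. -/
theorem exists_admissible {K L E : Type u} [Field K] [Finite K] [Field L] [Algebra K L]
    [FiniteDimensional K L] [Field E] [Algebra K E] [FiniteDimensional K E]
    (hq : Odd (Nat.card K)) (hE : 2 ≤ Module.finrank K E) (k : ℕ) :
    ∃ (F : K[X]) (γ : L), F.Monic ∧ Irreducible F ∧ F.natDegree = Module.finrank K E ∧
      ¬ IsSquare ((-1) ^ (Module.finrank K E * k) * F.coeff 0 ^ k * Algebra.norm K γ) := by
  have : Fintype K := Fintype.ofFinite K
  have : Finite L := Module.finite_of_finite K
  have hchar : ringChar K ≠ 2 := by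
    intro h
    have := FiniteField.even_card_iff_char_two.1 h
    rw [Nat.card_eq_fintype_card, Nat.odd_iff] at hq
    lia
  set pb := Field.powerBasisOfFiniteOfSeparable K E
  set F := minpoly K pb.gen with hFdef
  have hint : IsIntegral K pb.gen := Algebra.IsIntegral.isIntegral _
  have hdeg : F.natDegree = Module.finrank K E := by
    rw [hFdef, pb.natDegree_minpoly, pb.finrank]
  have hirr : Irreducible F := minpoly.irreducible hint
  have hF : F.Monic := minpoly.monic hint
  have h0 : F.coeff 0 ≠ 0 := coeff_zero_ne_of_isCoprime
    (isCoprime_X_of_irreducible hF hirr fun h => by rw [h, natDegree_X] at hdeg; lia)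
  obtain ⟨a, ha⟩ := FiniteField.exists_nonsquare hchar
  obtain ⟨γ, hγ⟩ := FiniteField.norm_surjective K L
    (((-1) ^ (Module.finrank K E * k) * F.coeff 0 ^ k)⁻¹ * a)
  refine ⟨F, γ, hF, hirr, hdeg, ?_⟩
  rwa [hγ, mul_inv_cancel_left₀]
  exact mul_ne_zero (pow_ne_zero _ (neg_ne_zero.2 one_ne_zero)) (pow_ne_zero _ h0)

end Admissible

end SkewMRD

/-! ### Assembly of the main theorem. -/

theorem mainTheorem11 {K L E : Type u} [Field K] [Finite K] [Field L] [Algebra K L]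
    [Field E] [Algebra K E] (t k s : ℕ)
    (hq : Odd (Nat.card K)) (ht : 2 ≤ t) (hk : 1 < k) (hkt : k ≤ t) (hs : 3 ≤ s)
    (hdvd : ¬ 2 * t ∣ s * k)
    (hL : Module.finrank K L = 2 * t) (hE : Module.finrank K E = s)
    (σ : L ≃ₐ[K] L) (hσ : SkewMRD.IsGenerator σ)
    (L' : IntermediateField K L) (hL' : Module.finrank K L' = t) :
    (∃ (F : Polynomial K) (γ : L), F.Monic ∧ Irreducible F ∧ F.natDegree = s ∧
      ¬ IsSquare ((-1) ^ (s * k) * F.coeff 0 ^ k * Algebra.norm K γ)) ∧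
    ∀ (F : Polynomial K) (γ : L), F.Monic → Irreducible F → F.natDegree = s →
      ¬ IsSquare ((-1) ^ (s * k) * F.coeff 0 ^ k * Algebra.norm K γ) →
      Nonempty (SkewMRD.SkewQuot σ F ≃+* Matrix (Fin (2 * t)) (Fin (2 * t)) E) ∧
      ∀ θ : SkewMRD.SkewQuot σ F ≃+* Matrix (Fin (2 * t)) (Fin (2 * t)) E,
        SkewMRD.IsLinearMRD K (θ '' SkewMRD.codeD σ L' F k γ) (2 * t - k + 1) ∧
        SkewMRD.HasNuclearParameters (θ '' SkewMRD.codeD σ L' F k γ)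
          (Nat.card K ^ (2 * t * s * k)) (Nat.card K ^ t) (Nat.card K ^ t) (Nat.card K ^ s)
          (Nat.card K) ∧
        SkewMRD.IsNew (θ '' SkewMRD.codeD σ L' F k γ) := by
  have hfL : FiniteDimensional K L := Module.finite_of_finrank_pos (by lia)
  have hfE : FiniteDimensional K E := Module.finite_of_finrank_pos (by lia)
  have hE' : Finite E := Module.finite_of_finite K
  have hcardE : Nat.card E = Nat.card K ^ s := by
    rw [Module.natCard_eq_pow_finrank (K := K) (V := E), hE]
  constructor
  · have := SkewMRD.exists_admissible (L := L) (E := E) hq (by lia) k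
    rwa [hE] at this
  rintro F γ hF hirr rfl hγ
  have hFX : F ≠ X := fun h => by
    rw [h, natDegree_X] at hs
    lia
  have hγ0 : γ ≠ 0 := by
    rintro rfl
    exact hγ ⟨0, by simp⟩
  have hr2 : 2 ≤ F.natDegree * k := by nlinarith
  have hrN : F.natDegree * k + 2 ≤ 2 * t * F.natDegree := by nlinarith
  refine ⟨SkewMRD.nonempty_ringEquiv_matrix hσ hL (by lia) hF hirr hFX hcardE, fun θ => ?_⟩
  have hpar := SkewMRD.hasNuclearParameters_codeD hσ hL (by lia) hF
    (SkewMRD.isCoprime_X_of_irreducible hF hirr hFX) hγ0 (by lia) hr2 hrN hL' rfl θ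
  refine ⟨SkewMRD.isLinearMRD_codeD hσ hL ⟨t, two_mul t⟩ hF hirr hE θ (by lia) (by lia)
    (by rw [hL']) hγ, by rwa [hcardE, ← mul_assoc] at hpar, ?_⟩
  obtain ⟨-, h1, h2, h3, -, h5⟩ := hpar
  -- The centraliser is the full centre of the matrix ring, so the last nuclear parameter is the
  -- centre invariant used in `isNew_of_invariants`.
  have hcentre : SkewMRD.centraliser (θ '' SkewMRD.codeD σ L' F k γ) = Set.center _ := by
    refine Set.ext fun A => ⟨fun hA => ?_, fun hA M _ => ?_⟩
    · obtain ⟨z, rfl⟩ := θ.surjective A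
      rw [← SkewMRD.image_center_eq θ]
      refine ⟨z, Semigroup.mem_center_iff.2 (SkewMRD.commute_of_commute_codeD (L' := L') (γ := γ) hr2
        (SkewMRD.isCoprime_X_of_irreducible hF hirr hFX) fun m hm => θ.injective ?_), rfl⟩
      rw [map_mul, map_mul]
      exact hA _ ⟨m, hm, rfl⟩
    · exact (Semigroup.mem_center_iff.1 hA M).symm
  rw [SkewMRD.centre, hcentre] at h5
  exact SkewMRD.isNew_of_invariants
    (V := (SkewMRD.codeDGroup (σ := σ) L' F k γ (by lia)).map
      (θ : SkewMRD.SkewQuot σ F →+ Matrix (Fin (2 * t)) (Fin (2 * t)) E))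
    Finite.one_lt_card ht hk hkt (by lia) hdvd hcardE h2 h3 h5 h1
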